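/- **Theorem 1.** Fix $d,p\ge 1$. *Test.* Let $X_1,X_2,\dots\in\mathbb R^d$ be nonstochastic design points and, for each $n$, let $Y_i=f(X_i)+\varepsilon_i\in\mathbb R^p$, $i=1,\dots,n$, with $E\varepsilon_i=0$ and $\Sigma_i=E[\varepsilon_i\varepsilon_i^T]$. For a kernel $K:\mathbb R^d\to[0,\infty)$ put $K_h(x)=K(x/h)/h^d$ and $w_h(X_i,X_j)=K_h(X_i-X_j)/\sum_{k=1}^nK_h(X_i-X_k)$. Let $H_n=\{h=h_{\max}a^k: k=0,1,2,\dots,\ h\ge h_{\min}\}$ with $a\in(0,1)$, $h_{\min}=h_{\min,n}>0$, let $I_{h}=I_{h,n}\subset\{1,\dots,n\}$ be sets of test points and $S_n=\{(i,m,h):h\in H_n,\ i\in I_{h,n},\ m=1,\dots,p\}$. Let $\hat\Sigma_i=\hat\Sigma_{i,n}$ be measurable functions of $(Y_1,\dots,Y_n)$ with values in the positive semidefinite $p\times p$ matrices. For $s=(i,m,h)$ put $\hat f_s=\sum_jw_h(X_i,X_j)Y_{j,m}$, $\hat V_s^2=\sum_jw_h(X_i,X_j)^2\hat\Sigma_{j,mm}$,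 and $\hat T=\max_{s\in S_n}\hat f_s/\hat V_s$. Let $\alpha\in(0,1)$, $\beta_n>0$, $0<\gamma_n<\alpha/2$, and let $g_0:\mathbb R\to[0,1]$ be nonincreasing and twice continuously differentiable (in particular, any thrice differentiable nonincreasing function will do), with $g_0=1$ on $(-\infty,0]$ and $g_0=0$ on $[1,\infty)$. Given the data, let $\tilde Y_i\sim N(0,\hat\Sigma_i)$ be independent and, for nonempty $A\subset S_n$ and $q\in(0,1)$, let $c_q(A)$ be the (smallest) solution $c$ of $E[g_0((T_A-c)/\beta_n)\mid Y_1,\dots,Y_n]=q$, where $T_A=\max_{(i,m,h)\in A}\sum_jw_h(X_i,X_j)\tilde Y_{j,m}/\hat V_{i,m,h}$. Put $c^{PIA}_q=c_q(S_n)$, $S^{RMS}_n=\{s\in S_n:\hat f_s/\hat V_s>-2(c^{PIA}_{1-\gamma_n}+\beta_n)\}$, $c^{RMS}_{q}=c_q(S^{RMS}_n)$, and $$g^{PIA}_{1-\alpha}(x)=g_0\big((x-c^{PIA}_{1-\alpha})/\beta_n\big),\qquad g^{RMS}_{1-\alpha}(x)=g_0\big((x-c^{RMS}_{1-\alpha+2\gamma_n})/\beta_n\big),$$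 with $g^{RMS}_{1-\alpha}\equiv1$ if $S_n^{RMS}=\emptyset$. The randomized test accepts the null hypothesis with probability $g^{P}_{1-\alpha}(\hat T)$, $P\in\{PIA,RMS\}$. *Models.* Let $[\tau]$ be the largest integer strictly smaller than $\tau$. Let $\mathcal F(\tau,L)$ be the class of $g:\mathbb R^d\to\mathbb R$ with continuous partial derivatives up to order $[\tau]$ such that $|D^{\lambda}g(x)-D^{\lambda}g(y)|\le L\|x-y\|^{\tau-[\tau]}$ for all $x,y$ and all multi-indices $|\lambda|=[\tau]$. If $\tau\le1$, put $\varsigma=0$ and $\mathcal F_\varsigma(\tau,L)=\mathcal F(\tau,L)$. If $\tau>1$ and $1\le\varsigma\le[\tau]$, let $\mathcal F_\varsigma(\tau,L)$ be the class of $g\in\mathcal F(\tau,L)$ such that, with $g^{(k,l)}$ the $k$-th derivative in the unit direction $l$, $g^{(1,l)}(x)=0$ implies $g^{(k,l)}(x)=0$ for $k=1,\dots,\varsigma$, and $g^{(1,l)}(x)=0\ne g^{(\varsigma+1,l)}(x)$ for some $x,l$. Fix $\tau\ge1/4$, $L>0$, such a $\varsigma$, and positive constants $C_f,C,C',c,\delta$.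 For each $n$, $\mathcal G$ is the class of models $w=(f^w,\text{law of }(\varepsilon_1,\dots,\varepsilon_n))$ such that * the $\varepsilon_i$ are independent and centered, $E|\varepsilon_{i,m}|^{4+\delta}\le C$, $\Sigma_{i,mm}\ge c$, and the entries of $\Sigma_i$ and the mixed fourth moments of the components of $\varepsilon_i$ differ from those of $\varepsilon_j$ by at most $C'\|X_i-X_j\|$, for all $i,j\le n$ and all components; * each component $f_m$ is either identically zero, or belongs to $\mathcal F_\varsigma(\tau,L)$ with $|D^{\lambda}f_m|\le C_f$ for all $|\lambda|=\varsigma+1$ if $\varsigma<[\tau]$. $\mathcal G_0$ is the set of $w\in\mathcal G$ with $f^w_m(X_i)\le0$ for all $m$ and all $i\le n$. *Assumptions.* * $\|X_i\|<h_{\max}$ for all $i$; and with $M_h(X_i)=\#\{j\le n:\|X_j-X_i\|\le h\}$ there are $0<C_1<C_2$ such that for all large $n$, $M_{h/2}(X_i)\ge C_1nh^d$ and $M_h(X_i)\le C_2nh^d$ for all $i\in\mathbb N$, $h\in H_n$. * $h_{\min,n}\to0$, and $|H_n|\le C_3\log n$ for some constant $C_3$ and all large $n$. * For some $0<\phi<1/(2+d)$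 and $\kappa=1/(2+d)-\phi$, $\max_{i\le n}\|\hat\Sigma_i-\Sigma_i\|=o_p(n^{-\kappa})$ in spectral norm, uniformly over $w\in\mathcal G_0$. * $0\le K\le1$, $K(x)=0$ for $\|x\|>1$, and $K(x)\ge C_4$ for $\|x\|\le1/2$ with some $C_4\in(0,1)$. * $\beta_n$ is bounded and $(\log n)^4/(\beta_n^{10}h_{\min,n}^{3d}n)\to0$. * For all $n$ and $h\in H_n$: $\|X_i-X_j\|>2h$ for all distinct $i,j\in I_{h,n}$, and every $i\le n$ has some $j\in I_{h,n}$ with $\|X_i-X_j\|\le2h$. *Conclusion.* As $n\to\infty$, for $P=PIA$ and $P=RMS$, $$\inf_{w\in\mathcal G_0}E_w[g^{P}_{1-\alpha}(\hat T)]\ge1-\alpha+o(1).$$ Moreover $E_w[g^{PIA}_{1-\alpha}(\hat T)]=1-\alpha+o(1)$ uniformly over $w\in\mathcal G_0$ with $f^w\equiv0$ (so that the supremum over these $w$ tends to $1-\alpha$), and if $\gamma_n\to0$ the same holds for $g^{RMS}_{1-\alpha}$. -/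

import Mathlib

open MeasureTheory ProbabilityTheory Filter Topology

noncomputable section

namespace CMITest

/-- Euclidean space of dimension `k`. -/
abbrev Vec (k : ℕ) := EuclideanSpace ℝ (Fin k)

/-! ### Hölder classes -/

/-- `[τ]`: the largest integer strictly smaller than `τ` (for `τ > 0`). -/
def strictFloor (τ : ℝ) : ℕ := ⌈τ⌉₊ - 1

/-- The iterated partial derivative `∂^k g / ∂x_{j 0} ⋯ ∂x_{j (k-1)}` at `x`. For functions with
continuous partial derivatives up to order `k`, letting `j` range over all maps `Fin k → Fin d`
amounts to letting the multi-index range over all multi-indices of order `k`. -/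
def partialD {d k : ℕ} (g : Vec d → ℝ) (j : Fin k → Fin d) (x : Vec d) : ℝ :=
  iteratedFDeriv ℝ k g x (fun i => EuclideanSpace.single (j i) (1 : ℝ))

/-- The `k`-th derivative of `g` at `x` in the direction `l`. -/
def dirD {d : ℕ} (k : ℕ) (g : Vec d → ℝ) (l x : Vec d) : ℝ :=
  iteratedDeriv k (fun t : ℝ => g (x + t • l)) 0

/-- The Hölder class `𝓕(τ, L)`. -/
def HolderClass {d : ℕ} (τ L : ℝ) (g : Vec d → ℝ) : Prop :=
  ContDiff ℝ (strictFloor τ) g ∧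
    ∀ (j : Fin (strictFloor τ) → Fin d) (x y : Vec d),
      |partialD g j x - partialD g j y| ≤ L * ‖x - y‖ ^ (τ - strictFloor τ)

/-- The subclass `𝓕_ς(τ, L)`; it is all of `𝓕(τ, L)` when `τ ≤ 1`. -/
def RestrictedHolderClass {d : ℕ} (ς : ℕ) (τ L : ℝ) (g : Vec d → ℝ) : Prop :=
  HolderClass τ L g ∧
    (1 < τ →
      (∀ x l : Vec d, ‖l‖ = 1 → dirD 1 g l x = 0 → ∀ k, 1 ≤ k → k ≤ ς → dirD k g l x = 0) ∧
      ∃ x l : Vec d, ‖l‖ = 1 ∧ dirD 1 g l x = 0 ∧ dirD (ς + 1) g l x ≠ 0)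

/-! ### Models -/

/-- A model for a sample of size `n`: a regression function `f = (f_1, …, f_p)` on `ℝ^d` and the
laws of the disturbances `ε_1, …, ε_n` in `ℝ^p` (which are independent). -/
structure Model (d p n : ℕ) where
  f : Fin p → Vec d → ℝ
  noise : Fin n → Measure (Vec p)

/-- The constants which determine the class of models. -/
structure ModelConstants where
  τ : ℝ
  L : ℝ
  ς : ℕ
  Cf : ℝ
  δ : ℝ
  Cmom : ℝ
  Clip : ℝ
  cvar : ℝ

/-- Admissible values of the constants. -/
def ModelConstants.Admissible (c : ModelConstants) : Prop :=
  1 / 4 ≤ c.τ ∧ 0 < c.L ∧ 0 < c.Cf ∧ 0 < c.δ ∧ 0 < c.Cmom ∧ 0 < c.Clip ∧ 0 < c.cvar ∧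
    ((c.τ ≤ 1 ∧ c.ς = 0) ∨ (1 < c.τ ∧ 1 ≤ c.ς ∧ c.ς ≤ strictFloor c.τ))

namespace Model

variable {d p n : ℕ}

/-- The covariance matrix `Σ_i = E[ε_i ε_iᵀ]`. -/
def cov (w : Model d p n) (i : Fin n) : Matrix (Fin p) (Fin p) ℝ :=
  Matrix.of fun m₁ m₂ => ∫ e, e m₁ * e m₂ ∂(w.noise i)

/-- The mixed fourth moments of `ε_i`. -/
def fourthMoment (w : Model d p n) (i : Fin n) (m₁ m₂ m₃ m₄ : Fin p) : ℝ :=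
  ∫ e, e m₁ * e m₂ * e m₃ * e m₄ ∂(w.noise i)

/-- The joint law of the independent disturbances `(ε_1, …, ε_n)`. -/
def noiseLaw (w : Model d p n) : Measure (Fin n → Vec p) := Measure.pi w.noise

/-- The responses `Y_i = f(X_i) + ε_i`. -/
def response (w : Model d p n) (X : ℕ → Vec d) (e : Fin n → Vec p) : Fin n → Vec p :=
  fun i => WithLp.toLp 2 fun m => w.f m (X i) + e i m

/-- The condition on the disturbances. -/
def DisturbanceCondition (c : ModelConstants) (X : ℕ → Vec d) (w : Model d p n) : Prop :=
  (∀ i, IsProbabilityMeasure (w.noise i)) ∧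
  (∀ i m, Integrable (fun e : Vec p => |e m| ^ (4 + c.δ)) (w.noise i) ∧
    ∫ e, |e m| ^ (4 + c.δ) ∂(w.noise i) ≤ c.Cmom) ∧
  (∀ i m, ∫ e, e m ∂(w.noise i) = 0) ∧
  (∀ i j m₁ m₂, |w.cov i m₁ m₂ - w.cov j m₁ m₂| ≤ c.Clip * ‖X i - X j‖) ∧
  (∀ i j m₁ m₂ m₃ m₄, |w.fourthMoment i m₁ m₂ m₃ m₄ - w.fourthMoment j m₁ m₂ m₃ m₄| ≤
    c.Clip * ‖X i - X j‖) ∧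
  (∀ i m, c.cvar ≤ w.cov i m m)

/-- The condition on the regression function. The identically zero component, for which the order
of degeneracy `ς` is not defined, is admitted. -/
def RegressionCondition (c : ModelConstants) (w : Model d p n) : Prop :=
  ∀ m, w.f m = 0 ∨
    (RestrictedHolderClass c.ς c.τ c.L (w.f m) ∧
      (c.ς < strictFloor c.τ →
        ∀ (j : Fin (c.ς + 1) → Fin d) (x : Vec d), |partialD (w.f m) j x| ≤ c.Cf))

/-- The class `𝓖` of models (for samples of size `n`). -/
def InClass (c : ModelConstants) (X : ℕ → Vec d) (w : Model d p n) : Prop :=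
  w.DisturbanceCondition c X ∧ w.RegressionCondition c

/-- The class `𝓖₀` of models in `𝓖` which satisfy the null hypothesis `f(X_i) ≤ 0`. -/
def InNullClass (c : ModelConstants) (X : ℕ → Vec d) (w : Model d p n) : Prop :=
  w.InClass c X ∧ ∀ (m : Fin p) (i : Fin n), w.f m (X i) ≤ 0

end Model

/-! ### The test -/

/-- All ingredients of the test: design points `X`, kernel `K`, bandwidth parameters
`hmax`, `a`, `hmin n`, sets of test points `I n h`, the function `g₀`, the randomization widths
`β n`, the truncation parameters `γ n`, the nominal level `α` and the estimators
`covHat n Y i` of `Σ_i` from the responses `Y = (Y_1, …, Y_n)`. -/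
structure Design (d p : ℕ) where
  X : ℕ → Vec d
  K : Vec d → ℝ
  hmax : ℝ
  a : ℝ
  hmin : ℕ → ℝ
  I : (n : ℕ) → ℝ → Finset (Fin n)
  g₀ : ℝ → ℝ
  β : ℕ → ℝ
  γ : ℕ → ℝ
  α : ℝ
  covHat : (n : ℕ) → (Fin n → Vec p) → Fin n → Matrix (Fin p) (Fin p) ℝ

/-- The number `c` with `E[g₀((T - c) / β)] = q`, where `T` is a random variable on `(Ω, μ)`
(the smallest such number, should there be several). -/
def smoothedQuantile {Ω : Type*} [MeasurableSpace Ω] (g₀ : ℝ → ℝ) (β : ℝ) (μ : Measure Ω)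
    (T : Ω → ℝ) (q : ℝ) : ℝ :=
  sInf {c : ℝ | ∫ z, g₀ ((T z - c) / β) ∂μ = q}

namespace Design

variable {d p : ℕ} (D : Design d p)

/-- The set `H_n` of bandwidth values. -/
def bandwidths (n : ℕ) : Set ℝ := {h | (∃ k : ℕ, h = D.hmax * D.a ^ k) ∧ D.hmin n ≤ h}

/-- The number `M_h(X_i)` of the design points among `X_1, …, X_n` within distance `h` of `X_i`. -/
def localCount (n : ℕ) (h : ℝ) (i : ℕ) : ℕ :=
  Set.ncard {j : Fin n | ‖D.X j - D.X i‖ ≤ h}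

/-- `K_h(x) = K(x / h) / h^d`. -/
def scaledKernel (h : ℝ) (x : Vec d) : ℝ := D.K (h⁻¹ • x) / h ^ d

/-- The weight `w_h(X_i, X_j)`. -/
def weight (n : ℕ) (h : ℝ) (i j : Fin n) : ℝ :=
  D.scaledKernel h (D.X i - D.X j) / ∑ k : Fin n, D.scaledKernel h (D.X i - D.X k)

/-- The index set `S_n` of triples `(i, m, h)`. -/
def indexSet (n : ℕ) : Set (Fin n × Fin p × ℝ) :=
  {s | s.2.2 ∈ D.bandwidths n ∧ s.1 ∈ D.I n s.2.2}

/-- The kernel smoother `∑_j w_h(X_i, X_j) y_{j,m}`, for `s = (i, m, h)`. -/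
def smooth (n : ℕ) (y : Fin n → Vec p) (s : Fin n × Fin p × ℝ) : ℝ :=
  ∑ j : Fin n, D.weight n s.2.2 s.1 j * y j s.2.1

/-- The estimated standard deviation `V̂_s`, computed from the responses `Y`. -/
def sdHat (n : ℕ) (Y : Fin n → Vec p) (s : Fin n × Fin p × ℝ) : ℝ :=
  √(∑ j : Fin n, D.weight n s.2.2 s.1 j ^ 2 * D.covHat n Y j s.2.1 s.2.1)

/-- The test statistic `T̂ = max_{s ∈ S_n} f̂_s / V̂_s`. -/
def stat (n : ℕ) (Y : Fin n → Vec p) : ℝ :=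
  sSup ((fun s => D.smooth n Y s / D.sdHat n Y s) '' D.indexSet n)

/-- The law of the simulated sample: independent `Ỹ_i ∼ N(0, Σ̂_i)`, given the responses `Y`. -/
def simLaw (n : ℕ) (Y : Fin n → Vec p) : Measure (Fin n → Vec p) :=
  Measure.pi fun i => multivariateGaussian 0 (D.covHat n Y i)

/-- The simulated statistic `max_{s ∈ A} (∑_j w_h(X_i, X_j) Ỹ_{j,m}) / V̂_s`. -/
def simStat (n : ℕ) (Y : Fin n → Vec p) (A : Set (Fin n × Fin p × ℝ)) (z : Fin n → Vec p) : ℝ :=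
  sSup ((fun s => D.smooth n z s / D.sdHat n Y s) '' A)

/-- The critical value at level `q` based on the indices in `A`. -/
def critical (n : ℕ) (Y : Fin n → Vec p) (A : Set (Fin n × Fin p × ℝ)) (q : ℝ) : ℝ :=
  smoothedQuantile D.g₀ (D.β n) (D.simLaw n Y) (D.simStat n Y A) q

/-- The plug-in critical value `c_q^{PIA}`. -/
def cPIA (n : ℕ) (Y : Fin n → Vec p) (q : ℝ) : ℝ := D.critical n Y (D.indexSet n) q

/-- The selected set `S^{RMS}`. -/
def rmsSet (n : ℕ) (Y : Fin n → Vec p) : Set (Fin n × Fin p × ℝ) :=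
  {s ∈ D.indexSet n |
    -2 * (D.cPIA n Y (1 - D.γ n) + D.β n) < D.smooth n Y s / D.sdHat n Y s}

/-- `g_{1-α}^{PIA}(T̂)`: the probability, given the responses `Y`, with which the plug-in test
accepts the null hypothesis. -/
def acceptPIA (n : ℕ) (Y : Fin n → Vec p) : ℝ :=
  D.g₀ ((D.stat n Y - D.cPIA n Y (1 - D.α)) / D.β n)

open Classical in
/-- `g_{1-α}^{RMS}(T̂)`: the probability, given the responses `Y`, with which the test with refined
moment selection accepts. If no index is selected, there is no simulated statistic, and the null
hypothesis is accepted. -/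
def acceptRMS (n : ℕ) (Y : Fin n → Vec p) : ℝ :=
  if (D.rmsSet n Y).Nonempty then
    D.g₀ ((D.stat n Y - D.critical n Y (D.rmsSet n Y) (1 - D.α + 2 * D.γ n)) / D.β n)
  else 1

/-- `E_w[φ(Y_1, …, Y_n)]`. -/
def expect {n : ℕ} (w : Model d p n) (φ : (Fin n → Vec p) → ℝ) : ℝ :=
  ∫ e, φ (w.response D.X e) ∂w.noiseLaw

/-! ### Assumptions -/

/-- The level, and the choice of the function `g₀` and of the sequences `β` and `γ`. -/
def TuningCondition : Prop :=
  0 < D.α ∧ D.α < 1 ∧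
  ContDiff ℝ 2 D.g₀ ∧ Antitone D.g₀ ∧ (∀ x ≤ 0, D.g₀ x = 1) ∧ (∀ x, 1 ≤ x → D.g₀ x = 0) ∧
  (∀ n, 0 < D.β n) ∧ (∀ n, 0 < D.γ n ∧ D.γ n < D.α / 2)

/-- Design points: they lie in the ball of radius `hmax`, and the number of design points in a
neighbourhood of a design point is of the order of `n h^d`. The lower bound is required for the
ball of radius `h / 2`, the region where the kernel is bounded away from zero. -/
def DesignPointCondition : Prop :=
  (∀ i, ‖D.X i‖ < D.hmax) ∧
  ∃ C₁ C₂ : ℝ, 0 < C₁ ∧ C₁ < C₂ ∧ ∀ᶠ n : ℕ in atTop, ∀ i : ℕ, ∀ h ∈ D.bandwidths n,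
    C₁ * n * h ^ d ≤ D.localCount n (h / 2) i ∧ (D.localCount n h i : ℝ) ≤ C₂ * n * h ^ d

/-- Bandwidth values. -/
def BandwidthCondition : Prop :=
  0 < D.a ∧ D.a < 1 ∧ (∀ n, 0 < D.hmin n) ∧ Tendsto D.hmin atTop (𝓝 0) ∧
  ∃ C : ℝ, 0 < C ∧ ∀ᶠ n : ℕ in atTop, ((D.bandwidths n).ncard : ℝ) ≤ C * Real.log n

/-- `covHat` consists of measurable functions of the responses with values in the positive
semidefinite matrices. -/
def CovEstimator : Prop :=
  (∀ n i m₁ m₂, Measurable fun Y => D.covHat n Y i m₁ m₂) ∧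
  (∀ n Y i, (D.covHat n Y i).PosSemidef)

/-- `max_i ‖Σ̂_i - Σ_i‖ = o_p(n^{-κ})` in the spectral norm, uniformly over the models in `𝓖₀`. -/
def VarianceEstimatorCondition (c : ModelConstants) (κ : ℝ) : Prop :=
  ∀ η : ℝ, 0 < η → ∀ ε : ℝ, 0 < ε → ∀ᶠ n : ℕ in atTop, ∀ w : Model d p n,
    w.InNullClass c D.X →
      w.noiseLaw.real {e | ∃ i : Fin n, η * (n : ℝ) ^ (-κ) ≤
        ‖Matrix.toEuclideanCLM (𝕜 := ℝ) (D.covHat n (w.response D.X e) i - w.cov i)‖} ≤ ε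

/-- The kernel. -/
def KernelCondition : Prop :=
  (∀ x, 0 ≤ D.K x) ∧ (∀ x, 1 < ‖x‖ → D.K x = 0) ∧ (∀ x, D.K x ≤ 1) ∧
  ∃ C : ℝ, 0 < C ∧ C < 1 ∧ ∀ x, ‖x‖ ≤ 1 / 2 → C ≤ D.K x

/-- The randomization widths. -/
def TestFunctionCondition : Prop :=
  (∃ C : ℝ, 0 < C ∧ ∀ n, D.β n ≤ C) ∧
  Tendsto (fun n : ℕ => Real.log n ^ 4 / (D.β n ^ 10 * D.hmin n ^ (3 * d) * n)) atTop (𝓝 0)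

/-- The sets of test points. -/
def TestPointCondition : Prop :=
  ∀ n, ∀ h ∈ D.bandwidths n,
    (∀ i ∈ D.I n h, ∀ j ∈ D.I n h, i ≠ j → 2 * h < ‖D.X i - D.X j‖) ∧
    (∀ i : Fin n, ∃ j ∈ D.I n h, ‖D.X i - D.X j‖ ≤ 2 * h)

end Design

end CMITest

end

/-! Under the null hypothesis every studentized statistic has nonpositive drift, so `stat` is at
most the maximum of the studentized smoothed noise, with equality when the regression function
vanishes. The law of this maximum and the law of the simulated maximum are both compared with one
deterministic object, `gaussCdf`: the smoothed distribution function of the maximum of unit-variance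
Gaussian variables having the true covariances. `ApproxAt` records the result. For every nonempty
set of indices and at every level, the smoothed distribution function of the noise maximum (with
either sign) is within `η` of `gaussCdf`. Off an event of probability at most `η`, so is the
simulated one.

Non-Gaussian noise is replaced by Gaussian noise by Lindeberg's method. The step function is
approximated within `η` by a function `f` with three derivatives bounded by a constant `G` that does
not depend on `n`, and the maximum by b⁻¹ log ∑ exp(b xᵢ), whose derivatives are bounded free of the
dimension. With b of order log n the smoothing error is small, and the third-order error is of order
(log n)² / (β³ (n h_min^{3d})^{1/2}), which the assumption on `β` sends to zero. Gaussian vectors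
with different covariances are compared by the same method: each is the law of a normalized sum of m
independent copies, and as m → ∞ only the second-order error survives.

Uniformity over narrow steps, and the passage from true to estimated standard deviations, rest on
anti-concentration: the maximum of N unit-variance Gaussians gives [c, c + l] mass at most e³ l y +
N exp(-(y - l)² / 2). To see this, decompose by the index of the maximum, condition on the residuals
of the other variables, and compare the normal mass of the interval with that of the adjacent
interval of length 1 / y.

For the plug-in test, the random critical value is bracketed by deterministic quantiles of
`gaussCdf`, and both claims follow. For refined moment selection, let b be, up to the width β, about
a 1 - γ quantile of the noise maximum, and let F be the indices with drift at least -(b - 1). With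
probability about 1 - γ no noise falls below -b, and then F is selected, so the critical value is at
least that of F. Statistics outside F must not exceed the critical value. If some pair of component
and bandwidth contains many statistics of moderately negative drift, a fixed number of them is
selected; being uncorrelated they force the critical value above 2, which the statistics outside F
cannot reach. Otherwise such statistics are so few (of the order of the number of bandwidths, hence
at most logarithmic in the number of test points at one bandwidth) that their noise stays well below
b. The added 2γ in the level pays for the two events on which the noise leaves [-b, b]. -/

namespace CMITest

/-! ### Third-order Taylor bounds on the line -/

/-- `g` is bounded and has three derivatives `g₁`, `g₂`, `g₃`, all of them bounded by `G`. -/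
structure ThreeDeriv (g g₁ g₂ g₃ : ℝ → ℝ) (G : ℝ) : Prop where
  d₁ : ∀ x, HasDerivAt g (g₁ x) x
  d₂ : ∀ x, HasDerivAt g₁ (g₂ x) x
  d₃ : ∀ x, HasDerivAt g₂ (g₃ x) x
  b₁ : ∀ x, |g₁ x| ≤ G
  b₂ : ∀ x, |g₂ x| ≤ G
  b₃ : ∀ x, |g₃ x| ≤ G
  bdd : ∃ M, ∀ x, |g x| ≤ M

lemma ThreeDeriv.nonneg {g g₁ g₂ g₃ : ℝ → ℝ} {G : ℝ} (h : ThreeDeriv g g₁ g₂ g₃ G) : 0 ≤ G :=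
  (abs_nonneg _).trans (h.b₁ 0)

lemma le_of_hasDerivAt_nonpos {f f' : ℝ → ℝ} (hf : ∀ t, HasDerivAt f (f' t) t)
    (h : ∀ t, 0 ≤ t → f' t ≤ 0) {t : ℝ} (ht : 0 ≤ t) : f t ≤ f 0 := by
  have : AntitoneOn f (Set.Ici 0) := by
    refine antitoneOn_of_deriv_nonpos (convex_Ici 0)
      (fun x _ => (hf x).continuousAt.continuousWithinAt)
      (fun x _ => (hf x).differentiableAt.differentiableWithinAt) fun x hx => ?_
    rw [interior_Ici] at hx
    rw [(hf x).deriv]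
    exact h x (le_of_lt hx)
  exact this (by simp) ht ht

/-- The bound on the third derivative is integrated three times, each time as the monotonicity of
the difference from a polynomial on [0, ∞). No continuity of `f₃` is needed. -/
lemma taylor_three_le {f f₁ f₂ f₃ : ℝ → ℝ} {M : ℝ} (h₁ : ∀ t, HasDerivAt f (f₁ t) t)
    (h₂ : ∀ t, HasDerivAt f₁ (f₂ t) t) (h₃ : ∀ t, HasDerivAt f₂ (f₃ t) t)
    (hM : ∀ t, f₃ t ≤ M) : f 1 - f 0 - f₁ 0 - f₂ 0 / 2 ≤ M / 6 := by
  have e₂ : ∀ t, 0 ≤ t → f₂ t - M * t ≤ f₂ 0 := by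
    intro t ht
    have := le_of_hasDerivAt_nonpos (f := fun t => f₂ t - M * t) (f' := fun t => f₃ t - M * 1)
      (fun t => (h₃ t).sub ((hasDerivAt_id t).const_mul M)) (fun t _ => by linarith [hM t]) ht
    simpa using this
  have e₁ : ∀ t, 0 ≤ t → f₁ t - f₂ 0 * t - M / 2 * t ^ 2 ≤ f₁ 0 := by
    intro t ht
    have := le_of_hasDerivAt_nonpos (f := fun t => f₁ t - f₂ 0 * t - M / 2 * t ^ 2)
      (f' := fun t => f₂ t - f₂ 0 * 1 - M / 2 * (2 * t))
      (fun t => ((h₂ t).sub ((hasDerivAt_id t).const_mul _)).sub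
        (by simpa using (hasDerivAt_pow 2 t).const_mul (M / 2)))
      (fun t ht => by linarith [e₂ t ht]) ht
    simpa using this
  have := le_of_hasDerivAt_nonpos (f := fun t => f t - f₁ 0 * t - f₂ 0 / 2 * t ^ 2 - M / 6 * t ^ 3)
      (f' := fun t => f₁ t - f₁ 0 * 1 - f₂ 0 / 2 * (2 * t) - M / 6 * (3 * t ^ 2))
      (fun t => (((h₁ t).sub ((hasDerivAt_id t).const_mul _)).sub
        (by simpa using (hasDerivAt_pow 2 t).const_mul (f₂ 0 / 2))).sub
        (by simpa using (hasDerivAt_pow 3 t).const_mul (M / 6)))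
      (fun t ht => by linarith [e₁ t ht]) (t := 1) zero_le_one
  simp only [mul_one, one_pow, mul_zero, sub_zero, ne_eq, OfNat.ofNat_ne_zero, not_false_eq_true,
    zero_pow] at this
  linarith

lemma abs_taylor_three_le {f f₁ f₂ f₃ : ℝ → ℝ} {M : ℝ} (h₁ : ∀ t, HasDerivAt f (f₁ t) t)
    (h₂ : ∀ t, HasDerivAt f₁ (f₂ t) t) (h₃ : ∀ t, HasDerivAt f₂ (f₃ t) t)
    (hM : ∀ t, |f₃ t| ≤ M) : |f 1 - f 0 - f₁ 0 - f₂ 0 / 2| ≤ M / 6 := by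
  rw [abs_le]
  have a := taylor_three_le h₁ h₂ h₃ fun t => (le_abs_self _).trans (hM t)
  have b := taylor_three_le (f := -f) (f₁ := -f₁) (f₂ := -f₂) (f₃ := -f₃) (M := M)
    (fun t => (h₁ t).neg) (fun t => (h₂ t).neg)
    (fun t => (h₃ t).neg) fun t => (neg_le_abs _).trans (hM t)
  simp only [Pi.neg_apply] at b
  constructor <;> linarith

/-! ### The smooth maximum and its expansion along a line -/

section SmoothMax

variable {ι : Type*} [Fintype ι] [Nonempty ι]

/-- The partition function of the smooth maximum. -/
noncomputable def expSum (b : ℝ) (x : ι → ℝ) : ℝ := ∑ i, Real.exp (b * x i)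

/-- The smooth maximum `b⁻¹ log ∑ᵢ exp (b xᵢ)`. -/
noncomputable def smax (b : ℝ) (x : ι → ℝ) : ℝ := b⁻¹ * Real.log (expSum b x)

/-- The weights of the smooth maximum. -/
noncomputable def softWeight (b : ℝ) (x : ι → ℝ) (i : ι) : ℝ := Real.exp (b * x i) / expSum b x

/-- The moments of `v` under the weights of the smooth maximum. -/
noncomputable def softMoment (b : ℝ) (x v : ι → ℝ) (k : ℕ) : ℝ := ∑ i, softWeight b x i * v i ^ k

lemma expSum_pos (b : ℝ) (x : ι → ℝ) : 0 < expSum b x :=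
  Finset.sum_pos (fun _ _ => Real.exp_pos _) Finset.univ_nonempty

lemma softWeight_nonneg (b : ℝ) (x : ι → ℝ) (i : ι) : 0 ≤ softWeight b x i :=
  div_nonneg (Real.exp_pos _).le (expSum_pos b x).le

lemma sum_softWeight (b : ℝ) (x : ι → ℝ) : ∑ i, softWeight b x i = 1 := by
  simp_rw [softWeight, ← Finset.sum_div]
  exact div_self (expSum_pos b x).ne'

lemma abs_softMoment_le (b : ℝ) (x v : ι → ℝ) (k : ℕ) : |softMoment b x v k| ≤ ‖v‖ ^ k := by
  calc |softMoment b x v k| ≤ ∑ i, |softWeight b x i * v i ^ k| := Finset.abs_sum_le_sum_abs _ _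
    _ ≤ ∑ i, softWeight b x i * ‖v‖ ^ k := by
        refine Finset.sum_le_sum fun i _ => ?_
        rw [abs_mul, abs_of_nonneg (softWeight_nonneg b x i), abs_pow]
        have : |v i| ≤ ‖v‖ := norm_le_pi_norm v i
        gcongr
        exact softWeight_nonneg b x i
    _ = ‖v‖ ^ k := by rw [← Finset.sum_mul, sum_softWeight, one_mul]

lemma le_smax {b : ℝ} (hb : 0 < b) (x : ι → ℝ) (i : ι) : x i ≤ smax b x := by
  have : b * x i ≤ Real.log (expSum b x) := by
    rw [Real.le_log_iff_exp_le (expSum_pos b x)]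
    exact Finset.single_le_sum (f := fun i => Real.exp (b * x i)) (fun _ _ => (Real.exp_pos _).le)
      (Finset.mem_univ i)
  rw [smax, ← div_eq_inv_mul, le_div_iff₀ hb]
  linarith

/-- The sum of exponentials is at most the number of terms times the largest one. Together with
`le_smax` this brackets the smooth maximum between the maximum and the maximum plus (log N) / b. -/
lemma smax_le {b : ℝ} (hb : 0 < b) {x : ι → ℝ} {m : ℝ} (h : ∀ i, x i ≤ m) :
    smax b x ≤ m + Real.log (Fintype.card ι) / b := by
  have hcard : (0 : ℝ) < Fintype.card ι := by exact_mod_cast Fintype.card_pos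
  have h1 : expSum b x ≤ Fintype.card ι * Real.exp (b * m) := by
    calc expSum b x ≤ ∑ _i : ι, Real.exp (b * m) :=
          Finset.sum_le_sum fun i _ => Real.exp_le_exp.2 (mul_le_mul_of_nonneg_left (h i) hb.le)
      _ = _ := by simp
  have h2 : Real.log (expSum b x) ≤ Real.log (Fintype.card ι) + b * m := by
    calc _ ≤ Real.log (Fintype.card ι * Real.exp (b * m)) :=
          Real.log_le_log (expSum_pos b x) h1
      _ = _ := by rw [Real.log_mul hcard.ne' (Real.exp_pos _).ne', Real.log_exp]
  calc smax b x ≤ b⁻¹ * (Real.log (Fintype.card ι) + b * m) := by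
        unfold smax; gcongr
    _ = _ := by field_simp; ring

omit [Fintype ι] [Nonempty ι] in
lemma hasDerivAt_exp_line (b : ℝ) (x v : ι → ℝ) (i : ι) (t : ℝ) :
    HasDerivAt (fun t => Real.exp (b * (x + t • v) i))
      (Real.exp (b * (x + t • v) i) * (b * v i)) t := by
  have : HasDerivAt (fun t : ℝ => b * (x + t • v) i) (b * v i) t := by
    simp only [Pi.add_apply, Pi.smul_apply, smul_eq_mul]
    simpa using (((hasDerivAt_id t).mul_const (v i)).const_add (x i)).const_mul b
  exact this.exp

lemma hasDerivAt_expSum_line (b : ℝ) (x v : ι → ℝ) (t : ℝ) :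
    HasDerivAt (fun t => expSum b (x + t • v))
      (expSum b (x + t • v) * (b * softMoment b (x + t • v) v 1)) t := by
  have h := HasDerivAt.fun_sum (u := Finset.univ) fun i _ => hasDerivAt_exp_line b x v i t
  convert! h using 1
  have := (expSum_pos b (x + t • v)).ne'
  simp only [softMoment, softWeight, Finset.mul_sum]
  refine Finset.sum_congr rfl fun i _ => ?_
  field_simp

lemma hasDerivAt_smax_line {b : ℝ} (hb : 0 < b) (x v : ι → ℝ) (t : ℝ) :
    HasDerivAt (fun t => smax b (x + t • v)) (softMoment b (x + t • v) v 1) t := by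
  have := ((hasDerivAt_expSum_line b x v t).log (expSum_pos b _).ne').const_mul b⁻¹
  convert! this using 1
  have := (expSum_pos b (x + t • v)).ne'
  field_simp

/-- The weights form a Gibbs measure, so differentiating along `v` produces `b` times the covariance
of `v ^ k` and `v`. -/
lemma hasDerivAt_softMoment_line (b : ℝ) (x v : ι → ℝ) (k : ℕ) (t : ℝ) :
    HasDerivAt (fun t => softMoment b (x + t • v) v k)
      (b * (softMoment b (x + t • v) v (k + 1) -
        softMoment b (x + t • v) v k * softMoment b (x + t • v) v 1)) t := by
  have hne := (expSum_pos b (x + t • v)).ne'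
  have h := HasDerivAt.fun_sum (u := Finset.univ) fun i _ =>
    (((hasDerivAt_exp_line b x v i t).fun_div (hasDerivAt_expSum_line b x v t) hne).mul_const
      (v i ^ k))
  convert! h using 1
  rw [mul_sub]
  conv_lhs => rw [softMoment, softMoment, Finset.sum_mul, Finset.mul_sum, Finset.mul_sum,
    ← Finset.sum_sub_distrib]
  refine Finset.sum_congr rfl fun i _ => ?_
  simp only [softWeight]
  field_simp
  ring

/-- The second derivative of `g ∘ smax` at `x` in the direction `v`. -/
noncomputable def secondTerm (g₁ g₂ : ℝ → ℝ) (b : ℝ) (x v : ι → ℝ) : ℝ :=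
  g₂ (smax b x) * softMoment b x v 1 ^ 2 +
    g₁ (smax b x) * (b * (softMoment b x v 2 - softMoment b x v 1 ^ 2))

variable {g g₁ g₂ g₃ : ℝ → ℝ} {G : ℝ}

/-- Along the segment from `x` to `x + v` the derivatives are cumulants of `v` under the Gibbs
weights. As the weights sum to one, these are controlled by the sup norm of `v`, whatever the number
of coordinates. The third derivative costs at most two factors of `b`. -/
lemma abs_smooth_max_expansion_le (hg : ThreeDeriv g g₁ g₂ g₃ G) {b : ℝ} (hb : 1 ≤ b)
    (x v : ι → ℝ) :
    |g (smax b (x + v)) - g (smax b x) - g₁ (smax b x) * softMoment b x v 1 -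
      secondTerm g₁ g₂ b x v / 2| ≤ 13 * G * b ^ 2 * ‖v‖ ^ 3 / 6 := by
  have hb0 : 0 < b := by linarith
  set m : ℝ → ℝ := fun t => smax b (x + t • v) with hm
  set A : ℕ → ℝ → ℝ := fun k t => softMoment b (x + t • v) v k with hA
  have dm : ∀ t, HasDerivAt m (A 1 t) t := hasDerivAt_smax_line hb0 x v
  have dA : ∀ k t, HasDerivAt (A k) (b * (A (k + 1) t - A k t * A 1 t)) t :=
    hasDerivAt_softMoment_line b x v
  have h₁ : ∀ t, HasDerivAt (fun t => g (m t)) (g₁ (m t) * A 1 t) t := fun t =>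
    (hg.d₁ (m t)).comp t (dm t)
  have h₂ : ∀ t, HasDerivAt (fun t => g₁ (m t) * A 1 t)
      (g₂ (m t) * A 1 t ^ 2 + g₁ (m t) * (b * (A 2 t - A 1 t ^ 2))) t := fun t => by
    convert! ((hg.d₂ (m t)).comp t (dm t)).mul (dA 1 t) using 1
    simp only [Function.comp]; ring
  have h₃ : ∀ t, HasDerivAt (fun t => g₂ (m t) * A 1 t ^ 2 + g₁ (m t) * (b * (A 2 t - A 1 t ^ 2)))
      (g₃ (m t) * A 1 t ^ 3 + 3 * (g₂ (m t) * A 1 t * (b * (A 2 t - A 1 t ^ 2))) +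
        g₁ (m t) * (b ^ 2 * (A 3 t - 3 * A 1 t * A 2 t + 2 * A 1 t ^ 3))) t := fun t => by
    have e₁ := ((hg.d₃ (m t)).comp t (dm t)).mul ((dA 1 t).fun_pow 2)
    have e₂ := ((hg.d₂ (m t)).comp t (dm t)).mul
      (((dA 2 t).fun_sub ((dA 1 t).fun_pow 2)).const_mul b)
    convert! e₁.add e₂ using 1
    simp only [Function.comp]; push_cast; ring
  have key := abs_taylor_three_le h₁ h₂ h₃ (M := 13 * G * b ^ 2 * ‖v‖ ^ 3) fun t => by
    have B := fun k => abs_softMoment_le b (x + t • v) v k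
    have a1 : |A 1 t| ≤ ‖v‖ := by simpa using B 1
    have a2 : |A 2 t| ≤ ‖v‖ ^ 2 := B 2
    have a3 : |A 3 t| ≤ ‖v‖ ^ 3 := B 3
    have R0 : 0 ≤ ‖v‖ := norm_nonneg v
    have G0 := hg.nonneg
    have q2 : |A 2 t - A 1 t ^ 2| ≤ 2 * ‖v‖ ^ 2 := by
      calc _ ≤ |A 2 t| + |A 1 t ^ 2| := abs_sub _ _
        _ ≤ ‖v‖ ^ 2 + ‖v‖ ^ 2 := by rw [abs_pow]; gcongr
        _ = _ := by ring
    have q3 : |A 3 t - 3 * A 1 t * A 2 t + 2 * A 1 t ^ 3| ≤ 6 * ‖v‖ ^ 3 := by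
      calc _ ≤ |A 3 t| + |3 * A 1 t * A 2 t| + |2 * A 1 t ^ 3| :=
            (abs_add_le _ _).trans (add_le_add_left (abs_sub _ _) _)
        _ = |A 3 t| + 3 * |A 1 t| * |A 2 t| + 2 * |A 1 t| ^ 3 := by
            simp only [abs_mul, abs_pow, Nat.abs_ofNat]
        _ ≤ ‖v‖ ^ 3 + 3 * ‖v‖ * ‖v‖ ^ 2 + 2 * ‖v‖ ^ 3 := by gcongr
        _ = _ := by ring
    have t1 : |g₃ (m t) * A 1 t ^ 3| ≤ G * ‖v‖ ^ 3 := by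
      rw [abs_mul, abs_pow]; gcongr; exact hg.b₃ _
    have t2 : |3 * (g₂ (m t) * A 1 t * (b * (A 2 t - A 1 t ^ 2)))| ≤ 6 * G * b * ‖v‖ ^ 3 := by
      rw [abs_mul, abs_mul, abs_mul, abs_mul, abs_of_pos hb0]
      calc _ ≤ |(3 : ℝ)| * (G * ‖v‖ * (b * (2 * ‖v‖ ^ 2))) := by gcongr; exact hg.b₂ _
        _ = _ := by rw [abs_of_pos (by norm_num : (0 : ℝ) < 3)]; ring
    have t3 : |g₁ (m t) * (b ^ 2 * (A 3 t - 3 * A 1 t * A 2 t + 2 * A 1 t ^ 3))| ≤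
        6 * G * b ^ 2 * ‖v‖ ^ 3 := by
      rw [abs_mul, abs_mul, abs_of_pos (pow_pos hb0 2)]
      calc _ ≤ G * (b ^ 2 * (6 * ‖v‖ ^ 3)) := by gcongr; exact hg.b₁ _
        _ = _ := by ring
    calc _ ≤ G * ‖v‖ ^ 3 + 6 * G * b * ‖v‖ ^ 3 + 6 * G * b ^ 2 * ‖v‖ ^ 3 :=
          (abs_add_le _ _).trans (add_le_add ((abs_add_le _ _).trans (add_le_add t1 t2)) t3)
      _ = G * ‖v‖ ^ 3 * (1 + 6 * b + 6 * b ^ 2) := by ring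
      -- The constant is 13 = 1 + 6 + 6; `1 ≤ b` lets the lower powers of `b` be absorbed.
      _ ≤ G * ‖v‖ ^ 3 * (13 * b ^ 2) := by gcongr; nlinarith
      _ = _ := by ring
  simp only [hm, hA, one_smul, zero_smul, add_zero] at key
  exact key

end SmoothMax

/-! ### Smooth approximation of the step -/

/-- The smooth approximant can be chosen equal to `g` off (-1, 2), because `g` is locally constant
near that closed set. Its derivative then has compact support, so all three derivatives are bounded.
The bound depends on `g` and `η` only, which later allows `b` of logarithmic size. -/
lemma exists_threeDeriv_approx {g : ℝ → ℝ} (hg : Continuous g) (h₀ : ∀ x ≤ 0, g x = 1)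
    (h₁ : ∀ x, 1 ≤ x → g x = 0) (hb : ∀ x, |g x| ≤ 1) {η : ℝ} (hη : 0 < η) :
    ∃ f f₁ f₂ f₃ G, ThreeDeriv f f₁ f₂ f₃ G ∧ ∀ x, |f x - g x| ≤ η := by
  set S : Set ℝ := Set.Iic (-1) ∪ Set.Ici 2
  set U : Set ℝ := Set.Iio 0 ∪ Set.Ioi 1
  have hSU : S ⊆ U := Set.union_subset_union (fun x (hx : x ≤ -1) => show x < 0 by linarith)
    (fun x (hx : 2 ≤ x) => show 1 < x by linarith)
  have hU : IsOpen U := isOpen_Iio.union isOpen_Ioi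
  have hUS : U ∈ 𝓝ˢ S := hU.mem_nhdsSet.2 hSU
  have hsm : ContDiffOn ℝ ((⊤ : ℕ∞) : WithTop ℕ∞) g U := by
    intro x hx
    refine ContDiffAt.contDiffWithinAt ?_
    rcases hx with hx | hx
    · exact (contDiffAt_const (c := (1 : ℝ))).congr_of_eventuallyEq
        ((eventually_lt_nhds hx).mono fun y hy => h₀ y hy.le)
    · exact (contDiffAt_const (c := (0 : ℝ))).congr_of_eventuallyEq
        ((eventually_gt_nhds hx).mono fun y hy => h₁ y hy.le)
  obtain ⟨f, hf, hfg, hfS, -⟩ := hg.exists_contDiff_approx_and_eqOn (⊤ : ℕ∞)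
    (continuous_const (y := η)) (fun _ => hη) (isClosed_Iic.union isClosed_Ici) hUS hsm
  have hd : ContDiff ℝ ((⊤ : ℕ∞) : WithTop ℕ∞) (deriv f) := (contDiff_infty_iff_deriv.1 hf).2
  have hdd : ContDiff ℝ ((⊤ : ℕ∞) : WithTop ℕ∞) (deriv (deriv f)) :=
    (contDiff_infty_iff_deriv.1 hd).2
  have hddd : ContDiff ℝ ((⊤ : ℕ∞) : WithTop ℕ∞) (deriv (deriv (deriv f))) :=
    (contDiff_infty_iff_deriv.1 hdd).2
  have hc : HasCompactSupport (deriv f) := by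
    refine HasCompactSupport.intro (isCompact_Icc (a := (-1 : ℝ)) (b := 2)) fun x hx => ?_
    rw [Set.mem_Icc, not_and_or, not_le, not_le] at hx
    rcases hx with hx | hx
    · have : f =ᶠ[𝓝 x] fun _ => 1 := (eventually_lt_nhds hx).mono fun y hy =>
        (hfS (Or.inl hy.le)).trans (h₀ y (by linarith))
      rw [this.deriv_eq, deriv_const]
    · have : f =ᶠ[𝓝 x] fun _ => 0 := (eventually_gt_nhds hx).mono fun y hy =>
        (hfS (Or.inr hy.le)).trans (h₁ y (by linarith))
      rw [this.deriv_eq, deriv_const]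
  obtain ⟨G₁, hG₁⟩ := hc.exists_bound_of_continuous hd.continuous
  obtain ⟨G₂, hG₂⟩ := hc.deriv.exists_bound_of_continuous hdd.continuous
  obtain ⟨G₃, hG₃⟩ := hc.deriv.deriv.exists_bound_of_continuous hddd.continuous
  refine ⟨f, deriv f, deriv (deriv f), deriv (deriv (deriv f)), max G₁ (max G₂ G₃),
    ⟨fun x => ((hf.differentiable (by simp)) x).hasDerivAt,
      fun x => ((hd.differentiable (by simp)) x).hasDerivAt,
      fun x => ((hdd.differentiable (by simp)) x).hasDerivAt,
      fun x => (hG₁ x).trans (le_max_left _ _),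
      fun x => (hG₂ x).trans ((le_max_left _ _).trans (le_max_right _ _)),
      fun x => (hG₃ x).trans ((le_max_right _ _).trans (le_max_right _ _)),
      1 + η, fun x => ?_⟩, fun x => by simpa [Real.dist_eq] using (hfg x).le⟩
  have := (hfg x).le
  rw [Real.dist_eq] at this
  calc |f x| = |g x + (f x - g x)| := by ring_nf
    _ ≤ |g x| + |f x - g x| := abs_add_le _ _
    _ ≤ 1 + η := add_le_add (hb x) this

/-! ### One Lindeberg swap -/

section Swap

variable {ι : Type*} [Fintype ι] [Nonempty ι]

lemma continuous_smax {b : ℝ} : Continuous (smax (ι := ι) b) := by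
  unfold smax expSum
  refine continuous_const.mul (Continuous.log (by fun_prop) fun x => (expSum_pos b x).ne')

variable {g g₁ g₂ g₃ : ℝ → ℝ} {G : ℝ}

lemma ThreeDeriv.continuous (hg : ThreeDeriv g g₁ g₂ g₃ G) : Continuous g :=
  continuous_iff_continuousAt.2 fun x => (hg.d₁ x).continuousAt

/-- The coefficients of the quadratic form `secondTerm`. -/
noncomputable def secondCoeff (g₁ g₂ : ℝ → ℝ) (b : ℝ) (x : ι → ℝ) (i k : ι) : ℝ :=
  open Classical in
  (g₂ (smax b x) - g₁ (smax b x) * b) * (softWeight b x i * softWeight b x k) +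
    if i = k then g₁ (smax b x) * b * softWeight b x i else 0

omit [Nonempty ι] in
lemma secondTerm_eq (b : ℝ) (x v : ι → ℝ) :
    secondTerm g₁ g₂ b x v = ∑ i, ∑ k, secondCoeff g₁ g₂ b x i k * (v i * v k) := by
  classical
  have h1 : softMoment b x v 1 ^ 2 =
      ∑ i, ∑ k, softWeight b x i * softWeight b x k * (v i * v k) := by
    rw [sq, softMoment, Finset.sum_mul_sum]
    refine Finset.sum_congr rfl fun i _ => Finset.sum_congr rfl fun k _ => by ring
  have h2 : softMoment b x v 2 =
      ∑ i, ∑ k, if i = k then softWeight b x i * (v i * v k) else 0 := by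
    rw [softMoment]
    refine Finset.sum_congr rfl fun i _ => ?_
    rw [Finset.sum_ite_eq, if_pos (Finset.mem_univ i)]; ring
  have : secondTerm g₁ g₂ b x v = (g₂ (smax b x) - g₁ (smax b x) * b) * softMoment b x v 1 ^ 2 +
      g₁ (smax b x) * b * softMoment b x v 2 := by unfold secondTerm; ring
  rw [this, h1, h2]
  simp only [Finset.mul_sum, ← Finset.sum_add_distrib]
  refine Finset.sum_congr rfl fun i _ => Finset.sum_congr rfl fun k _ => ?_
  unfold secondCoeff
  split_ifs <;> ring

/-- The weights sum to one, so the entries of the Hessian of `g ∘ smax` have a dimension-free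
absolute sum. Hence covariances need only be close entrywise, without a factor for the number of
entries. -/
lemma sum_abs_secondCoeff_le (hg : ThreeDeriv g g₁ g₂ g₃ G) {b : ℝ} (hb : 1 ≤ b) (x : ι → ℝ) :
    ∑ i, ∑ k, |secondCoeff g₁ g₂ b x i k| ≤ 3 * G * b := by
  classical
  have hb0 : 0 < b := by linarith
  have hG := hg.nonneg
  have hw := softWeight_nonneg b x
  calc ∑ i, ∑ k, |secondCoeff g₁ g₂ b x i k|
      ≤ ∑ i, ∑ k, ((G + G * b) * (softWeight b x i * softWeight b x k) +
          if i = k then G * b * softWeight b x i else 0) := by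
        refine Finset.sum_le_sum fun i _ => Finset.sum_le_sum fun k _ => ?_
        refine (abs_add_le _ _).trans (add_le_add ?_ ?_)
        · rw [abs_mul, abs_of_nonneg (mul_nonneg (hw i) (hw k))]
          refine mul_le_mul_of_nonneg_right ?_ (mul_nonneg (hw i) (hw k))
          refine (abs_sub _ _).trans (add_le_add (hg.b₂ _) ?_)
          rw [abs_mul, abs_of_pos hb0]
          exact mul_le_mul_of_nonneg_right (hg.b₁ _) hb0.le
        · split_ifs
          · rw [abs_mul, abs_mul, abs_of_pos hb0, abs_of_nonneg (hw i)]
            gcongr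
            · exact hw i
            · exact hg.b₁ _
          · simp
    _ = (G + G * b) + G * b := by
        simp only [Finset.sum_add_distrib, ← Finset.mul_sum, Finset.sum_ite_eq, Finset.mem_univ,
          if_true, sum_softWeight, mul_one]
    _ ≤ 3 * G * b := by nlinarith

variable {Ω Ω' : Type*} [MeasurableSpace Ω] [MeasurableSpace Ω']

omit [Nonempty ι] in
lemma _root_.MeasureTheory.MemLp.integrable_eval_mul {P : Measure Ω} [IsProbabilityMeasure P]
    {X : Ω → ι → ℝ} (hX : MemLp X 3 P) (i k : ι) : Integrable (fun ω => X ω i * X ω k) P := by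
  have h : ∀ i, MemLp (fun ω => X ω i) 2 P := fun i =>
    ((memLp_pi_iff.1 hX) i).mono_exponent (by norm_num)
  exact (h i).integrable_mul (h k)

/-- Averaging the expansion at `y`: the linear term vanishes because `X` is centred, and the
quadratic term depends on `X` through its second moments alone. -/
lemma abs_integral_smooth_max_sub_le (hg : ThreeDeriv g g₁ g₂ g₃ G) {b : ℝ} (hb : 1 ≤ b)
    {P : Measure Ω} [IsProbabilityMeasure P] {X : Ω → ι → ℝ} (hX : MemLp X 3 P)
    (hX0 : ∀ i, ∫ ω, X ω i ∂P = 0) (y : ι → ℝ) :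
    |∫ ω, g (smax b (y + X ω)) ∂P - (g (smax b y) +
      (∑ i, ∑ k, secondCoeff g₁ g₂ b y i k * ∫ ω, X ω i * X ω k ∂P) / 2)| ≤
      13 * G * b ^ 2 / 6 * ∫ ω, ‖X ω‖ ^ 3 ∂P := by
  have hi : ∀ i, Integrable (fun ω => X ω i) P := fun i =>
    ((memLp_pi_iff.1 hX) i).integrable (by norm_num)
  have hii := hX.integrable_eval_mul
  have h3 : Integrable (fun ω => ‖X ω‖ ^ 3) P := by
    have := hX.integrable_norm_pow (p := 3) (by norm_num)
    exact_mod_cast this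
  obtain ⟨M, hM⟩ := hg.bdd
  have hF : Integrable (fun ω => g (smax b (y + X ω))) P := by
    refine Integrable.of_bound (C := M) ?_ (ae_of_all _ fun ω => hM _)
    exact (hg.continuous.comp continuous_smax).comp_aestronglyMeasurable
      (hX.aestronglyMeasurable.const_add y)
  have hlin : Integrable (fun ω => g₁ (smax b y) * softMoment b y (X ω) 1) P := by
    simp only [softMoment, pow_one]
    exact (integrable_finsetSum _ fun i _ => (hi i).const_mul _).const_mul _
  have hlin0 : ∫ ω, g₁ (smax b y) * softMoment b y (X ω) 1 ∂P = 0 := by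
    simp only [softMoment, pow_one]
    rw [integral_const_mul, integral_finsetSum _ fun i _ => (hi i).const_mul _]
    simp [integral_const_mul, hX0]
  have hsec : Integrable (fun ω => secondTerm g₁ g₂ b y (X ω)) P := by
    simp only [secondTerm_eq]
    exact integrable_finsetSum _ fun i _ => integrable_finsetSum _ fun k _ => (hii i k).const_mul _
  have hsec0 : ∫ ω, secondTerm g₁ g₂ b y (X ω) ∂P =
      ∑ i, ∑ k, secondCoeff g₁ g₂ b y i k * ∫ ω, X ω i * X ω k ∂P := by
    simp only [secondTerm_eq]
    rw [integral_finsetSum _ fun i _ => integrable_finsetSum _ fun k _ => (hii i k).const_mul _]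
    refine Finset.sum_congr rfl fun i _ => ?_
    rw [integral_finsetSum _ fun k _ => (hii i k).const_mul _]
    simp [integral_const_mul]
  have e : ∫ ω, g (smax b (y + X ω)) ∂P - (g (smax b y) +
      (∑ i, ∑ k, secondCoeff g₁ g₂ b y i k * ∫ ω, X ω i * X ω k ∂P) / 2) =
      ∫ ω, (g (smax b (y + X ω)) - g (smax b y) - g₁ (smax b y) * softMoment b y (X ω) 1 -
        secondTerm g₁ g₂ b y (X ω) / 2) ∂P := by
    have i1 : Integrable (fun ω => g (smax b (y + X ω)) - g (smax b y)) P :=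
      hF.sub (integrable_const _)
    have i2 : Integrable (fun ω => g (smax b (y + X ω)) - g (smax b y) -
      g₁ (smax b y) * softMoment b y (X ω) 1) P := i1.sub hlin
    rw [integral_sub i2 (hsec.div_const 2), integral_sub i1 hlin,
      integral_sub hF (integrable_const _), hlin0, integral_div, hsec0]
    simp only [integral_const, probReal_univ, one_smul]
    ring
  rw [e, ← integral_const_mul, ← Real.norm_eq_abs]
  refine norm_integral_le_of_norm_le (h3.const_mul _) (ae_of_all _ fun ω => ?_)
  rw [Real.norm_eq_abs]
  refine (abs_smooth_max_expansion_le hg hb y (X ω)).trans_eq (by ring)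

/-- One step of the Lindeberg replacement. -/
lemma abs_integral_swap_le (hg : ThreeDeriv g g₁ g₂ g₃ G) {b : ℝ} (hb : 1 ≤ b)
    {P : Measure Ω} [IsProbabilityMeasure P] {X : Ω → ι → ℝ} (hX : MemLp X 3 P)
    (hX0 : ∀ i, ∫ ω, X ω i ∂P = 0)
    {Q : Measure Ω'} [IsProbabilityMeasure Q] {Y : Ω' → ι → ℝ} (hY : MemLp Y 3 Q)
    (hY0 : ∀ i, ∫ ω, Y ω i ∂Q = 0) {Δ : ℝ}
    (hΔ : ∀ i k, |∫ ω, X ω i * X ω k ∂P - ∫ ω, Y ω i * Y ω k ∂Q| ≤ Δ) (y : ι → ℝ) :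
    |∫ ω, g (smax b (y + X ω)) ∂P - ∫ ω, g (smax b (y + Y ω)) ∂Q| ≤
      3 * G * b * Δ + 3 * G * b ^ 2 * (∫ ω, ‖X ω‖ ^ 3 ∂P + ∫ ω, ‖Y ω‖ ^ 3 ∂Q) := by
  have h1 := abs_integral_smooth_max_sub_le hg hb hX hX0 y
  have h2 := abs_integral_smooth_max_sub_le hg hb hY hY0 y
  have h3 : |(∑ i, ∑ k, secondCoeff g₁ g₂ b y i k * ∫ ω, X ω i * X ω k ∂P) -
      ∑ i, ∑ k, secondCoeff g₁ g₂ b y i k * ∫ ω, Y ω i * Y ω k ∂Q| ≤ 3 * G * b * Δ := by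
    simp only [← Finset.sum_sub_distrib, ← mul_sub]
    have hΔ0 : 0 ≤ Δ := (abs_nonneg _).trans (hΔ (Classical.arbitrary ι) (Classical.arbitrary ι))
    calc _ ≤ ∑ i, ∑ k, |secondCoeff g₁ g₂ b y i k| * Δ := by
          refine (Finset.abs_sum_le_sum_abs _ _).trans (Finset.sum_le_sum fun i _ => ?_)
          refine (Finset.abs_sum_le_sum_abs _ _).trans (Finset.sum_le_sum fun k _ => ?_)
          rw [abs_mul]
          gcongr
          exact hΔ i k
      _ = (∑ i, ∑ k, |secondCoeff g₁ g₂ b y i k|) * Δ := by simp only [Finset.sum_mul]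
      _ ≤ _ := mul_le_mul_of_nonneg_right (sum_abs_secondCoeff_le hg hb y) hΔ0
  have hG : 0 ≤ G * b ^ 2 := mul_nonneg hg.nonneg (by positivity)
  have i1 : 0 ≤ ∫ ω, ‖X ω‖ ^ 3 ∂P := integral_nonneg fun _ => by positivity
  have i2 : 0 ≤ ∫ ω, ‖Y ω‖ ^ 3 ∂Q := integral_nonneg fun _ => by positivity
  have j1 := mul_nonneg hG i1
  have j2 := mul_nonneg hG i2
  rw [abs_le] at h1 h2 h3 ⊢
  constructor <;> nlinarith [h1.1, h1.2, h2.1, h2.2, h3.1, h3.2]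

end Swap

/-! ### Swapping all the summands -/

section Telescope

variable {E : Type*} [NormedAddCommGroup E] [MeasurableSpace E] [BorelSpace E]
  [SecondCountableTopology E]
  {Ω : Type*} [MeasurableSpace Ω]

lemma integral_pi_succ_sum {n : ℕ} (μ : Fin (n + 1) → Measure Ω) [∀ i, IsProbabilityMeasure (μ i)]
    {X : Fin (n + 1) → Ω → E} (hX : ∀ i, Measurable (X i)) {F : E → ℝ} (hF : Measurable F)
    {M : ℝ} (hM : ∀ x, |F x| ≤ M) :
    ∫ ω, F (∑ i, X i (ω i)) ∂(Measure.pi μ) =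
      ∫ a, ∫ ω, F (X 0 a + ∑ i : Fin n, X i.succ (ω i)) ∂(Measure.pi fun i => μ i.succ) ∂(μ 0) := by
  rw [← ((measurePreserving_piFinSuccAbove μ 0).symm).integral_comp']
  simp_rw [MeasurableEquiv.piFinSuccAbove_symm_apply, Fin.insertNthEquiv, Fin.sum_univ_succ,
    Fin.insertNth_zero, Equiv.coe_fn_mk, Fin.cons_succ, Fin.zero_succAbove, Fin.cons_zero]
  refine integral_prod (μ := μ 0) (ν := Measure.pi fun i : Fin n => μ i.succ)
    (fun z => F (X 0 z.1 + ∑ i : Fin n, X i.succ (z.2 i))) ?_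
  refine Integrable.of_bound (C := M) (Measurable.aestronglyMeasurable ?_) (ae_of_all _ fun ω => hM _)
  exact hF.comp (((hX 0).comp measurable_fst).add (Finset.measurable_sum _ fun i _ =>
    (hX i.succ).comp ((measurable_pi_apply i).comp measurable_snd)))

/-- The Lindeberg replacement of all the summands of a sum of independent random vectors. -/
lemma abs_integral_pi_sub_le {n : ℕ} (μ ν : Fin n → Measure Ω) [∀ i, IsProbabilityMeasure (μ i)]
    [∀ i, IsProbabilityMeasure (ν i)] {X Y : Fin n → Ω → E} (hX : ∀ i, Measurable (X i))
    (hY : ∀ i, Measurable (Y i)) {F : E → ℝ} (hF : Measurable F) {M : ℝ} (hM : ∀ x, |F x| ≤ M)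
    {e : Fin n → ℝ}
    (h : ∀ i y, |∫ ω, F (y + X i ω) ∂(μ i) - ∫ ω, F (y + Y i ω) ∂(ν i)| ≤ e i) :
    |∫ ω, F (∑ i, X i (ω i)) ∂(Measure.pi μ) - ∫ ω, F (∑ i, Y i (ω i)) ∂(Measure.pi ν)| ≤
      ∑ i, e i := by
  -- The first summand is swapped with the sum of the others frozen (by Fubini) as the shift `y`.
  -- The remaining ones are handled by induction, applied to the translate of `F` by `Y 0 a`, which
  -- is why `F` is generalized.
  induction n generalizing F with
  | zero => simp
  | succ n ih =>
    rw [integral_pi_succ_sum μ hX hF hM, integral_pi_succ_sum ν hY hF hM]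
    set P := Measure.pi fun i : Fin n => μ i.succ
    set Q := Measure.pi fun i : Fin n => ν i.succ
    have hmX : Measurable fun ω : Fin n → Ω => ∑ i : Fin n, X i.succ (ω i) :=
      Finset.measurable_sum _ fun i _ => (hX i.succ).comp (measurable_pi_apply i)
    have hsX : ∀ (ρ : Measure Ω) [IsProbabilityMeasure ρ] (Z : Ω → E), Measurable Z →
        Integrable (fun z : Ω × (Fin n → Ω) => F (Z z.1 + ∑ i : Fin n, X i.succ (z.2 i)))
          (ρ.prod P) := fun ρ _ Z hZ =>
      Integrable.of_bound (C := M) (Measurable.aestronglyMeasurable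
        (hF.comp ((hZ.comp measurable_fst).add (hmX.comp measurable_snd))))
        (ae_of_all _ fun ω => hM _)
    have hmY : Measurable fun ω : Fin n → Ω => ∑ i : Fin n, Y i.succ (ω i) :=
      Finset.measurable_sum _ fun i _ => (hY i.succ).comp (measurable_pi_apply i)
    have hsY : Integrable (fun z : Ω × (Fin n → Ω) =>
        F (Y 0 z.1 + ∑ i : Fin n, Y i.succ (z.2 i))) ((ν 0).prod Q) :=
      Integrable.of_bound (C := M) (Measurable.aestronglyMeasurable
        (hF.comp (((hY 0).comp measurable_fst).add (hmY.comp measurable_snd))))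
        (ae_of_all _ fun ω => hM _)
    have s1 : |∫ a, ∫ ω, F (X 0 a + ∑ i : Fin n, X i.succ (ω i)) ∂P ∂(μ 0) -
        ∫ a, ∫ ω, F (Y 0 a + ∑ i : Fin n, X i.succ (ω i)) ∂P ∂(ν 0)| ≤ e 0 := by
      have w1 := integral_integral_swap (f := fun a (ω : Fin n → Ω) => F (X 0 a + ∑ i : Fin n, X i.succ (ω i)))
        (hsX (μ 0) _ (hX 0))
      have w2 := integral_integral_swap (f := fun a (ω : Fin n → Ω) => F (Y 0 a + ∑ i : Fin n, X i.succ (ω i)))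
        (hsX (ν 0) _ (hY 0))
      rw [w1, w2, ← integral_sub (hsX (μ 0) _ (hX 0)).integral_prod_right
          (hsX (ν 0) _ (hY 0)).integral_prod_right]
      have := norm_integral_le_of_norm_le_const (μ := P) (C := e 0) (f := fun (ω : Fin n → Ω) =>
        ∫ a, F (X 0 a + ∑ i : Fin n, X i.succ (ω i)) ∂(μ 0) -
          ∫ a, F (Y 0 a + ∑ i : Fin n, X i.succ (ω i)) ∂(ν 0)) (ae_of_all _ fun ω => by
          have := h 0 (∑ i : Fin n, X i.succ (ω i))
          simpa only [add_comm, Real.norm_eq_abs] using this)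
      simpa using this
    have s2 : |∫ a, ∫ ω, F (Y 0 a + ∑ i : Fin n, X i.succ (ω i)) ∂P ∂(ν 0) -
        ∫ a, ∫ ω, F (Y 0 a + ∑ i : Fin n, Y i.succ (ω i)) ∂Q ∂(ν 0)| ≤ ∑ i : Fin n, e i.succ := by
      rw [← integral_sub (hsX (ν 0) _ (hY 0)).integral_prod_left hsY.integral_prod_left]
      have := norm_integral_le_of_norm_le_const (μ := ν 0) (C := ∑ i : Fin n, e i.succ)
        (f := fun a => ∫ ω, F (Y 0 a + ∑ i : Fin n, X i.succ (ω i)) ∂P -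
          ∫ ω, F (Y 0 a + ∑ i : Fin n, Y i.succ (ω i)) ∂Q) (ae_of_all _ fun a => by
          refine ih (fun i => μ i.succ) (fun i => ν i.succ) (fun i => hX i.succ)
            (fun i => hY i.succ) (F := fun x => F (Y 0 a + x)) (hF.comp (measurable_const_add _))
            (fun x => hM _) fun i y => ?_
          simpa only [add_assoc] using h i.succ (Y 0 a + y))
      simpa using this
    rw [Fin.sum_univ_succ]
    exact (abs_sub_le _ _ _).trans (add_le_add s1 s2)

end Telescope

/-! ### Comparison of Gaussian vectors -/

section Comparison

variable {E : Type*} [NormedAddCommGroup E] [NormedSpace ℝ E] [MeasurableSpace E] [BorelSpace E]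
  [SecondCountableTopology E] [CompleteSpace E]

/-- A centred Gaussian measure is the law of the normalized sum of independent copies. -/
lemma map_pi_normalized_sum_eq_self (μ : Measure E) [IsGaussian μ]
    (h0 : ∀ L : StrongDual ℝ E, μ[L] = 0) {m : ℕ} (hm : 0 < m) :
    (Measure.pi fun _ : Fin m => μ).map (fun x => ∑ i, (√(m : ℝ))⁻¹ • x i) = μ := by
  have hmeas : Measurable fun x : Fin m → E => ∑ i, (√(m : ℝ))⁻¹ • x i := by fun_prop
  have := Measure.isProbabilityMeasure_map (μ := Measure.pi fun _ : Fin m => μ) hmeas.aemeasurable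
  refine Measure.ext_of_charFunDual (funext fun L => ?_)
  rw [charFunDual_apply, integral_map hmeas.aemeasurable
    (Measurable.aestronglyMeasurable (by fun_prop))]
  have : ∀ x : Fin m → E, Complex.exp (L (∑ i, (√(m : ℝ))⁻¹ • x i) * Complex.I) =
      ∏ i, Complex.exp (((√(m : ℝ))⁻¹ • L) (x i) * Complex.I) := fun x => by
    rw [← Complex.exp_sum, map_sum, Complex.ofReal_sum, Finset.sum_mul]
    simp
  simp_rw [this]
  rw [integral_fintype_prod_eq_prod (f := fun _ : Fin m => fun x : E =>
    Complex.exp (((√(m : ℝ))⁻¹ • L) x * Complex.I))]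
  have hV : Var[(((√(m : ℝ))⁻¹ • L : StrongDual ℝ E) : E → ℝ); μ] = (m : ℝ)⁻¹ * Var[L; μ] := by
    have : (((√(m : ℝ))⁻¹ • L : StrongDual ℝ E) : E → ℝ) = (√(m : ℝ))⁻¹ • (L : E → ℝ) := rfl
    rw [this, variance_smul, inv_pow, Real.sq_sqrt (Nat.cast_nonneg m)]
  have hL : ∫ x, Complex.exp (((√(m : ℝ))⁻¹ • L) x * Complex.I) ∂μ =
      Complex.exp (-((m : ℝ)⁻¹ * Var[L; μ] : ℝ) / 2) := by
    rw [← charFunDual_apply, IsGaussian.charFunDual_eq, integral_complex_ofReal, h0, hV]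
    simp [neg_div]
  rw [hL, IsGaussian.charFunDual_eq, integral_complex_ofReal, h0]
  simp only [Finset.prod_const, Finset.card_univ, Fintype.card_fin, ← Complex.exp_nat_mul]
  congr 1
  have : (m : ℂ) ≠ 0 := by exact_mod_cast hm.ne'
  push_cast
  field_simp
  simp

variable {ι : Type*} [Fintype ι] [Nonempty ι] {g g₁ g₂ g₃ : ℝ → ℝ} {G : ℝ}

/-- Comparison of the smooth maxima of two centred Gaussian vectors. -/
lemma abs_integral_gaussian_sub_le (hg : ThreeDeriv g g₁ g₂ g₃ G) {b : ℝ} (hb : 1 ≤ b)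
    (μ ν : Measure (ι → ℝ)) [IsGaussian μ] [IsGaussian ν]
    (hμ : ∀ i, ∫ x, x i ∂μ = 0) (hν : ∀ i, ∫ x, x i ∂ν = 0) {Δ : ℝ}
    (hΔ : ∀ i k, |∫ x, x i * x k ∂μ - ∫ x, x i * x k ∂ν| ≤ Δ) :
    |∫ x, g (smax b x) ∂μ - ∫ x, g (smax b x) ∂ν| ≤ 3 * G * b * Δ := by
  obtain ⟨M, hM⟩ := hg.bdd
  have hFm : Measurable fun x : ι → ℝ => g (smax b x) :=
    (hg.continuous.comp continuous_smax).measurable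
  have hdual : ∀ (ρ : Measure (ι → ℝ)) [IsGaussian ρ], (∀ i, ∫ x, x i ∂ρ = 0) →
      ∀ L : StrongDual ℝ (ι → ℝ), ρ[L] = 0 := by
    intro ρ _ h L
    have hint : Integrable (fun x : ι → ℝ => x) ρ := IsGaussian.integrable_fun_id
    rw [ContinuousLinearMap.integral_comp_comm L hint]
    have : ∫ x, x ∂ρ = 0 := by
      ext i
      rw [eval_integral fun i => hint.eval i]; exact h i
    rw [this, map_zero]
  set Cμ := ∫ x, ‖x‖ ^ 3 ∂μ
  set Cν := ∫ x, ‖x‖ ^ 3 ∂ν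
  -- Both Gaussians are written as sums of m copies scaled by m^{-1/2}. The m swaps contribute m ·
  -- (Δ / m) from the second moments and m · m^{-3/2} from the third, so the latter disappears as m
  -- → ∞.
  have key : ∀ m : ℕ, 0 < m → |∫ x, g (smax b x) ∂μ - ∫ x, g (smax b x) ∂ν| ≤
      3 * G * b * Δ + 3 * G * b ^ 2 * (Cμ + Cν) * (√(m : ℝ))⁻¹ := by
    intro m hm
    have hm' : (0 : ℝ) < m := by exact_mod_cast hm
    have hs : 0 < √(m : ℝ) := Real.sqrt_pos.2 hm'
    have hmeas : Measurable fun x : Fin m → ι → ℝ => ∑ i, (√(m : ℝ))⁻¹ • x i := by fun_prop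
    have repr : ∀ (ρ : Measure (ι → ℝ)) [IsGaussian ρ], (∀ i, ∫ x, x i ∂ρ = 0) →
        ∫ x, g (smax b x) ∂ρ =
          ∫ x, g (smax b (∑ i, (√(m : ℝ))⁻¹ • x i)) ∂(Measure.pi fun _ : Fin m => ρ) := by
      intro ρ _ h
      conv_lhs => rw [← map_pi_normalized_sum_eq_self ρ (hdual ρ h) hm]
      rw [integral_map hmeas.aemeasurable hFm.aestronglyMeasurable]
    rw [repr μ hμ, repr ν hν]
    have hL3 : ∀ (ρ : Measure (ι → ℝ)) [IsGaussian ρ],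
        MemLp (fun x : ι → ℝ => (√(m : ℝ))⁻¹ • x) 3 ρ := fun ρ _ => by
      have := (IsGaussian.memLp_id ρ 3 (by simp)).const_smul (√(m : ℝ))⁻¹
      exact this
    have h0 : ∀ (ρ : Measure (ι → ℝ)), (∀ i, ∫ x, x i ∂ρ = 0) →
        ∀ i, ∫ x, ((√(m : ℝ))⁻¹ • x) i ∂ρ = 0 := fun ρ h i => by
      simp [integral_const_mul, h i]
    have hcov : ∀ i k, |∫ x, ((√(m : ℝ))⁻¹ • x) i * ((√(m : ℝ))⁻¹ • x) k ∂μ -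
        ∫ x, ((√(m : ℝ))⁻¹ • x) i * ((√(m : ℝ))⁻¹ • x) k ∂ν| ≤ (m : ℝ)⁻¹ * Δ := fun i k => by
      have : ∀ x : ι → ℝ, ((√(m : ℝ))⁻¹ • x) i * ((√(m : ℝ))⁻¹ • x) k =
          (m : ℝ)⁻¹ * (x i * x k) := fun x => by
        simp only [Pi.smul_apply, smul_eq_mul]
        rw [show (√(m : ℝ))⁻¹ * x i * ((√(m : ℝ))⁻¹ * x k) =
          (√(m : ℝ) ^ 2)⁻¹ * (x i * x k) by ring, Real.sq_sqrt hm'.le]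
      simp_rw [this, integral_const_mul, ← mul_sub]
      rw [abs_mul, abs_of_pos (inv_pos.2 hm')]
      exact mul_le_mul_of_nonneg_left (hΔ i k) (inv_pos.2 hm').le
    have hn3 : ∀ (ρ : Measure (ι → ℝ)), ∫ x : ι → ℝ, ‖(√(m : ℝ))⁻¹ • x‖ ^ 3 ∂ρ =
        (m : ℝ)⁻¹ * (√(m : ℝ))⁻¹ * ∫ x, ‖x‖ ^ 3 ∂ρ := fun ρ => by
      rw [← integral_const_mul]
      refine integral_congr_ae (ae_of_all _ fun x => ?_)
      simp only [norm_smul, norm_inv, Real.norm_eq_abs, abs_of_pos hs]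
      rw [mul_pow, show ((√(m : ℝ))⁻¹) ^ 3 = (√(m : ℝ) ^ 2)⁻¹ * (√(m : ℝ))⁻¹ by ring,
        Real.sq_sqrt hm'.le]
    refine (abs_integral_pi_sub_le (fun _ : Fin m => μ) (fun _ => ν)
      (X := fun _ x => (√(m : ℝ))⁻¹ • x) (Y := fun _ x => (√(m : ℝ))⁻¹ • x) (fun _ => by fun_prop)
      (fun _ => by fun_prop) hFm (fun x => hM _)
      (fun _ y => abs_integral_swap_le hg hb (hL3 μ) (h0 μ hμ) (hL3 ν) (h0 ν hν) hcov y)).trans_eq ?_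
    rw [hn3, hn3, Finset.sum_const, Finset.card_univ, Fintype.card_fin, nsmul_eq_mul]
    field_simp
    ring
  have hlim : Tendsto (fun m : ℕ => 3 * G * b * Δ + 3 * G * b ^ 2 * (Cμ + Cν) * (√(m : ℝ))⁻¹) atTop
      (𝓝 (3 * G * b * Δ + 3 * G * b ^ 2 * (Cμ + Cν) * 0)) :=
    tendsto_const_nhds.add (((Real.tendsto_sqrt_atTop.comp
      tendsto_natCast_atTop_atTop).inv_tendsto_atTop).const_mul _)
  rw [mul_zero, add_zero] at hlim
  exact ge_of_tendsto hlim ((eventually_gt_atTop 0).mono key)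

end Comparison

/-! ### Standard normal estimates -/

section StandardNormal

lemma gaussianReal_real_ge_le {t : ℝ} (ht : 0 ≤ t) :
    (gaussianReal 0 1).real {x | t ≤ x} ≤ Real.exp (-t ^ 2 / 2) := by
  have h : HasSubgaussianMGF (fun x : ℝ => x) 1 (gaussianReal 0 1) :=
    ⟨fun t => integrable_exp_mul_gaussianReal t, fun t => by
      rw [mgf_fun_id_gaussianReal]; simp⟩
  simpa using h.measure_ge_le ht

lemma gaussianReal_real_eq_integral (s : Set ℝ) :
    (gaussianReal 0 1).real s = ∫ x in s, gaussianPDFReal 0 1 x := by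
  rw [measureReal_def, gaussianReal_apply_eq_integral 0 one_ne_zero, ENNReal.toReal_ofReal]
  exact integral_nonneg fun x => gaussianPDFReal_nonneg 0 1 x

lemma gaussianPDFReal_zero_one (x : ℝ) :
    gaussianPDFReal 0 1 x = (√(2 * Real.pi))⁻¹ * Real.exp (-x ^ 2 / 2) := by
  simp [gaussianPDFReal_def]

lemma gaussianReal_Icc_le {a l C : ℝ} (hl : 0 ≤ l)
    (h : ∀ x ∈ Set.Icc a (a + l), gaussianPDFReal 0 1 x ≤ C) :
    (gaussianReal 0 1).real (Set.Icc a (a + l)) ≤ C * l := by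
  rw [gaussianReal_real_eq_integral]
  calc _ ≤ ∫ _x in Set.Icc a (a + l), C :=
        setIntegral_mono_on (integrable_gaussianPDFReal 0 1).integrableOn
          (integrableOn_const (by simp)) measurableSet_Icc h
    _ = _ := by simp [hl, mul_comm]

lemma le_gaussianReal_Ioc {a l C : ℝ} (hl : 0 ≤ l)
    (h : ∀ x ∈ Set.Ioc a (a + l), C ≤ gaussianPDFReal 0 1 x) :
    C * l ≤ (gaussianReal 0 1).real (Set.Ioc a (a + l)) := by
  rw [gaussianReal_real_eq_integral]
  calc _ = ∫ _x in Set.Ioc a (a + l), C := by simp [hl, mul_comm]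
    _ ≤ _ := setIntegral_mono_on (integrableOn_const (by simp))
          (integrable_gaussianPDFReal 0 1).integrableOn measurableSet_Ioc h

/-- Only the mass of (b, b + 1] is kept, where x² / 2 ≤ (b + 1)² / 2 ≤ b² + 1. The exponent is not
sharp, but any Gaussian lower bound serves. -/
lemma le_gaussianReal_real_gt {b : ℝ} (hb : 0 ≤ b) :
    (√(2 * Real.pi))⁻¹ * Real.exp (-1) * Real.exp (-b ^ 2) ≤
      (gaussianReal 0 1).real {x | b < x} := by
  have h := le_gaussianReal_Ioc (a := b) (l := 1)
    (C := (√(2 * Real.pi))⁻¹ * Real.exp (-1) * Real.exp (-b ^ 2)) zero_le_one fun x hx => by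
      rw [gaussianPDFReal_zero_one, mul_assoc, ← Real.exp_add]
      have : -1 + -b ^ 2 ≤ -x ^ 2 / 2 := by
        nlinarith [hx.1, hx.2, sq_nonneg (b - 1), mul_self_le_mul_self (by linarith [hx.1]) hx.2]
      gcongr
  rw [mul_one] at h
  exact h.trans (measureReal_mono fun x hx => hx.1)

/-- Comparison of the standard normal mass of adjacent intervals. -/
lemma gaussianReal_Icc_le_Ioc {c l y : ℝ} (hl : 0 ≤ l) (hy : 1 ≤ y) (hly : l ≤ 1 / y)
    (hcy : c + l ≤ y) :
    (gaussianReal 0 1).real (Set.Icc c (c + l)) ≤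
      Real.exp 3 * l * y * (gaussianReal 0 1).real (Set.Ioc (c + l) (c + l + 1 / y)) := by
  have hy0 : 0 < y := by linarith
  have hyi : 1 / y ≤ 1 := by rw [div_le_one hy0]; exact hy
  have hyy : 1 / y * y = 1 := by field_simp
  have hyi0 : 0 < 1 / y := by positivity
  set D := (√(2 * Real.pi))⁻¹
  have hD : 0 ≤ D := by positivity
  -- Compared with its value at `c + l`, the density gains at most a factor e on the left interval
  -- and loses at most e^{3/2} on the right one of length `1 / y`, because the points stay below `2
  -- * y`. The product e^{5/2} is rounded up to e³.
  have e1 := gaussianReal_Icc_le (a := c) (l := l)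
    (C := D * Real.exp (1 - (c + l) ^ 2 / 2)) hl fun x hx => by
      rw [gaussianPDFReal_zero_one]
      have h1 : (c + l - x) * (c + l + x) ≤ 2 := by
        rcases le_total 0 (c + l + x) with h | h
        · have : (c + l - x) * (c + l + x) ≤ 1 / y * (2 * y) :=
            mul_le_mul (by linarith [hx.1]) (by linarith [hx.2]) h hyi0.le
          linarith
        · have := mul_nonneg_of_nonpos_of_nonpos (a := -(c + l - x)) (by linarith [hx.2]) h
          linarith
      have : -x ^ 2 / 2 ≤ 1 - (c + l) ^ 2 / 2 := by nlinarith
      gcongr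
  have e2 := le_gaussianReal_Ioc (a := c + l) (l := 1 / y)
    (C := D * Real.exp (-(3 / 2) - (c + l) ^ 2 / 2)) hyi0.le fun x hx => by
      rw [gaussianPDFReal_zero_one]
      have h1 : (x - (c + l)) * (x + (c + l)) ≤ 3 := by
        rcases le_total 0 (x + (c + l)) with h | h
        · have : (x - (c + l)) * (x + (c + l)) ≤ 1 / y * (3 * y) :=
            mul_le_mul (by linarith [hx.2]) (by linarith [hx.2]) h hyi0.le
          linarith
        · have := mul_nonneg_of_nonpos_of_nonpos (a := -(x - (c + l))) (by linarith [hx.1]) h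
          linarith
      have : -(3 / 2) - (c + l) ^ 2 / 2 ≤ -x ^ 2 / 2 := by nlinarith
      gcongr
  calc _ ≤ D * Real.exp (1 - (c + l) ^ 2 / 2) * l := e1
    _ = Real.exp (5 / 2) * l * y * (D * Real.exp (-(3 / 2) - (c + l) ^ 2 / 2) * (1 / y)) := by
        rw [show 1 - (c + l) ^ 2 / 2 = 5 / 2 + (-(3 / 2) - (c + l) ^ 2 / 2) by ring, Real.exp_add]
        field_simp
    _ ≤ Real.exp 3 * l * y * _ := by
        gcongr
        norm_num

end StandardNormal

/-! ### Anti-concentration of Gaussian maxima -/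

/-- Jointly Gaussian, centred random variables with variance one. -/
structure UnitGaussian {Ω ι : Type*} [MeasurableSpace Ω] [Fintype ι] (Z : ι → Ω → ℝ)
    (P : Measure Ω) : Prop where
  measurable : ∀ i, Measurable (Z i)
  law : HasGaussianLaw (fun ω i => Z i ω) P
  mean : ∀ i, ∫ ω, Z i ω ∂P = 0
  var : ∀ i, Var[Z i; P] = 1

namespace UnitGaussian

variable {Ω ι : Type*} [MeasurableSpace Ω] [Fintype ι] {Z : ι → Ω → ℝ} {P : Measure Ω}

lemma isProbabilityMeasure (h : UnitGaussian Z P) : IsProbabilityMeasure P :=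
  h.law.isProbabilityMeasure

lemma map_eq (h : UnitGaussian Z P) (i : ι) : P.map (Z i) = gaussianReal 0 1 := by
  have := h.law.isProbabilityMeasure
  have hi : HasGaussianLaw (Z i) P := h.law.eval i
  rw [hi.map_eq_gaussianReal, h.mean, h.var]; simp

lemma real_preimage (h : UnitGaussian Z P) (i : ι) {s : Set ℝ} (hs : MeasurableSet s) :
    P.real (Z i ⁻¹' s) = (gaussianReal 0 1).real s := by
  rw [← h.map_eq i, map_measureReal_apply (h.measurable i) hs]

lemma real_ge_le (h : UnitGaussian Z P) {t : ℝ} (ht : 0 ≤ t) :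
    P.real {ω | ∃ i, t ≤ Z i ω} ≤ Fintype.card ι * Real.exp (-t ^ 2 / 2) := by
  have := h.isProbabilityMeasure
  have e : {ω | ∃ i, t ≤ Z i ω} = ⋃ i, Z i ⁻¹' {x | t ≤ x} := by ext; simp
  rw [e]
  calc _ ≤ ∑ i, P.real (Z i ⁻¹' {x | t ≤ x}) := measureReal_iUnion_fintype_le _
    _ ≤ ∑ _i : ι, Real.exp (-t ^ 2 / 2) := Finset.sum_le_sum fun i _ => by
        rw [h.real_preimage i (s := {x | t ≤ x}) measurableSet_Ici]; exact gaussianReal_real_ge_le ht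
    _ = _ := by simp

lemma memLp (h : UnitGaussian Z P) (i : ι) : MemLp (Z i) 2 P := by
  have := h.isProbabilityMeasure
  exact (h.law.eval i).memLp_two

lemma cov_le_one (h : UnitGaussian Z P) (i k : ι) : cov[Z i, Z k; P] ≤ 1 := by
  have := h.isProbabilityMeasure
  have h1 := variance_nonneg (Z i - Z k) P
  rw [variance_sub (h.memLp i) (h.memLp k), h.var, h.var] at h1
  linarith

/-- The residuals of the regression on `Z i` are uncorrelated with `Z i`, and they are jointly
Gaussian with it. -/
lemma indepFun_residual (h : UnitGaussian Z P) (i : ι) :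
    IndepFun (Z i) (fun ω k => Z k ω - cov[Z i, Z k; P] * Z i ω) P := by
  have := h.isProbabilityMeasure
  -- The single variable `Z i` is carried as a family over `Unit`, since the criterion for
  -- independence concerns two families.
  have hj : HasGaussianLaw (fun ω => ((fun _ : Unit => Z i ω),
      fun k => Z k ω - cov[Z i, Z k; P] * Z i ω)) P := by
    let L : (ι → ℝ) →L[ℝ] (Unit → ℝ) × (ι → ℝ) :=
      (ContinuousLinearMap.pi fun _ => ContinuousLinearMap.proj i).prod
        (ContinuousLinearMap.pi fun k => ContinuousLinearMap.proj k -
          cov[Z i, Z k; P] • ContinuousLinearMap.proj i)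
    exact h.law.map_fun L
  have := hj.indepFun_of_covariance_eval (X := fun _ : Unit => Z i)
    (Y := fun k ω => Z k ω - cov[Z i, Z k; P] * Z i ω) fun _ k => by
      have e : (fun ω => Z k ω - cov[Z i, Z k; P] * Z i ω) = Z k - cov[Z i, Z k; P] • Z i := rfl
      rw [e, covariance_sub_right (h.memLp i) (h.memLp k) ((h.memLp i).const_smul _),
        covariance_smul_right, covariance_self (h.measurable i).aemeasurable, h.var]
      ring
  exact this.comp (φ := fun x : Unit → ℝ => x ()) (ψ := id) (measurable_pi_apply _) measurable_id

/-- Anti-concentration for the maximum, on the part of the line below `y`. -/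
lemma real_max_mem_Icc_le_of_le (h : UnitGaussian Z P) {c l y : ℝ} (hl : 0 ≤ l) (hy : 1 ≤ y)
    (hly : l ≤ 1 / y) (hcy : c + l ≤ y) :
    P.real {ω | ∃ i, Z i ω ∈ Set.Icc c (c + l) ∧ ∀ k, Z k ω ≤ Z i ω} ≤ Real.exp 3 * l * y := by
  classical
  have := h.isProbabilityMeasure
  -- An arbitrary order breaks ties in favour of the smallest index, making the events that the
  -- maximum is attained at `i` disjoint.
  let : LinearOrder ι := LinearOrder.lift' (Fintype.equivFin ι) (Fintype.equivFin ι).injective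
  set ev : Set ℝ → ι → Set Ω := fun B i =>
    {ω | Z i ω ∈ B ∧ (∀ k < i, Z k ω < Z i ω) ∧ ∀ k, Z k ω ≤ Z i ω} with hev
  set ρ : ι → ι → ℝ := fun i k => cov[Z i, Z k; P]
  set W : ι → Ω → ι → ℝ := fun i ω k => Z k ω - ρ i k * Z i ω
  set r := c + l
  -- `H i` separates the two regimes. If `i` is the maximizer and `Z i ≤ r`, the residuals lie in `H
  -- i`; if the residuals lie in `H i` and `Z i > r`, then `i` is the maximizer. Both use that
  -- correlations are at most one. By independence, shifting the interval for `Z i` from `B` to `B'`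
  -- changes only a one-dimensional factor, and the disjoint events over `B'` have total mass at
  -- most one.
  set H : ι → Set (ι → ℝ) := fun i =>
    {w | (∀ k < i, w k < (1 - ρ i k) * r) ∧ ∀ k, w k ≤ (1 - ρ i k) * r}
  have hWm : ∀ i, Measurable (W i) := fun i => measurable_pi_iff.2 fun k =>
    (h.measurable k).sub ((h.measurable i).const_mul _)
  have hHm : ∀ i, MeasurableSet (H i) := fun i => by
    have e : H i = (⋂ k, ⋂ _ : k < i, {w | w k < (1 - ρ i k) * r}) ∩
        ⋂ k, {w | w k ≤ (1 - ρ i k) * r} := by ext w; simp [H]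
    rw [e]
    exact (MeasurableSet.iInter fun k => MeasurableSet.iInter fun _ =>
        measurableSet_lt (measurable_pi_apply k) measurable_const).inter
      (MeasurableSet.iInter fun k => measurableSet_le (measurable_pi_apply k) measurable_const)
  have hρ : ∀ i k, 0 ≤ 1 - ρ i k := fun i k => by linarith [h.cov_le_one i k]
  set B := Set.Icc c r
  set B' := Set.Ioc r (r + 1 / y)
  have hind : ∀ i (D : Set ℝ), MeasurableSet D → P.real (Z i ⁻¹' D ∩ W i ⁻¹' H i) =
      (gaussianReal 0 1).real D * P.real (W i ⁻¹' H i) := fun i D hD => by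
    rw [← h.real_preimage i hD, measureReal_def,
      (h.indepFun_residual i).measure_inter_preimage_eq_mul D (H i) hD (hHm i), ENNReal.toReal_mul]
    rfl
  have hup : ∀ i, P.real (ev B i) ≤ (gaussianReal 0 1).real B * P.real (W i ⁻¹' H i) := fun i => by
    rw [← hind i B measurableSet_Icc]
    refine measureReal_mono fun ω hω => ⟨hω.1, fun k hk => ?_, fun k => ?_⟩
    · have h1 := hω.2.1 k hk
      have h2 := mul_le_mul_of_nonneg_left hω.1.2 (hρ i k)
      change Z k ω - ρ i k * Z i ω < _
      linarith
    · have h1 := hω.2.2 k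
      have h2 := mul_le_mul_of_nonneg_left hω.1.2 (hρ i k)
      change Z k ω - ρ i k * Z i ω ≤ _
      linarith
  have hlow : ∀ i, (gaussianReal 0 1).real B' * P.real (W i ⁻¹' H i) ≤ P.real (ev B' i) := fun i => by
    rw [← hind i B' measurableSet_Ioc]
    refine measureReal_mono fun ω hω => ⟨hω.1, fun k hk => ?_, fun k => ?_⟩
    · have h1 : Z k ω - ρ i k * Z i ω < _ := hω.2.1 k hk
      have h2 := mul_le_mul_of_nonneg_left hω.1.1.le (hρ i k)
      linarith
    · have h1 : Z k ω - ρ i k * Z i ω ≤ _ := hω.2.2 k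
      have h2 := mul_le_mul_of_nonneg_left hω.1.1.le (hρ i k)
      linarith
  have hsub : {ω | ∃ i, Z i ω ∈ B ∧ ∀ k, Z k ω ≤ Z i ω} ⊆ ⋃ i, ev B i := by
    rintro ω ⟨i, hi, hmax⟩
    have hne : (Finset.univ.filter fun j => ∀ k, Z k ω ≤ Z j ω).Nonempty := ⟨i, by simpa using hmax⟩
    set j := (Finset.univ.filter fun j => ∀ k, Z k ω ≤ Z j ω).min' hne with hj
    have hjm : ∀ k, Z k ω ≤ Z j ω := by
      have := Finset.min'_mem _ hne
      simpa using this
    have hij : Z i ω = Z j ω := le_antisymm (hjm i) (hmax j)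
    refine Set.mem_iUnion.2 ⟨j, hij ▸ hi, fun k hk => lt_of_le_of_ne (hjm k) fun hkj => ?_, hjm⟩
    refine absurd (Finset.min'_le (Finset.univ.filter fun j => ∀ k, Z k ω ≤ Z j ω) k ?_)
      (not_le.2 hk)
    simpa [hkj] using hjm
  have hdisj : Pairwise (Function.onFun Disjoint (ev B')) := fun i k hik => by
    refine Set.disjoint_left.2 fun ω hi hk => ?_
    rcases lt_or_gt_of_ne hik with hlt | hlt
    · exact absurd (hk.2.1 i hlt) (not_lt.2 (hi.2.2 k))
    · exact absurd (hi.2.1 k hlt) (not_lt.2 (hk.2.2 i))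
  have hevm : ∀ i, MeasurableSet (ev B' i) := fun i => by
    have e : ev B' i = Z i ⁻¹' B' ∩ ((⋂ k, ⋂ _ : k < i, {ω | Z k ω < Z i ω}) ∩
        ⋂ k, {ω | Z k ω ≤ Z i ω}) := by ext ω; simp [ev]
    rw [e]
    exact (h.measurable i measurableSet_Ioc).inter ((MeasurableSet.iInter fun k =>
        MeasurableSet.iInter fun _ => measurableSet_lt (h.measurable k) (h.measurable i)).inter
      (MeasurableSet.iInter fun k => measurableSet_le (h.measurable k) (h.measurable i)))
  have hsum : ∑ i, P.real (ev B' i) ≤ 1 := by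
    rw [← measureReal_iUnion_fintype hdisj hevm]
    exact measureReal_le_one
  have hγ := gaussianReal_Icc_le_Ioc hl hy hly hcy
  have hR : 0 ≤ Real.exp 3 * l * y := by positivity
  calc _ ≤ ∑ i, P.real (ev B i) :=
        (measureReal_mono hsub).trans (measureReal_iUnion_fintype_le _)
    _ ≤ ∑ i, Real.exp 3 * l * y * P.real (ev B' i) := Finset.sum_le_sum fun i _ => by
        refine (hup i).trans ((mul_le_mul_of_nonneg_right hγ measureReal_nonneg).trans ?_)
        rw [mul_assoc]
        exact mul_le_mul_of_nonneg_left (hlow i) hR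
    _ ≤ _ := by
        rw [← Finset.mul_sum]
        exact mul_le_of_le_one_right hR hsum

/-- Anti-concentration for the maximum of jointly Gaussian variables with variance one. -/
lemma real_max_mem_Icc_le (h : UnitGaussian Z P) (c : ℝ) {l y : ℝ} (hl : 0 ≤ l) (hy : 1 ≤ y)
    (hly : l ≤ 1 / y) :
    P.real {ω | ∃ i, Z i ω ∈ Set.Icc c (c + l) ∧ ∀ k, Z k ω ≤ Z i ω} ≤
      Real.exp 3 * l * y + Fintype.card ι * Real.exp (-(y - l) ^ 2 / 2) := by
  have := h.isProbabilityMeasure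
  rcases le_or_gt (c + l) y with hc | hc
  · have := h.real_max_mem_Icc_le_of_le hl hy hly hc
    have : 0 ≤ Fintype.card ι * Real.exp (-(y - l) ^ 2 / 2) := by positivity
    linarith
  · have h1 : 1 / y ≤ 1 := by rw [div_le_one (by linarith)]; exact hy
    have h2 := h.real_ge_le (t := y - l) (by linarith)
    have h3 : P.real {ω | ∃ i, Z i ω ∈ Set.Icc c (c + l) ∧ ∀ k, Z k ω ≤ Z i ω} ≤
        P.real {ω | ∃ i, y - l ≤ Z i ω} :=
      measureReal_mono fun ω ⟨i, hi, _⟩ => ⟨i, by linarith [hi.1]⟩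
    have : 0 ≤ Real.exp 3 * l * y := by positivity
    linarith

/-- The distribution of the maximum over a subset of uncorrelated variables. -/
lemma real_forall_le_eq (h : UnitGaussian Z P) {I : Finset ι}
    (hI : ∀ i ∈ I, ∀ k ∈ I, i ≠ k → cov[Z i, Z k; P] = 0) (x : ℝ) :
    P.real {ω | ∀ i ∈ I, Z i ω ≤ x} = (gaussianReal 0 1).real (Set.Iic x) ^ I.card := by
  have := h.isProbabilityMeasure
  have hg : HasGaussianLaw (fun ω (i : I) => Z i ω) P := by
    let L : (ι → ℝ) →L[ℝ] (I → ℝ) :=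
      ContinuousLinearMap.pi fun i => ContinuousLinearMap.proj (i : ι)
    exact h.law.map_fun L
  have hind := hg.iIndepFun_of_covariance_eq_zero (X := fun (i : I) => Z i) fun i k hik =>
    hI i i.2 k k.2 fun e => hik (Subtype.ext e)
  have e : {ω | ∀ i ∈ I, Z i ω ≤ x} = ⋂ i ∈ (Finset.univ : Finset I), Z i ⁻¹' Set.Iic x := by
    ext ω; simp
  rw [e, measureReal_def, hind.measure_inter_preimage_eq_mul Finset.univ
    (sets := fun _ => Set.Iic x) fun _ _ => measurableSet_Iic, ENNReal.toReal_prod]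
  have : ∀ i : I, (P (Z i ⁻¹' Set.Iic x)).toReal = (gaussianReal 0 1).real (Set.Iic x) := fun i =>
    h.real_preimage i measurableSet_Iic
  simp [this]

end UnitGaussian

/-! ### Step functions, smoothed distribution functions and quantiles -/

/-- A continuous nonincreasing function which is `1` on `(-∞, 0]` and `0` on `[1, ∞)`. -/
structure StepFunction (g : ℝ → ℝ) : Prop where
  cont : Continuous g
  anti : Antitone g
  one : ∀ x ≤ 0, g x = 1
  zero : ∀ x, 1 ≤ x → g x = 0

namespace StepFunction

variable {g : ℝ → ℝ}

lemma nonneg (hg : StepFunction g) (x : ℝ) : 0 ≤ g x := by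
  rw [← hg.zero (max x 1) (le_max_right _ _)]
  exact hg.anti (le_max_left _ _)

lemma le_one (hg : StepFunction g) (x : ℝ) : g x ≤ 1 := by
  rw [← hg.one (min x 0) (min_le_right _ _)]
  exact hg.anti (min_le_left _ _)

lemma abs_le_one (hg : StepFunction g) (x : ℝ) : |g x| ≤ 1 :=
  abs_le.2 ⟨by linarith [hg.nonneg x], hg.le_one x⟩

/-- A continuous step need not be Lipschitz, but it is within `η / 2` of a Lipschitz function. -/
lemma exists_abs_sub_le (hg : StepFunction g) {η : ℝ} (hη : 0 < η) :
    ∃ G, 0 ≤ G ∧ ∀ x y, |g x - g y| ≤ η + G * |x - y| := by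
  obtain ⟨f, f₁, f₂, f₃, G, hf, hfg⟩ :=
    exists_threeDeriv_approx hg.cont hg.one hg.zero hg.abs_le_one (half_pos hη)
  refine ⟨G, hf.nonneg, fun x y => ?_⟩
  have hL : |f x - f y| ≤ G * |x - y| :=
    convex_univ.norm_image_sub_le_of_norm_hasDerivWithin_le (f := f) (f' := f₁)
      (fun z _ => (hf.d₁ z).hasDerivWithinAt) (fun z _ => hf.b₁ z) (Set.mem_univ y) (Set.mem_univ x)
  have h1 := abs_le.1 (hfg x)
  have h2 := abs_le.1 (hfg y)
  have h3 := abs_le.1 hL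
  rw [abs_le]
  constructor <;> linarith

/-- Steps of different widths differ only on the wider one. -/
lemma abs_sub_le_indicator (hg : StepFunction g) {β l : ℝ} (hβ : 0 < β) (hl : β ≤ l) (t c : ℝ) :
    |g ((t - c) / β) - g ((t - c) / l)| ≤ (Set.Icc c (c + l)).indicator 1 t := by
  have hl0 : 0 < l := hβ.trans_le hl
  by_cases ht : t ∈ Set.Icc c (c + l)
  · rw [Set.indicator_of_mem ht, Pi.one_apply, abs_le]
    constructor <;> linarith [hg.nonneg ((t - c) / β), hg.nonneg ((t - c) / l),
      hg.le_one ((t - c) / β), hg.le_one ((t - c) / l)]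
  · rw [Set.indicator_of_notMem ht]
    rw [Set.mem_Icc, not_and_or, not_le, not_le] at ht
    rcases ht with ht | ht
    · rw [hg.one _ (div_nonpos_of_nonpos_of_nonneg (by linarith) hβ.le),
        hg.one _ (div_nonpos_of_nonpos_of_nonneg (by linarith) hl0.le)]
      simp
    · rw [hg.zero _ ((one_le_div hβ).2 (by linarith)), hg.zero _ ((one_le_div hl0).2 (by linarith))]
      simp

end StepFunction

/-- The smoothed distribution function `c ↦ E[g((T - c) / β)]`. -/
noncomputable def smoothCdf {Ω : Type*} [MeasurableSpace Ω] (g : ℝ → ℝ) (β : ℝ) (μ : Measure Ω)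
    (T : Ω → ℝ) (c : ℝ) : ℝ :=
  ∫ z, g ((T z - c) / β) ∂μ

section SmoothCdf

variable {Ω : Type*} [MeasurableSpace Ω] {g : ℝ → ℝ} {β : ℝ} {μ : Measure Ω}
  [IsProbabilityMeasure μ] {T T' : Ω → ℝ}

lemma StepFunction.integrable (hg : StepFunction g) (hT : Measurable T) (c : ℝ) :
    Integrable (fun z => g ((T z - c) / β)) μ :=
  Integrable.of_bound (C := 1) (hg.cont.measurable.comp ((hT.sub_const c).div_const β)
    |>.aestronglyMeasurable) (ae_of_all _ fun _ => hg.abs_le_one _)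

lemma smoothCdf_mono (hg : StepFunction g) (hβ : 0 < β) (hT : Measurable T) :
    Monotone (smoothCdf g β μ T) := fun c c' h =>
  integral_mono (hg.integrable hT c) (hg.integrable hT c') fun z =>
    hg.anti (div_le_div_of_nonneg_right (by linarith) hβ.le)

lemma smoothCdf_anti (hg : StepFunction g) (hβ : 0 < β) (hT : Measurable T) (hT' : Measurable T')
    (h : ∀ z, T z ≤ T' z) (c : ℝ) : smoothCdf g β μ T' c ≤ smoothCdf g β μ T c :=
  integral_mono (hg.integrable hT' c) (hg.integrable hT c) fun z =>
    hg.anti (div_le_div_of_nonneg_right (by linarith [h z]) hβ.le)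

lemma continuous_smoothCdf (hg : StepFunction g) (hT : Measurable T) :
    Continuous (smoothCdf g β μ T) := by
  refine continuous_of_dominated (bound := fun _ => 1)
    (fun c => (hg.integrable hT c).aestronglyMeasurable)
    (fun c => ae_of_all _ fun z => hg.abs_le_one _) (integrable_const _) (ae_of_all _ fun z => ?_)
  exact hg.cont.comp (by fun_prop)

lemma tendsto_smoothCdf_atTop (hg : StepFunction g) (hβ : 0 < β) (hT : Measurable T) :
    Tendsto (smoothCdf g β μ T) atTop (𝓝 1) := by
  have : (1 : ℝ) = ∫ _z, (1 : ℝ) ∂μ := by simp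
  rw [this]
  refine tendsto_integral_filter_of_dominated_convergence (fun _ => 1)
    (Eventually.of_forall fun c => (hg.integrable hT c).aestronglyMeasurable)
    (Eventually.of_forall fun c => ae_of_all _ fun z => hg.abs_le_one _) (integrable_const _)
    (ae_of_all _ fun z => ?_)
  refine tendsto_const_nhds.congr' ?_
  filter_upwards [eventually_ge_atTop (T z)] with c hc
  rw [hg.one _ (div_nonpos_of_nonpos_of_nonneg (by linarith) hβ.le)]

lemma tendsto_smoothCdf_atBot (hg : StepFunction g) (hβ : 0 < β) (hT : Measurable T) :
    Tendsto (smoothCdf g β μ T) atBot (𝓝 0) := by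
  have : (0 : ℝ) = ∫ _z, (0 : ℝ) ∂μ := by simp
  rw [this]
  refine tendsto_integral_filter_of_dominated_convergence (fun _ => 1)
    (Eventually.of_forall fun c => (hg.integrable hT c).aestronglyMeasurable)
    (Eventually.of_forall fun c => ae_of_all _ fun z => hg.abs_le_one _) (integrable_const _)
    (ae_of_all _ fun z => ?_)
  refine tendsto_const_nhds.congr' ?_
  filter_upwards [eventually_le_atBot (T z - β)] with c hc
  rw [hg.zero _ ((one_le_div hβ).2 (by linarith))]

lemma exists_smoothCdf_eq (hg : StepFunction g) (hβ : 0 < β) (hT : Measurable T) {q : ℝ}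
    (h0 : 0 < q) (h1 : q < 1) : ∃ c, smoothCdf g β μ T c = q :=
  mem_range_of_exists_le_of_exists_ge (continuous_smoothCdf hg hT)
    ((tendsto_smoothCdf_atBot hg hβ hT).eventually_le_const h0).exists
    ((tendsto_smoothCdf_atTop hg hβ hT).eventually_const_le h1).exists

/-- The level set is closed by continuity, nonempty by the intermediate value theorem, and bounded
below since the smoothed distribution function tends to 0 at -∞, so its infimum belongs to it. -/
lemma smoothedQuantile_spec (hg : StepFunction g) (hβ : 0 < β) (hT : Measurable T) {q : ℝ}
    (h0 : 0 < q) (h1 : q < 1) :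
    smoothCdf g β μ T (smoothedQuantile g β μ T q) = q := by
  have hcl : IsClosed {c : ℝ | smoothCdf g β μ T c = q} :=
    isClosed_eq (continuous_smoothCdf hg hT) continuous_const
  have hbdd : BddBelow {c : ℝ | smoothCdf g β μ T c = q} := by
    obtain ⟨c₀, hc₀⟩ := ((tendsto_smoothCdf_atBot (μ := μ) hg hβ hT).eventually_lt_const h0).exists
    refine ⟨c₀, fun c hc => le_of_not_gt fun hlt => ?_⟩
    have h2 : smoothCdf g β μ T c = q := hc
    linarith [smoothCdf_mono (μ := μ) hg hβ hT hlt.le]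
  exact hcl.csInf_mem (exists_smoothCdf_eq hg hβ hT h0 h1) hbdd

/-- The quantile and the smoothed distribution function form a Galois connection. Measurability of
critical values and every comparison of them with deterministic levels go through this equivalence.
-/
lemma smoothedQuantile_le_iff (hg : StepFunction g) (hβ : 0 < β) (hT : Measurable T) {q : ℝ}
    (h0 : 0 < q) (h1 : q < 1) (t : ℝ) :
    smoothedQuantile g β μ T q ≤ t ↔ q ≤ smoothCdf g β μ T t := by
  constructor
  · intro h
    rw [← smoothedQuantile_spec (μ := μ) hg hβ hT h0 h1]
    exact smoothCdf_mono hg hβ hT h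
  · intro h
    obtain ⟨c₀, hc₀⟩ := ((tendsto_smoothCdf_atBot (μ := μ) hg hβ hT).eventually_lt_const h0).exists
    have hct : c₀ ≤ t := le_of_not_gt fun hlt => by
      linarith [smoothCdf_mono (μ := μ) hg hβ hT hlt.le]
    obtain ⟨c, hc, hcq⟩ := intermediate_value_Icc hct (continuous_smoothCdf hg hT).continuousOn
      ⟨hc₀.le, h⟩
    have hbdd : BddBelow {c : ℝ | smoothCdf g β μ T c = q} :=
      ⟨c₀, fun c hc => le_of_not_gt fun hlt => by
        have h2 : smoothCdf g β μ T c = q := hc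
        linarith [smoothCdf_mono (μ := μ) hg hβ hT hlt.le]⟩
    exact (csInf_le hbdd hcq).trans hc.2

lemma smoothedQuantile_mono (hg : StepFunction g) (hβ : 0 < β) (hT : Measurable T)
    (hT' : Measurable T') (h : ∀ z, T z ≤ T' z) {q : ℝ} (h0 : 0 < q) (h1 : q < 1) :
    smoothedQuantile g β μ T q ≤ smoothedQuantile g β μ T' q := by
  rw [smoothedQuantile_le_iff hg hβ hT h0 h1]
  calc q = smoothCdf g β μ T' (smoothedQuantile g β μ T' q) :=
        (smoothedQuantile_spec hg hβ hT' h0 h1).symm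
    _ ≤ _ := smoothCdf_anti hg hβ hT hT' h _

lemma smoothCdf_le_real (hg : StepFunction g) (hβ : 0 < β) (hT : Measurable T) (c : ℝ) :
    smoothCdf g β μ T c ≤ μ.real {z | T z ≤ c + β} := by
  have hm : MeasurableSet {z | T z ≤ c + β} := measurableSet_le hT measurable_const
  rw [← integral_indicator_one hm]
  refine integral_mono (hg.integrable hT c) ((integrable_const (1 : ℝ)).indicator hm) fun z => ?_
  by_cases hz : T z ≤ c + β
  · rw [Set.indicator_of_mem (by exact hz)]; exact hg.le_one _
  · rw [Set.indicator_of_notMem (by exact hz)]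
    rw [not_le] at hz
    exact (hg.zero _ ((one_le_div hβ).2 (by linarith))).le

lemma real_le_smoothCdf (hg : StepFunction g) (hβ : 0 < β) (hT : Measurable T) (c : ℝ) :
    μ.real {z | T z ≤ c} ≤ smoothCdf g β μ T c := by
  have hm : MeasurableSet {z | T z ≤ c} := measurableSet_le hT measurable_const
  rw [← integral_indicator_one hm]
  refine integral_mono ((integrable_const (1 : ℝ)).indicator hm) (hg.integrable hT c) fun z => ?_
  by_cases hz : T z ≤ c
  · rw [Set.indicator_of_mem (by exact hz)]
    exact (hg.one _ (div_nonpos_of_nonpos_of_nonneg (by linarith) hβ.le)).ge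
  · rw [Set.indicator_of_notMem (by exact hz)]
    exact hg.nonneg _

lemma one_sub_smoothCdf_le (hg : StepFunction g) (hβ : 0 < β) (hT : Measurable T) (c : ℝ) :
    1 - smoothCdf g β μ T c ≤ μ.real {z | c < T z} := by
  have h := real_le_smoothCdf (μ := μ) hg hβ hT c
  have hm : MeasurableSet {z | T z ≤ c} := measurableSet_le hT measurable_const
  have h2 := probReal_compl_eq_one_sub (μ := μ) hm
  have e : {z | T z ≤ c}ᶜ = {z | c < T z} := by ext; simp
  rw [e] at h2
  linarith

lemma real_lt_le_one_sub (hg : StepFunction g) (hβ : 0 < β) (hT : Measurable T) (c : ℝ) :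
    μ.real {z | c + β < T z} ≤ 1 - smoothCdf g β μ T c := by
  have h := smoothCdf_le_real (μ := μ) hg hβ hT c
  have hm : MeasurableSet {z | T z ≤ c + β} := measurableSet_le hT measurable_const
  have h2 := probReal_compl_eq_one_sub (μ := μ) hm
  have e : {z | T z ≤ c + β}ᶜ = {z | c + β < T z} := by ext; simp
  rw [e] at h2
  linarith

/-- Changing the width of the step costs at most the mass of an interval. -/
lemma abs_smoothCdf_sub_le (hg : StepFunction g) {l : ℝ} (hβ : 0 < β) (hl : β ≤ l)
    (hT : Measurable T) (c : ℝ) :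
    |smoothCdf g β μ T c - smoothCdf g l μ T c| ≤ μ.real {z | T z ∈ Set.Icc c (c + l)} := by
  have hm : MeasurableSet {z | T z ∈ Set.Icc c (c + l)} := hT measurableSet_Icc
  rw [smoothCdf, smoothCdf, ← integral_sub (hg.integrable hT c) (hg.integrable hT c),
    ← integral_indicator_one hm, ← Real.norm_eq_abs]
  refine norm_integral_le_of_norm_le ((integrable_const (1 : ℝ)).indicator hm)
    (ae_of_all _ fun z => ?_)
  exact hg.abs_sub_le_indicator hβ hl (T z) c

lemma measurable_iSup_fin {ι : Type*} [Finite ι] {Z : ι → Ω → ℝ}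
    (hZ : ∀ i, Measurable (Z i)) : Measurable fun ω => ⨆ i, Z i ω := by
  have := Finite.to_countable (α := ι)
  exact Measurable.iSup hZ

end SmoothCdf

section Finite

variable {ι : Type*} [Finite ι]

lemma le_iSup_fin (x : ι → ℝ) (i : ι) : x i ≤ ⨆ i, x i :=
  le_ciSup (Set.finite_range x).bddAbove i

lemma iSup_sub_div [Nonempty ι] (x : ι → ℝ) (c : ℝ) {β : ℝ} (hβ : 0 < β) :
    ((⨆ i, x i) - c) / β = (⨆ i, x i / β) - c / β := by
  rw [sub_div]
  congr 1
  refine le_antisymm ?_ ?_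
  · rw [div_le_iff₀ hβ]
    refine ciSup_le fun i => ?_
    rw [← div_le_iff₀ hβ]
    exact le_iSup_fin (fun i => x i / β) i
  · exact ciSup_le fun i => div_le_div_of_nonneg_right (le_iSup_fin x i) hβ.le

end Finite

namespace UnitGaussian

variable {Ω ι : Type*} [MeasurableSpace Ω] [Fintype ι] [Nonempty ι] {Z : ι → Ω → ℝ} {P : Measure Ω}

lemma real_iSup_mem_Icc_le (h : UnitGaussian Z P) (c : ℝ) {l y : ℝ} (hl : 0 ≤ l) (hy : 1 ≤ y)
    (hly : l ≤ 1 / y) :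
    P.real {ω | (⨆ i, Z i ω) ∈ Set.Icc c (c + l)} ≤
      Real.exp 3 * l * y + Fintype.card ι * Real.exp (-(y - l) ^ 2 / 2) := by
  have := h.isProbabilityMeasure
  refine (measureReal_mono fun ω hω => ?_).trans (h.real_max_mem_Icc_le c hl hy hly)
  obtain ⟨i, hi⟩ := exists_eq_ciSup_of_finite (f := fun i => Z i ω)
  have hω' : (⨆ i, Z i ω) ∈ Set.Icc c (c + l) := hω
  rw [← hi] at hω'
  exact ⟨i, hω', fun k => hi ▸ le_iSup_fin (fun i => Z i ω) k⟩

lemma real_lt_iSup_le (h : UnitGaussian Z P) {t : ℝ} (ht : 0 ≤ t) :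
    P.real {ω | t < ⨆ i, Z i ω} ≤ Fintype.card ι * Real.exp (-t ^ 2 / 2) := by
  have := h.isProbabilityMeasure
  refine (measureReal_mono fun ω hω => ?_).trans (h.real_ge_le ht)
  have hω' : t < ⨆ i, Z i ω := hω
  obtain ⟨i, hi⟩ := exists_lt_of_lt_ciSup hω'
  exact ⟨i, hi.le⟩

end UnitGaussian

/-! ### Comparison of smoothed distribution functions of maxima -/

section MaxComparison

variable {f f₁ f₂ f₃ g : ℝ → ℝ} {G η : ℝ}

lemma ThreeDeriv.comp_sub (hf : ThreeDeriv f f₁ f₂ f₃ G) (c : ℝ) :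
    ThreeDeriv (fun x => f (x - c)) (fun x => f₁ (x - c)) (fun x => f₂ (x - c))
      (fun x => f₃ (x - c)) G where
  d₁ x := (hf.d₁ (x - c)).comp_sub_const x c
  d₂ x := (hf.d₂ (x - c)).comp_sub_const x c
  d₃ x := (hf.d₃ (x - c)).comp_sub_const x c
  b₁ _ := hf.b₁ _
  b₂ _ := hf.b₂ _
  b₃ _ := hf.b₃ _
  bdd := let ⟨M, hM⟩ := hf.bdd; ⟨M, fun _ => hM _⟩

lemma ThreeDeriv.abs_sub_le (hf : ThreeDeriv f f₁ f₂ f₃ G) (x y : ℝ) :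
    |f x - f y| ≤ G * |x - y| :=
  convex_univ.norm_image_sub_le_of_norm_hasDerivWithin_le (f := f) (f' := f₁)
    (fun z _ => (hf.d₁ z).hasDerivWithinAt) (fun z _ => hf.b₁ z) (Set.mem_univ y) (Set.mem_univ x)

variable {ι : Type*} [Fintype ι] [Nonempty ι]

/-- The vector is divided by `β` before the smooth maximum is taken. The derivatives of `f` then
stay free of `β`, and powers of `β` enter only through the moments of the rescaled summands. -/
lemma abs_smax_sub_step_iSup_le (hf : ThreeDeriv f f₁ f₂ f₃ G) (hfg : ∀ x, |f x - g x| ≤ η)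
    {b : ℝ} (hb : 0 < b) {β : ℝ} (hβ : 0 < β) (x : ι → ℝ) (c : ℝ) :
    |f (smax b (β⁻¹ • x) - c / β) - g (((⨆ i, x i) - c) / β)| ≤
      G * (Real.log (Fintype.card ι) / b) + η := by
  rw [iSup_sub_div x c hβ]
  set m := ⨆ i, x i / β
  have hx : ∀ i, (β⁻¹ • x) i ≤ m := fun i => by
    have := le_iSup_fin (fun i => x i / β) i
    simpa [m, div_eq_inv_mul] using this
  have h1 := smax_le hb hx
  obtain ⟨i, hi⟩ := exists_eq_ciSup_of_finite (f := fun i => x i / β)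
  have h2 : m ≤ smax b (β⁻¹ • x) := by
    have := le_smax hb (β⁻¹ • x) i
    rw [← show x i / β = m from hi]
    simpa [div_eq_inv_mul] using this
  have h3 : |f (smax b (β⁻¹ • x) - c / β) - f (m - c / β)| ≤
      G * (Real.log (Fintype.card ι) / b) := by
    refine (hf.abs_sub_le _ _).trans (mul_le_mul_of_nonneg_left ?_ hf.nonneg)
    rw [abs_of_nonneg (by linarith)]
    linarith
  exact (_root_.abs_sub_le _ (f (m - c / β)) _).trans (add_le_add h3 (hfg _))

variable {Ω Ω' : Type*} [MeasurableSpace Ω] [MeasurableSpace Ω']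

lemma abs_integral_smax_sub_smoothCdf_le (hf : ThreeDeriv f f₁ f₂ f₃ G) (hg : StepFunction g)
    (hfg : ∀ x, |f x - g x| ≤ η) {b : ℝ} (hb : 0 < b) {β : ℝ} (hβ : 0 < β)
    {P : Measure Ω} [IsProbabilityMeasure P] {X : Ω → ι → ℝ} (hX : Measurable X) (c : ℝ) :
    |∫ ω, f (smax b (β⁻¹ • X ω) - c / β) ∂P - smoothCdf g β P (fun ω => ⨆ i, X ω i) c| ≤
      G * (Real.log (Fintype.card ι) / b) + η := by
  obtain ⟨M, hM⟩ := hf.bdd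
  have h1 : Integrable (fun ω => f (smax b (β⁻¹ • X ω) - c / β)) P :=
    Integrable.of_bound (C := M) (((hf.continuous.comp ((continuous_smax.comp
      (continuous_const_smul β⁻¹)).sub continuous_const)).measurable.comp hX).aestronglyMeasurable)
      (ae_of_all _ fun ω => hM _)
  have h2 : Integrable (fun ω => g (((⨆ i, X ω i) - c) / β)) P :=
    hg.integrable (measurable_iSup_fin fun i => (measurable_pi_apply i).comp hX) c
  rw [smoothCdf, ← integral_sub h1 h2]
  have := norm_integral_le_of_norm_le_const (μ := P)
    (f := fun ω => f (smax b (β⁻¹ • X ω) - c / β) - g (((⨆ i, X ω i) - c) / β))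
    (ae_of_all _ fun ω => abs_smax_sub_step_iSup_le hf hfg hb hβ (X ω) c)
  simpa using this

/-- Lindeberg comparison of the maxima of two sums of independent random vectors with the same
second moments. -/
lemma abs_smoothCdf_sum_sub_le (hf : ThreeDeriv f f₁ f₂ f₃ G) (hg : StepFunction g)
    (hfg : ∀ x, |f x - g x| ≤ η) {b : ℝ} (hb : 1 ≤ b) {β : ℝ} (hβ : 0 < β) {n : ℕ}
    (μ ν : Fin n → Measure Ω) [∀ j, IsProbabilityMeasure (μ j)] [∀ j, IsProbabilityMeasure (ν j)]
    {X Y : Fin n → Ω → ι → ℝ} (hX : ∀ j, Measurable (X j)) (hY : ∀ j, Measurable (Y j))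
    (hX3 : ∀ j, MemLp (X j) 3 (μ j)) (hY3 : ∀ j, MemLp (Y j) 3 (ν j))
    (hX0 : ∀ j i, ∫ ω, X j ω i ∂(μ j) = 0) (hY0 : ∀ j i, ∫ ω, Y j ω i ∂(ν j) = 0)
    (hcov : ∀ j i k, ∫ ω, X j ω i * X j ω k ∂(μ j) = ∫ ω, Y j ω i * Y j ω k ∂(ν j))
    {R : ℝ} (hXR : ∀ j, ∫ ω, ‖X j ω‖ ^ 3 ∂(μ j) ≤ R) (hYR : ∀ j, ∫ ω, ‖Y j ω‖ ^ 3 ∂(ν j) ≤ R)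
    (c : ℝ) :
    |smoothCdf g β (Measure.pi μ) (fun ω => ⨆ i, (∑ j, X j (ω j)) i) c -
      smoothCdf g β (Measure.pi ν) (fun ω => ⨆ i, (∑ j, Y j (ω j)) i) c| ≤
      2 * η + 2 * G * (Real.log (Fintype.card ι) / b) + 6 * G * b ^ 2 * (n * R) / β ^ 3 := by
  obtain ⟨M, hM⟩ := hf.bdd
  have hb0 : 0 < b := by linarith
  have hsumX : Measurable fun ω : Fin n → Ω => ∑ j, X j (ω j) :=
    Finset.measurable_sum _ fun j _ => (hX j).comp (measurable_pi_apply j)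
  have hsumY : Measurable fun ω : Fin n → Ω => ∑ j, Y j (ω j) :=
    Finset.measurable_sum _ fun j _ => (hY j).comp (measurable_pi_apply j)
  have a1 := abs_integral_smax_sub_smoothCdf_le hf hg hfg hb0 hβ (P := Measure.pi μ) hsumX c
  have a2 := abs_integral_smax_sub_smoothCdf_le hf hg hfg hb0 hβ (P := Measure.pi ν) hsumY c
  have hmean : ∀ (ρ : Measure Ω) (W : Ω → ι → ℝ), (∀ i, ∫ ω, W ω i ∂ρ = 0) →
      ∀ i, ∫ ω, (β⁻¹ • W ω) i ∂ρ = 0 := fun ρ W h i => by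
    simp [integral_const_mul, h i]
  have hsec : ∀ (ρ : Measure Ω) (W : Ω → ι → ℝ) i k, ∫ ω, (β⁻¹ • W ω) i * (β⁻¹ • W ω) k ∂ρ =
      β⁻¹ ^ 2 * ∫ ω, W ω i * W ω k ∂ρ := fun ρ W i k => by
    rw [← integral_const_mul]
    refine integral_congr_ae (ae_of_all _ fun ω => ?_)
    simp only [Pi.smul_apply, smul_eq_mul]; ring
  have hthird : ∀ (ρ : Measure Ω) (W : Ω → ι → ℝ), ∫ ω, ‖β⁻¹ • W ω‖ ^ 3 ∂ρ =
      β⁻¹ ^ 3 * ∫ ω, ‖W ω‖ ^ 3 ∂ρ := fun ρ W => by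
    rw [← integral_const_mul]
    refine integral_congr_ae (ae_of_all _ fun ω => ?_)
    simp only [norm_smul, norm_inv, Real.norm_eq_abs, abs_of_pos hβ, mul_pow]
  have key := abs_integral_pi_sub_le μ ν (X := fun j ω => β⁻¹ • X j ω) (Y := fun j ω => β⁻¹ • Y j ω)
    (fun j => (measurable_const_smul β⁻¹).comp (hX j))
    (fun j => (measurable_const_smul β⁻¹).comp (hY j))
    (F := fun x => f (smax b x - c / β))
    (hf.continuous.comp (continuous_smax.sub continuous_const)).measurable (fun x => hM _)
    (e := fun _ => 6 * G * b ^ 2 * R / β ^ 3)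
    (fun j y => by
      refine (abs_integral_swap_le (hf.comp_sub (c / β)) hb ((hX3 j).const_smul β⁻¹)
        (hmean _ _ (hX0 j)) ((hY3 j).const_smul β⁻¹) (hmean _ _ (hY0 j)) (Δ := 0)
        (fun i k => ?_) y).trans ?_
      · simp only [Pi.smul_apply]
        have e1 := hsec (μ j) (X j) i k
        have e2 := hsec (ν j) (Y j) i k
        simp only [Pi.smul_apply] at e1 e2
        rw [e1, e2, hcov j i k]; simp
      · have e1 := hthird (μ j) (X j)
        have e2 := hthird (ν j) (Y j)
        simp only [Pi.smul_apply]
        rw [e1, e2]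
        have hβ3 : 0 < β⁻¹ ^ 3 := by positivity
        have hG2 : 0 ≤ 3 * G * b ^ 2 := mul_nonneg (mul_nonneg (by norm_num) hf.nonneg) (by positivity)
        calc _ ≤ 3 * G * b * 0 + 3 * G * b ^ 2 * (β⁻¹ ^ 3 * R + β⁻¹ ^ 3 * R) := by
              gcongr
              exacts [hXR j, hYR j]
          _ = _ := by rw [inv_pow]; field_simp; ring)
  have hlin : ∀ (W : Fin n → Ω → ι → ℝ) (ω : Fin n → Ω),
      ∑ j, β⁻¹ • W j (ω j) = β⁻¹ • ∑ j, W j (ω j) := fun W ω => by rw [Finset.smul_sum]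
  simp only [hlin, Finset.sum_const, Finset.card_univ, Fintype.card_fin, nsmul_eq_mul] at key
  have e : (n : ℝ) * (6 * G * b ^ 2 * R / β ^ 3) = 6 * G * b ^ 2 * (n * R) / β ^ 3 := by ring
  rw [e] at key
  rw [abs_le] at *
  constructor <;> linarith [a1.1, a1.2, a2.1, a2.2, key.1, key.2]

omit [Nonempty ι] in
lemma UnitGaussian.integral_eval_map_smul {P : Measure Ω} {Z : ι → Ω → ℝ} (hZ : UnitGaussian Z P)
    (a : ℝ) (i : ι) : ∫ x, x i ∂(P.map fun ω => a • fun i => Z i ω) = 0 := by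
  have hm : Measurable fun ω => a • fun i => Z i ω :=
    (measurable_const_smul a).comp (measurable_pi_iff.2 hZ.measurable)
  rw [integral_map hm.aemeasurable (measurable_pi_apply i).aestronglyMeasurable]
  simp [integral_const_mul, hZ.mean i]

omit [Nonempty ι] in
lemma UnitGaussian.integral_eval_mul_map_smul {P : Measure Ω} {Z : ι → Ω → ℝ}
    (hZ : UnitGaussian Z P) (a : ℝ) (i k : ι) :
    ∫ x, x i * x k ∂(P.map fun ω => a • fun i => Z i ω) = a ^ 2 * cov[Z i, Z k; P] := by
  have := hZ.isProbabilityMeasure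
  have hm : Measurable fun ω => a • fun i => Z i ω :=
    (measurable_const_smul a).comp (measurable_pi_iff.2 hZ.measurable)
  have hm2 : Measurable fun x : ι → ℝ => x i * x k := by fun_prop
  rw [integral_map hm.aemeasurable hm2.aestronglyMeasurable,
    covariance_eq_sub (hZ.memLp i) (hZ.memLp k), hZ.mean, hZ.mean, mul_zero, sub_zero,
    ← integral_const_mul]
  refine integral_congr_ae (ae_of_all _ fun ω => ?_)
  simp only [Pi.smul_apply, smul_eq_mul, Pi.mul_apply]; ring

/-- Comparison of the maxima of two Gaussian vectors. -/
lemma UnitGaussian.abs_smoothCdf_sub_le (hf : ThreeDeriv f f₁ f₂ f₃ G) (hg : StepFunction g)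
    (hfg : ∀ x, |f x - g x| ≤ η) {b : ℝ} (hb : 1 ≤ b) {l : ℝ} (hl : 0 < l)
    {P : Measure Ω} {Q : Measure Ω'} {Z : ι → Ω → ℝ} {W : ι → Ω' → ℝ}
    (hZ : UnitGaussian Z P) (hW : UnitGaussian W Q) {Δ : ℝ}
    (hΔ : ∀ i k, |cov[Z i, Z k; P] - cov[W i, W k; Q]| ≤ Δ) (c : ℝ) :
    |smoothCdf g l P (fun ω => ⨆ i, Z i ω) c - smoothCdf g l Q (fun ω => ⨆ i, W i ω) c| ≤
      2 * η + 2 * G * (Real.log (Fintype.card ι) / b) + 3 * G * b * Δ / l ^ 2 := by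
  have := hZ.isProbabilityMeasure
  have := hW.isProbabilityMeasure
  have hb0 : 0 < b := by linarith
  have mZ : Measurable fun ω i => Z i ω := measurable_pi_iff.2 hZ.measurable
  have mW : Measurable fun ω i => W i ω := measurable_pi_iff.2 hW.measurable
  have a1 := abs_integral_smax_sub_smoothCdf_le hf hg hfg hb0 hl (P := P) mZ c
  have a2 := abs_integral_smax_sub_smoothCdf_le hf hg hfg hb0 hl (P := Q) mW c
  have mZ' : Measurable fun ω => l⁻¹ • fun i => Z i ω :=
    (measurable_const_smul l⁻¹).comp mZ
  have mW' : Measurable fun ω => l⁻¹ • fun i => W i ω :=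
    (measurable_const_smul l⁻¹).comp mW
  have gZ : IsGaussian (P.map fun ω => l⁻¹ • fun i => Z i ω) := (hZ.law.smul l⁻¹).isGaussian_map
  have gW : IsGaussian (Q.map fun ω => l⁻¹ • fun i => W i ω) := (hW.law.smul l⁻¹).isGaussian_map
  have hl2 : 0 < l⁻¹ ^ 2 := by positivity
  have key := abs_integral_gaussian_sub_le (hf.comp_sub (c / l)) hb _ _ (hZ.integral_eval_map_smul l⁻¹)
    (hW.integral_eval_map_smul l⁻¹) (Δ := l⁻¹ ^ 2 * Δ) fun i k => by
      rw [hZ.integral_eval_mul_map_smul, hW.integral_eval_mul_map_smul, ← mul_sub, abs_mul, abs_of_pos hl2]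
      exact mul_le_mul_of_nonneg_left (hΔ i k) hl2.le
  have mF : Measurable fun x : ι → ℝ => f (smax b x - c / l) :=
    (hf.continuous.comp (continuous_smax.sub continuous_const)).measurable
  rw [integral_map mZ'.aemeasurable mF.aestronglyMeasurable,
    integral_map mW'.aemeasurable mF.aestronglyMeasurable] at key
  have e : 3 * G * b * (l⁻¹ ^ 2 * Δ) = 3 * G * b * Δ / l ^ 2 := by
    rw [inv_pow]; field_simp
  rw [e] at key
  rw [abs_le] at *
  constructor <;> linarith [a1.1, a1.2, a2.1, a2.2, key.1, key.2]

end MaxComparison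

/-! ### Products of Gaussian laws: covariances and measurable dependence on parameters -/

open scoped MatrixOrder Matrix.Norms.L2Operator in
lemma continuousOn_matrix_sqrt {p : ℕ} :
    ContinuousOn (CFC.sqrt : Matrix (Fin p) (Fin p) ℝ → Matrix (Fin p) (Fin p) ℝ)
      {A | A.PosSemidef} := by
  have := CFC.continuousOn_sqrt (A := Matrix (Fin p) (Fin p) ℝ)
  simpa only [Matrix.nonneg_iff_posSemidef] using this

section GaussPi

variable {n p : ℕ}

/-- The law of independent `N(0, Σᵢ)` random vectors. -/
noncomputable def gaussPi (S : Fin n → Matrix (Fin p) (Fin p) ℝ) : Measure (Fin n → Vec p) :=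
  Measure.pi fun i => multivariateGaussian 0 (S i)

instance (S : Fin n → Matrix (Fin p) (Fin p) ℝ) : IsProbabilityMeasure (gaussPi S) := by
  unfold gaussPi; infer_instance

/-- The linear statistic `∑ⱼ aⱼ zⱼₘ`. -/
def linStat (a : Fin n → ℝ) (m : Fin p) (z : Fin n → Vec p) : ℝ := ∑ j, a j * z j m

lemma measurable_linStat (a : Fin n → ℝ) (m : Fin p) : Measurable (linStat a m) := by
  unfold linStat; fun_prop

lemma hasGaussianLaw_id_gaussPi (S : Fin n → Matrix (Fin p) (Fin p) ℝ) :
    HasGaussianLaw (fun z : Fin n → Vec p => z) (gaussPi S) := by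
  refine iIndepFun.hasGaussianLaw (X := fun i (z : Fin n → Vec p) => z i) (fun i => ?_) ?_
  · have : IsGaussian ((gaussPi S).map fun z => z i) := by
      have h := (measurePreserving_eval (fun i => multivariateGaussian 0 (S i)) i).map_eq
      have e : (gaussPi S).map (fun z => z i) = multivariateGaussian 0 (S i) := h
      rw [e]; infer_instance
    exact ⟨this⟩
  · exact iIndepFun_pi (X := fun _ : Fin n => (id : Vec p → Vec p)) fun _ => aemeasurable_id

lemma hasGaussianLaw_linStat {ι : Type*} [Fintype ι] (S : Fin n → Matrix (Fin p) (Fin p) ℝ)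
    (a : ι → Fin n → ℝ) (m : ι → Fin p) :
    HasGaussianLaw (fun z i => linStat (a i) (m i) z) (gaussPi S) := by
  let L : (Fin n → Vec p) →L[ℝ] (ι → ℝ) := ContinuousLinearMap.pi fun i =>
    ∑ j, a i j • (EuclideanSpace.proj (m i)).comp (ContinuousLinearMap.proj j)
  have h := (hasGaussianLaw_id_gaussPi S).map_fun L
  convert! h using 1
  ext z i
  simp [L, linStat]

lemma measurePreserving_eval_gaussPi (S : Fin n → Matrix (Fin p) (Fin p) ℝ) (j : Fin n) :
    MeasurePreserving (fun z : Fin n → Vec p => z j) (gaussPi S) (multivariateGaussian 0 (S j)) :=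
  measurePreserving_eval (fun i => multivariateGaussian 0 (S i)) j

lemma memLp_coord_multivariateGaussian (A : Matrix (Fin p) (Fin p) ℝ) (m : Fin p)
    (q : ENNReal) (hq : q ≠ ⊤) : MemLp (fun e : Vec p => e m) q (multivariateGaussian 0 A) :=
  IsGaussian.memLp_dual _ (EuclideanSpace.proj m) q hq

lemma memLp_coord_gaussPi (S : Fin n → Matrix (Fin p) (Fin p) ℝ) (j : Fin n) (m : Fin p) :
    MemLp (fun z : Fin n → Vec p => z j m) 2 (gaussPi S) :=
  (memLp_coord_multivariateGaussian (S j) m 2 (by simp)).comp_measurePreserving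
    (measurePreserving_eval_gaussPi S j)

lemma integral_coord_multivariateGaussian (A : Matrix (Fin p) (Fin p) ℝ) (m : Fin p) :
    ∫ e : Vec p, e m ∂(multivariateGaussian 0 A) = 0 := by
  have h := (EuclideanSpace.proj (𝕜 := ℝ) m).integral_comp_comm
    (IsGaussian.integrable_fun_id (μ := multivariateGaussian (0 : Vec p) A))
  rw [integral_id_multivariateGaussian] at h
  simpa using h

lemma integral_linStat_gaussPi (S : Fin n → Matrix (Fin p) (Fin p) ℝ) (a : Fin n → ℝ) (m : Fin p) :
    ∫ z, linStat a m z ∂(gaussPi S) = 0 := by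
  unfold linStat
  rw [integral_finsetSum _ fun j _ =>
    (((memLp_coord_gaussPi S j m).integrable (by norm_num)).const_mul _)]
  refine Finset.sum_eq_zero fun j _ => ?_
  rw [integral_const_mul]
  have h := (measurePreserving_eval_gaussPi S j).map_eq
  have e : ∫ z : Fin n → Vec p, z j m ∂(gaussPi S) =
      ∫ e : Vec p, e m ∂(multivariateGaussian 0 (S j)) := by
    rw [← h, integral_map (measurePreserving_eval_gaussPi S j).measurable.aemeasurable
      (by fun_prop)]
  rw [e, integral_coord_multivariateGaussian, mul_zero]

/-- Distinct observations are independent, so only the diagonal terms of the double sum remain. -/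
lemma cov_linStat_gaussPi {S : Fin n → Matrix (Fin p) (Fin p) ℝ} (hS : ∀ i, (S i).PosSemidef)
    (a a' : Fin n → ℝ) (m m' : Fin p) :
    cov[linStat a m, linStat a' m'; gaussPi S] = ∑ j, a j * a' j * S j m m' := by
  have hL := memLp_coord_gaussPi S
  have h1 : ∀ j k, cov[fun z : Fin n → Vec p => z j m, fun z => z k m'; gaussPi S] =
      if j = k then S j m m' else 0 := fun j k => by
    split_ifs with hjk
    · subst hjk
      rw [← covariance_eval_multivariateGaussian (μ := 0) (hS j) m m',
        ← (measurePreserving_eval_gaussPi S j).map_eq, covariance_map]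
      · rfl
      · fun_prop
      · fun_prop
      · exact (measurePreserving_eval_gaussPi S j).measurable.aemeasurable
    · have hind : iIndepFun (fun i (z : Fin n → Vec p) => z i) (gaussPi S) :=
        iIndepFun_pi (X := fun _ : Fin n => (id : Vec p → Vec p)) fun _ => aemeasurable_id
      have := (hind.indepFun hjk).comp (φ := fun e : Vec p => e m) (ψ := fun e : Vec p => e m')
        (by fun_prop) (by fun_prop)
      exact this.covariance_eq_zero (hL j m) (hL k m')
  unfold linStat
  rw [covariance_fun_sum_fun_sum (fun j => (hL j m).const_mul _) (fun j => (hL j m').const_mul _)]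
  refine Finset.sum_congr rfl fun j _ => ?_
  simp only [covariance_const_mul_left, covariance_const_mul_right, h1]
  simp [mul_assoc, mul_left_comm]

lemma unitGaussian_linStat {ι : Type*} [Fintype ι] {S : Fin n → Matrix (Fin p) (Fin p) ℝ}
    (hS : ∀ i, (S i).PosSemidef) (a : ι → Fin n → ℝ) (m : ι → Fin p)
    (h : ∀ i, ∑ j, a i j ^ 2 * S j (m i) (m i) = 1) :
    UnitGaussian (fun i => linStat (a i) (m i)) (gaussPi S) where
  measurable i := measurable_linStat _ _
  law := hasGaussianLaw_linStat S a m
  mean i := integral_linStat_gaussPi S _ _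
  var i := by
    rw [← covariance_self (measurable_linStat _ _).aemeasurable, cov_linStat_gaussPi hS, ← h i]
    exact Finset.sum_congr rfl fun j _ => by ring

-- Writing the law as an image of a fixed standard Gaussian moves the covariance matrices into the
-- integrand, where continuity of the matrix square root gives measurability in a parameter.
open scoped MatrixOrder in
lemma gaussPi_eq_map (S : Fin n → Matrix (Fin p) (Fin p) ℝ) :
    gaussPi S = (Measure.pi fun _ : Fin n => stdGaussian (Vec p)).map
      (fun u i => Matrix.toEuclideanCLM (𝕜 := ℝ) (CFC.sqrt (S i)) (u i)) := by
  unfold gaussPi multivariateGaussian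
  rw [← Measure.pi_map_pi fun i => by fun_prop]
  simp

lemma measurable_matrix_of_entries {α : Type*} [MeasurableSpace α]
    {M : α → Matrix (Fin p) (Fin p) ℝ} (h : ∀ m m', Measurable fun y => M y m m') :
    @Measurable _ _ _ (borel _) M := by
  have : @Measurable _ _ _ MeasurableSpace.pi M :=
    measurable_pi_iff.2 fun m => measurable_pi_iff.2 fun m' => h m m'
  have e : (MeasurableSpace.pi : MeasurableSpace (Fin p → Fin p → ℝ)) = borel _ :=
    BorelSpace.measurable_eq
  rw [e] at this
  exact this

open scoped MatrixOrder in
lemma measurable_matrix_sqrt {α : Type*} [MeasurableSpace α] {M : α → Matrix (Fin p) (Fin p) ℝ}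
    (h : ∀ m m', Measurable fun y => M y m m') (hM : ∀ y, (M y).PosSemidef) (m m' : Fin p) :
    Measurable fun y => CFC.sqrt (M y) m m' := by
  let : MeasurableSpace (Matrix (Fin p) (Fin p) ℝ) := borel _
  have : BorelSpace (Matrix (Fin p) (Fin p) ℝ) := ⟨rfl⟩
  have hc : Continuous fun A : {A : Matrix (Fin p) (Fin p) ℝ | A.PosSemidef} =>
      CFC.sqrt (A : Matrix (Fin p) (Fin p) ℝ) m m' := by
    have h1 := continuousOn_iff_continuous_domRestrict.1 (continuousOn_matrix_sqrt (p := p))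
    exact (h1.matrix_elem m m')
  exact hc.measurable.comp ((measurable_matrix_of_entries h).subtype_mk (h := hM))

open scoped MatrixOrder in
/-- Measurability of an expectation over independent Gaussian vectors in a parameter on which the
covariance matrices depend. -/
lemma measurable_integral_gaussPi {α : Type*} [MeasurableSpace α]
    {S : α → Fin n → Matrix (Fin p) (Fin p) ℝ}
    (hm : ∀ i m m', Measurable fun y => S y i m m') (hS : ∀ y i, (S y i).PosSemidef)
    {φ : α → (Fin n → Vec p) → ℝ} (hφ : Measurable (Function.uncurry φ)) :
    Measurable fun y => ∫ z, φ y z ∂(gaussPi (S y)) := by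
  have e : ∀ y, ∫ z, φ y z ∂(gaussPi (S y)) = ∫ u : Fin n → Vec p,
      φ y (fun i => Matrix.toEuclideanCLM (𝕜 := ℝ) (CFC.sqrt (S y i)) (u i))
        ∂(Measure.pi fun _ : Fin n => stdGaussian (Vec p)) := fun y => by
    rw [gaussPi_eq_map, integral_map]
    · exact Measurable.aemeasurable (by fun_prop)
    · exact (hφ.comp measurable_prodMk_left).aestronglyMeasurable
  simp_rw [e]
  have hM : Measurable fun q : α × (Fin n → Vec p) =>
      φ q.1 (fun i => Matrix.toEuclideanCLM (𝕜 := ℝ) (CFC.sqrt (S q.1 i)) (q.2 i)) := by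
    suffices h : Measurable fun q : α × (Fin n → Vec p) => ((q.1, fun i =>
        Matrix.toEuclideanCLM (𝕜 := ℝ) (CFC.sqrt (S q.1 i)) (q.2 i)) : α × (Fin n → Vec p)) from
      hφ.comp h
    refine Measurable.prodMk measurable_fst (measurable_pi_iff.2 fun i => ?_)
    have : (fun q : α × (Fin n → Vec p) =>
        Matrix.toEuclideanCLM (𝕜 := ℝ) (CFC.sqrt (S q.1 i)) (q.2 i)) = fun q =>
          WithLp.toLp 2 (fun m => ∑ m', CFC.sqrt (S q.1 i) m m' * q.2 i m') := by
      funext q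
      ext m
      rw [Matrix.ofLp_toEuclideanCLM]
      rfl
    rw [this]
    refine (WithLp.measurable_toLp 2 _).comp (measurable_pi_iff.2 fun m => ?_)
    refine Finset.measurable_sum _ fun m' _ => ?_
    have h1 : Measurable fun q : α × (Fin n → Vec p) => CFC.sqrt (S q.1 i) m m' :=
      (measurable_matrix_sqrt (hm i) (fun y => hS y i) m m').comp measurable_fst
    exact h1.mul (by fun_prop)
  exact (StronglyMeasurable.integral_prod_right hM.stronglyMeasurable).measurable

end GaussPi

/-! ### Measurability of the two tests -/

/-- A selected subset of a finite set takes finitely many values, and on each of them the function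
is a fixed measurable one. This handles the critical value based on the selected indices. -/
lemma measurable_of_finite_selection {α ι : Type*} [MeasurableSpace α] {S : Set ι}
    (hS : S.Finite) {A : α → Set ι} (hA : ∀ y, A y ⊆ S)
    (hm : ∀ s ∈ S, MeasurableSet {y | s ∈ A y}) {F : Set ι → α → ℝ}
    (hF : ∀ B ⊆ S, Measurable (F B)) : Measurable fun y => F (A y) y := by
  intro t ht
  have e : (fun y => F (A y) y) ⁻¹' t =
      ⋃ B ∈ 𝒫 S, ((⋂ s ∈ S, {y | s ∈ A y ↔ s ∈ B}) ∩ F B ⁻¹' t) := by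
    ext y
    simp only [Set.mem_preimage, Set.mem_iUnion, Set.mem_powerset_iff, Set.mem_inter_iff,
      Set.mem_iInter, exists_prop]
    constructor
    · exact fun h => ⟨A y, hA y, fun s _ => Iff.rfl, h⟩
    · rintro ⟨B, hB, hs, hy⟩
      have : A y = B := by
        ext s
        exact ⟨fun h => (hs s (hA y h)).1 h, fun h => (hs s (hB h)).2 h⟩
      rwa [this]
  rw [e]
  refine hS.finite_subsets.measurableSet_biUnion fun B hB => ?_
  refine MeasurableSet.inter (hS.measurableSet_biInter fun s hs => ?_) (hF B hB ht)
  by_cases hsB : s ∈ B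
  · simpa [hsB] using hm s hs
  · have e' : {y | s ∈ A y ↔ s ∈ B} = {y | s ∈ A y}ᶜ := by ext; simp [hsB]
    rw [e']
    exact (hm s hs).compl

lemma Model.measurable_response {d p n : ℕ} (w : Model d p n) (X : ℕ → Vec d) :
    Measurable (w.response X) := by
  refine measurable_pi_iff.2 fun i => (WithLp.measurable_toLp 2 _).comp ?_
  exact measurable_pi_iff.2 fun m => by fun_prop

namespace Design

variable {d p : ℕ} {D : Design d p}

lemma TuningCondition.stepFunction (h : D.TuningCondition) : StepFunction D.g₀ :=
  ⟨h.2.2.1.continuous, h.2.2.2.1, h.2.2.2.2.1, h.2.2.2.2.2.1⟩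

lemma TuningCondition.β_pos (h : D.TuningCondition) (n : ℕ) : 0 < D.β n := h.2.2.2.2.2.2.1 n

lemma TuningCondition.γ_pos (h : D.TuningCondition) (n : ℕ) : 0 < D.γ n := (h.2.2.2.2.2.2.2 n).1

lemma TuningCondition.γ_lt (h : D.TuningCondition) (n : ℕ) : D.γ n < D.α / 2 :=
  (h.2.2.2.2.2.2.2 n).2

lemma BandwidthCondition.finite (h : D.BandwidthCondition) (n : ℕ) : (D.bandwidths n).Finite := by
  obtain ⟨h0, h1, hmin, -⟩ := h
  have ht : Tendsto (fun k : ℕ => D.hmax * D.a ^ k) atTop (𝓝 (D.hmax * 0)) :=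
    (tendsto_pow_atTop_nhds_zero_of_lt_one h0.le h1).const_mul _
  rw [mul_zero] at ht
  obtain ⟨N, hN⟩ := eventually_atTop.1 (ht.eventually_lt_const (hmin n))
  refine ((Set.finite_lt_nat N).image fun k => D.hmax * D.a ^ k).subset ?_
  rintro _ ⟨⟨k, rfl⟩, hk⟩
  exact ⟨k, lt_of_not_ge fun hNk => absurd (hN k hNk) (not_lt.2 hk), rfl⟩

lemma BandwidthCondition.finite_indexSet (h : D.BandwidthCondition) (n : ℕ) :
    (D.indexSet n).Finite := by
  have : (Set.univ ×ˢ Set.univ ×ˢ D.bandwidths n : Set (Fin n × Fin p × ℝ)).Finite :=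
    Set.finite_univ.prod (Set.finite_univ.prod (h.finite n))
  exact this.subset fun s hs => ⟨trivial, trivial, hs.1⟩

lemma measurable_smooth (n : ℕ) (s : Fin n × Fin p × ℝ) : Measurable fun y => D.smooth n y s :=
  measurable_linStat _ _

lemma CovEstimator.measurable_sdHat (h : D.CovEstimator) (n : ℕ) (s : Fin n × Fin p × ℝ) :
    Measurable fun Y => D.sdHat n Y s :=
  (Finset.measurable_sum _ fun j _ => (h.1 n j s.2.1 s.2.1).const_mul _).sqrt

lemma simStat_eq_iSup (n : ℕ) (Y : Fin n → Vec p) (A : Set (Fin n × Fin p × ℝ))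
    (z : Fin n → Vec p) : D.simStat n Y A z = ⨆ s : A, D.smooth n z s / D.sdHat n Y s :=
  sSup_image'

lemma CovEstimator.measurable_uncurry_simStat (h : D.CovEstimator) (n : ℕ)
    {A : Set (Fin n × Fin p × ℝ)} (hA : A.Finite) :
    Measurable fun q : (Fin n → Vec p) × (Fin n → Vec p) => D.simStat n q.1 A q.2 := by
  have := hA.to_subtype
  simp_rw [simStat_eq_iSup]
  exact measurable_iSup_fin fun s =>
    ((measurable_smooth n s.1).comp measurable_snd).div
      ((h.measurable_sdHat n s.1).comp measurable_fst)

lemma measurable_simStat (n : ℕ)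
    {A : Set (Fin n × Fin p × ℝ)} (hA : A.Finite) (Y : Fin n → Vec p) :
    Measurable (D.simStat n Y A) := by
  have := hA.to_subtype
  have e : D.simStat n Y A = fun z => ⨆ s : A, D.smooth n z s / D.sdHat n Y s :=
    funext fun z => simStat_eq_iSup n Y A z
  rw [e]
  exact measurable_iSup_fin fun s => (measurable_smooth n s.1).div_const _

lemma simLaw_eq_gaussPi (n : ℕ) (Y : Fin n → Vec p) : D.simLaw n Y = gaussPi (D.covHat n Y) := rfl

instance (n : ℕ) (Y : Fin n → Vec p) : IsProbabilityMeasure (D.simLaw n Y) := by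
  rw [simLaw_eq_gaussPi]; infer_instance

/-- By the Galois connection, sublevel sets are defined by a parametric Gaussian integral,
measurable in the data. -/
lemma CovEstimator.measurable_critical (h : D.CovEstimator) (ht : D.TuningCondition) (n : ℕ)
    {A : Set (Fin n × Fin p × ℝ)} (hA : A.Finite) {q : ℝ} (h0 : 0 < q) (h1 : q < 1) :
    Measurable fun Y => D.critical n Y A q := by
  refine measurable_of_Iic fun t => ?_
  have e : (fun Y => D.critical n Y A q) ⁻¹' Set.Iic t =
      {Y | q ≤ ∫ z, D.g₀ ((D.simStat n Y A z - t) / D.β n) ∂(gaussPi (D.covHat n Y))} := by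
    ext Y
    exact smoothedQuantile_le_iff (μ := D.simLaw n Y) ht.stepFunction (ht.β_pos n)
      (measurable_simStat n hA Y) h0 h1 t
  rw [e]
  refine measurableSet_le measurable_const ?_
  refine measurable_integral_gaussPi (h.1 n) (h.2 n) ?_
  exact ht.stepFunction.cont.measurable.comp
    (((h.measurable_uncurry_simStat n hA).sub_const _).div_const _)

lemma CovEstimator.measurable_stat (h : D.CovEstimator) (hb : D.BandwidthCondition) (n : ℕ) :
    Measurable (D.stat n) :=
  Measurable.comp (g := fun q : (Fin n → Vec p) × (Fin n → Vec p) =>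
      D.simStat n q.1 (D.indexSet n) q.2) (f := fun Y => (Y, Y))
    (h.measurable_uncurry_simStat n (hb.finite_indexSet n)) (measurable_id.prodMk measurable_id)

lemma CovEstimator.measurable_acceptPIA (h : D.CovEstimator) (ht : D.TuningCondition)
    (hb : D.BandwidthCondition) (n : ℕ) : Measurable (D.acceptPIA n) := by
  have hc := h.measurable_critical ht n (hb.finite_indexSet n) (q := 1 - D.α)
    (by linarith [ht.2.1]) (by linarith [ht.1])
  exact ht.stepFunction.cont.measurable.comp (((h.measurable_stat hb n).sub hc).div_const _)

lemma TuningCondition.γ_lt_one (h : D.TuningCondition) (n : ℕ) : D.γ n < 1 / 2 := by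
  linarith [h.γ_lt n, h.2.1]

lemma rmsSet_subset (n : ℕ) (Y : Fin n → Vec p) : D.rmsSet n Y ⊆ D.indexSet n := fun _ hs => hs.1

lemma CovEstimator.measurable_acceptRMS (h : D.CovEstimator) (ht : D.TuningCondition)
    (hb : D.BandwidthCondition) (n : ℕ) : Measurable (D.acceptRMS n) := by
  classical
  have hS := hb.finite_indexSet n
  refine measurable_of_finite_selection hS (A := D.rmsSet n)
    (F := fun B Y => if B.Nonempty then
      D.g₀ ((D.stat n Y - D.critical n Y B (1 - D.α + 2 * D.γ n)) / D.β n) else 1)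
    (rmsSet_subset n) (fun s hs => ?_) (fun B hB => ?_)
  · have hc := h.measurable_critical ht n hS (q := 1 - D.γ n) (by linarith [ht.γ_lt_one n])
      (by linarith [ht.γ_pos n])
    have e : {Y | s ∈ D.rmsSet n Y} = {Y | -2 * (D.cPIA n Y (1 - D.γ n) + D.β n) <
        D.smooth n Y s / D.sdHat n Y s} := by
      ext Y
      exact ⟨fun h => h.2, fun h => ⟨hs, h⟩⟩
    rw [e]
    exact measurableSet_lt ((hc.add_const _).const_mul _)
      ((measurable_smooth n s).div (h.measurable_sdHat n s))
  · by_cases hBn : B.Nonempty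
    · simp only [hBn, if_true]
      have hc := h.measurable_critical ht n (hS.subset hB) (q := 1 - D.α + 2 * D.γ n)
        (by linarith [ht.2.1, ht.γ_pos n]) (by linarith [ht.γ_lt n])
      exact ht.stepFunction.cont.measurable.comp (((h.measurable_stat hb n).sub hc).div_const _)
    · simp only [hBn, if_false]
      exact measurable_const

end Design

/-! ### Uniform asymptotics for maxima of at most n³ Gaussian variables -/

lemma tendsto_log_mul_rpow_neg (a k : ℝ) {κ : ℝ} (hκ : 0 < κ) :
    Tendsto (fun n : ℕ => (a + k * Real.log n) * (n : ℝ) ^ (-κ)) atTop (𝓝 0) := by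
  have h1 : Tendsto (fun x : ℝ => x ^ (-κ)) atTop (𝓝 0) := tendsto_rpow_neg_atTop hκ
  have h2 : Tendsto (fun x : ℝ => Real.log x / x ^ κ) atTop (𝓝 0) :=
    (isLittleO_log_rpow_atTop hκ).tendsto_div_nhds_zero
  have h3 := ((h1.const_mul a).add (h2.const_mul k)).comp (tendsto_natCast_atTop_atTop (R := ℝ))
  rw [mul_zero, mul_zero, add_zero] at h3
  refine h3.congr fun n => ?_
  simp only [Function.comp_apply]
  rw [Real.rpow_neg (Nat.cast_nonneg n)]
  ring

/-- The Gaussian tail at 4 log n is exp(-8 (log n)²), which beats the union bound over n³ indices.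
-/
lemma eventually_cube_mul_exp_le {η : ℝ} (hη : 0 < η) :
    ∀ᶠ n : ℕ in atTop, (n : ℝ) ^ 3 * Real.exp (-(4 * Real.log n) ^ 2 / 2) ≤ η := by
  have h1 : ∀ᶠ n : ℕ in atTop, 1 ≤ Real.log n :=
    (Real.tendsto_log_atTop.comp tendsto_natCast_atTop_atTop).eventually_ge_atTop 1
  have h2 : ∀ᶠ n : ℕ in atTop, ((n : ℝ))⁻¹ ≤ η :=
    (tendsto_inv_atTop_zero.comp tendsto_natCast_atTop_atTop).eventually_le_const hη
  filter_upwards [h1, h2, eventually_ge_atTop 1] with n hL hn hn1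
  have hn0 : (0 : ℝ) < n := by exact_mod_cast hn1
  refine le_trans ?_ hn
  have e : (n : ℝ) ^ 3 = Real.exp (3 * Real.log n) := by
    rw [mul_comm, Real.exp_mul, Real.exp_log hn0]; norm_cast
  have e2 : ((n : ℝ))⁻¹ = Real.exp (-Real.log n) := by rw [Real.exp_neg, Real.exp_log hn0]
  rw [e, e2, ← Real.exp_add]
  refine Real.exp_le_exp.2 ?_
  nlinarith

/-- Anti-concentration of Gaussian maxima, uniformly over at most `n ^ 3` variables. -/
lemma eventually_real_iSup_mem_Icc_le {κ η : ℝ} (hκ : 0 < κ) (hη : 0 < η) :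
    ∀ᶠ n : ℕ in atTop, ∀ (ι : Type) [Fintype ι] [Nonempty ι] (Ω : Type) [MeasurableSpace Ω]
      (P : Measure Ω) (Z : ι → Ω → ℝ), UnitGaussian Z P → (Fintype.card ι : ℝ) ≤ (n : ℝ) ^ 3 →
      ∀ l c : ℝ, l ≤ (n : ℝ) ^ (-κ) → P.real {ω | (⨆ i, Z i ω) ∈ Set.Icc c (c + l)} ≤ η := by
  have h1 := (tendsto_log_mul_rpow_neg 1 4 hκ).eventually_le_const (u := min 1 (η / 2 / Real.exp 3))
    (by positivity)
  have h2 : ∀ᶠ n : ℕ in atTop, 1 ≤ Real.log n :=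
    (Real.tendsto_log_atTop.comp tendsto_natCast_atTop_atTop).eventually_ge_atTop 1
  filter_upwards [h1, h2, eventually_cube_mul_exp_le (half_pos hη), eventually_ge_atTop 1]
    with n h1 hL h3 hn ι _ _ Ω _ P Z hZ hcard l c hl
  have := hZ.isProbabilityMeasure
  have hn1 : (1 : ℝ) ≤ n := by exact_mod_cast hn
  set x : ℝ := (n : ℝ) ^ (-κ)
  have hx0 : 0 ≤ x := by positivity
  have hx1 : x ≤ 1 := Real.rpow_le_one_of_one_le_of_nonpos hn1 (by linarith)
  -- The extra 1 absorbs the length of the interval: y - x is still at least 4 log n, so the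
  -- union-bound term stays below η / 2.
  set y := 1 + 4 * Real.log n with hy
  have hy1 : 1 ≤ y := by linarith
  have hxy : x ≤ 1 / y := by
    rw [le_div_iff₀ (by linarith), mul_comm]; exact h1.trans (min_le_left _ _)
  have hxy2 : Real.exp 3 * x * y ≤ η / 2 := by
    have := h1.trans (min_le_right _ _)
    rw [le_div_iff₀ (Real.exp_pos 3)] at this
    linarith
  refine (measureReal_mono (fun ω hω => ?_)).trans
    ((hZ.real_iSup_mem_Icc_le c hx0 hy1 hxy).trans ?_)
  · exact ⟨hω.1, hω.2.trans (by linarith)⟩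
  · have h4 : Real.exp (-(y - x) ^ 2 / 2) ≤ Real.exp (-(4 * Real.log n) ^ 2 / 2) := by
      refine Real.exp_le_exp.2 ?_
      have : 4 * Real.log n ≤ y - x := by linarith
      nlinarith
    have h5 : Fintype.card ι * Real.exp (-(y - x) ^ 2 / 2) ≤
        (n : ℝ) ^ 3 * Real.exp (-(4 * Real.log n) ^ 2 / 2) := by gcongr
    linarith

/-- Modulus of continuity of the smoothed distribution function of a Gaussian maximum, uniformly
over all widths `β`. -/
lemma eventually_smoothCdf_add_le {g : ℝ → ℝ} (hg : StepFunction g) {κ η : ℝ} (hκ : 0 < κ)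
    (hη : 0 < η) :
    ∀ᶠ n : ℕ in atTop, ∀ (ι : Type) [Fintype ι] [Nonempty ι] (Ω : Type) [MeasurableSpace Ω]
      (P : Measure Ω) (Z : ι → Ω → ℝ), UnitGaussian Z P → (Fintype.card ι : ℝ) ≤ (n : ℝ) ^ 3 →
      ∀ β l c : ℝ, 0 < β → 0 ≤ l → l ≤ (n : ℝ) ^ (-κ) →
        smoothCdf g β P (fun ω => ⨆ i, Z i ω) (c + l) ≤
          smoothCdf g β P (fun ω => ⨆ i, Z i ω) c + η := by
  obtain ⟨G, hG, hgG⟩ := hg.exists_abs_sub_le (half_pos hη)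
  have h1 := (tendsto_log_mul_rpow_neg G 0 (half_pos hκ)).eventually_le_const (half_pos hη)
  have h2 := (tendsto_log_mul_rpow_neg 2 0 (by linarith : 0 < κ / 4)).eventually_le_const one_pos
  filter_upwards [h1, h2, eventually_real_iSup_mem_Icc_le (by linarith : 0 < κ / 4) hη,
    eventually_ge_atTop 1] with n h1 h2 h3 hn ι _ _ Ω _ P Z hZ hcard β l c hβ hl0 hl
  have := hZ.isProbabilityMeasure
  have hT : Measurable fun ω => ⨆ i, Z i ω := measurable_iSup_fin hZ.measurable
  have hn1 : (1 : ℝ) ≤ n := by exact_mod_cast hn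
  have hn0 : (0 : ℝ) < n := by linarith
  simp only [zero_mul, add_zero] at h1 h2
  set x : ℝ := (n : ℝ) ^ (-(κ / 2)) with hx
  have hx0 : 0 < x := by positivity
  have hxx : (n : ℝ) ^ (-κ) = x * x := by
    rw [hx, ← Real.rpow_add hn0]; ring_nf
  -- For a wide step a shift by `l` moves the argument by l / β ≤ x, and the approximate Lipschitz
  -- bound applies. For a narrow one the smoothed distribution functions are sandwiched between true
  -- ones, which differ by the mass of an interval of length l + β ≤ 2x.
  by_cases hβx : x ≤ β
  · rw [smoothCdf, smoothCdf, ← sub_le_iff_le_add', ← integral_sub (hg.integrable hT _)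
      (hg.integrable hT _)]
    have : η = ∫ _ω, η ∂P := by simp
    rw [this]
    refine integral_mono ((hg.integrable hT _).sub (hg.integrable hT _)) (integrable_const _)
      fun ω => ?_
    have h4 := (le_abs_self _).trans
      (hgG (((⨆ i, Z i ω) - (c + l)) / β) (((⨆ i, Z i ω) - c) / β))
    have h5 : |((⨆ i, Z i ω) - (c + l)) / β - ((⨆ i, Z i ω) - c) / β| ≤ x := by
      have e : ((⨆ i, Z i ω) - (c + l)) / β - ((⨆ i, Z i ω) - c) / β = -(l / β) := by ring
      rw [e, abs_neg, abs_of_nonneg (by positivity), div_le_iff₀ hβ]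
      nlinarith
    have h6 := mul_le_mul_of_nonneg_left h5 hG
    simp only
    linarith
  · rw [not_le] at hβx
    have hle := smoothCdf_le_real (μ := P) hg hβ hT (c + l)
    have hge := real_le_smoothCdf (μ := P) hg hβ hT c
    have hx2 : 2 * x ≤ (n : ℝ) ^ (-(κ / 4)) := by
      have e : x = (n : ℝ) ^ (-(κ / 4)) * (n : ℝ) ^ (-(κ / 4)) := by
        rw [hx, ← Real.rpow_add hn0]; ring_nf
      have h0 : 0 ≤ (n : ℝ) ^ (-(κ / 4)) := by positivity
      rw [e]; nlinarith
    have hx1 : x ≤ 1 := Real.rpow_le_one_of_one_le_of_nonpos hn1 (by linarith)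
    have h4 := h3 ι Ω P Z hZ hcard (l + β) c (by nlinarith)
    have h5 : P.real {ω | (⨆ i, Z i ω) ≤ c + l + β} ≤ P.real {ω | (⨆ i, Z i ω) ≤ c} +
        P.real {ω | (⨆ i, Z i ω) ∈ Set.Icc c (c + (l + β))} := by
      refine (measureReal_mono (fun ω hω => ?_)).trans (measureReal_union_le _ _)
      have hω' : (⨆ i, Z i ω) ≤ c + l + β := hω
      rcases le_total (⨆ i, Z i ω) c with h | h
      · exact Or.inl h
      · exact Or.inr ⟨h, by linarith⟩
    linarith

/-- Comparison of the smoothed distribution functions of two Gaussian maxima, uniformly over all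
widths `β`. -/
lemma eventually_abs_smoothCdf_sub_le {g : ℝ → ℝ} (hg : StepFunction g) {κ η : ℝ} (hκ : 0 < κ)
    (hη : 0 < η) :
    ∀ᶠ n : ℕ in atTop, ∀ (ι : Type) [Fintype ι] [Nonempty ι] (Ω Ω' : Type) [MeasurableSpace Ω]
      [MeasurableSpace Ω'] (P : Measure Ω) (Q : Measure Ω') (Z : ι → Ω → ℝ) (W : ι → Ω' → ℝ),
      UnitGaussian Z P → UnitGaussian W Q → (Fintype.card ι : ℝ) ≤ (n : ℝ) ^ 3 →
      (∀ i k, |cov[Z i, Z k; P] - cov[W i, W k; Q]| ≤ (n : ℝ) ^ (-κ)) →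
      ∀ β c : ℝ, 0 < β →
        |smoothCdf g β P (fun ω => ⨆ i, Z i ω) c - smoothCdf g β Q (fun ω => ⨆ i, W i ω) c| ≤
          η := by
  obtain ⟨f, f₁, f₂, f₃, G, hf, hfg⟩ :=
    exists_threeDeriv_approx hg.cont hg.one hg.zero hg.abs_le_one (by linarith : 0 < η / 16)
  have hG := hf.nonneg
  -- The smoothing error 2G (3 log n) / b has to be at most η / 8 for b = 1 + k log n.
  set k := 48 * G / η with hk
  have hk0 : 0 ≤ k := by positivity
  have h1 := (tendsto_log_mul_rpow_neg (3 * G) (3 * G * k) (half_pos hκ)).eventually_le_const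
    (by linarith : 0 < η / 8)
  have hlog : ∀ᶠ n : ℕ in atTop, 1 ≤ Real.log n :=
    (Real.tendsto_log_atTop.comp tendsto_natCast_atTop_atTop).eventually_ge_atTop 1
  filter_upwards [h1, hlog, eventually_real_iSup_mem_Icc_le (by linarith : 0 < κ / 4)
    (by linarith : 0 < η / 8),
    eventually_ge_atTop 1] with n h1 hlog h3 hn ι _ _ Ω Ω' _ _ P Q Z W hZ hW hcard hcov β c hβ
  have := hZ.isProbabilityMeasure
  have := hW.isProbabilityMeasure
  have mZ : Measurable fun ω => ⨆ i, Z i ω := measurable_iSup_fin hZ.measurable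
  have mW : Measurable fun ω => ⨆ i, W i ω := measurable_iSup_fin hW.measurable
  have hn1 : (1 : ℝ) ≤ n := by exact_mod_cast hn
  have hn0 : (0 : ℝ) < n := by linarith
  set x : ℝ := (n : ℝ) ^ (-(κ / 4)) with hx
  have hx0 : 0 < x := by positivity
  have hxx : (n : ℝ) ^ (-(κ / 2)) = x ^ 2 := by
    rw [hx, sq, ← Real.rpow_add hn0]; ring_nf
  have hxx' : (n : ℝ) ^ (-κ) = x ^ 4 := by
    rw [hx, ← Real.rpow_natCast, ← Real.rpow_mul hn0.le]; push_cast; ring_nf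
  set b := 1 + k * Real.log n with hb
  have hb1 : 1 ≤ b := by nlinarith
  have key : ∀ l, x ≤ l → ∀ c, |smoothCdf g l P (fun ω => ⨆ i, Z i ω) c -
      smoothCdf g l Q (fun ω => ⨆ i, W i ω) c| ≤ η / 2 := fun l hl c => by
    have hl0 : 0 < l := hx0.trans_le hl
    have hmain := hZ.abs_smoothCdf_sub_le hf hg hfg hb1 hl0 hW hcov c
    have hlc : Real.log (Fintype.card ι) ≤ 3 * Real.log n := by
      calc Real.log (Fintype.card ι) ≤ Real.log ((n : ℝ) ^ 3) :=
            Real.log_le_log (by exact_mod_cast Fintype.card_pos) hcard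
        _ = _ := by rw [Real.log_pow]; norm_cast
    have t1 : 2 * G * (Real.log (Fintype.card ι) / b) ≤ η / 8 := by
      rw [← mul_div_assoc, div_le_iff₀ (by linarith)]
      have : k * η = 48 * G := by rw [hk]; field_simp
      have h4 := mul_le_mul_of_nonneg_left hlc hG
      have h5 : η / 8 * b = η / 8 + 6 * G * Real.log n := by
        rw [hb]; linear_combination (Real.log n / 8) * this
      nlinarith
    have t2 : 3 * G * b * (n : ℝ) ^ (-κ) / l ^ 2 ≤ η / 8 := by
      rw [div_le_iff₀ (by positivity), hxx']
      rw [hxx] at h1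
      have h6 : 3 * G * b * x ^ 2 ≤ η / 8 := by rw [hb]; linarith
      have h7 : x ^ 2 ≤ l ^ 2 := by gcongr
      calc 3 * G * b * x ^ 4 = (3 * G * b * x ^ 2) * x ^ 2 := by ring
        _ ≤ η / 8 * l ^ 2 := by gcongr
    linarith
  -- A step narrower than n^{-κ/4} is first widened to that width; anti-concentration bounds the
  -- change, and at that width the covariance error divided by the squared width is still small.
  by_cases hβx : x ≤ β
  · exact (key β hβx c).trans (by linarith)
  · rw [not_le] at hβx
    have a1 := (abs_smoothCdf_sub_le (μ := P) hg hβ hβx.le mZ c).trans (h3 ι Ω P Z hZ hcard x c le_rfl)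
    have a2 := (abs_smoothCdf_sub_le (μ := Q) hg hβ hβx.le mW c).trans
      (h3 ι Ω' Q W hW hcard x c le_rfl)
    have a3 := key x le_rfl c
    rw [abs_le] at *
    constructor <;> linarith

end CMITest

namespace CMITest
namespace Design

variable {d p : ℕ} {D : Design d p}

/-! ### Kernel weights and the numbers of test points and bandwidths -/

lemma BandwidthCondition.pos (h : D.BandwidthCondition) {n : ℕ} {b : ℝ}
    (hb : b ∈ D.bandwidths n) : 0 < b := (h.2.2.1 n).trans_le hb.2

lemma DesignPointCondition.hmax_pos (h : D.DesignPointCondition) : 0 < D.hmax :=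
  (norm_nonneg _).trans_lt (h.1 0)

lemma KernelCondition.scaledKernel_nonneg (hK : D.KernelCondition) {h : ℝ} (hh : 0 < h)
    (x : Vec d) : 0 ≤ D.scaledKernel h x := div_nonneg (hK.1 _) (by positivity)

lemma KernelCondition.scaledKernel_le (hK : D.KernelCondition) {h : ℝ} (hh : 0 < h)
    (x : Vec d) : D.scaledKernel h x ≤ 1 / h ^ d :=
  div_le_div_of_nonneg_right (hK.2.2.1 _) (by positivity)

lemma KernelCondition.scaledKernel_eq_zero (hK : D.KernelCondition) {h : ℝ} (hh : 0 < h)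
    {x : Vec d} (hx : h < ‖x‖) : D.scaledKernel h x = 0 := by
  rw [scaledKernel, hK.2.1, zero_div]
  rw [norm_smul, norm_inv, Real.norm_of_nonneg hh.le, inv_mul_eq_div]
  exact (one_lt_div hh).2 hx

/-- The deterministic properties of the weights and the index set, at sample size `n`, which
govern the behaviour of the test. -/
structure RegularAt (D : Design d p) (A : ℝ) (n : ℕ) : Prop where
  pos : 0 < n
  nonneg : ∀ h ∈ D.bandwidths n, ∀ i j, 0 ≤ D.weight n h i j
  sum_sq_pos : ∀ h ∈ D.bandwidths n, ∀ i, 0 < ∑ j, D.weight n h i j ^ 2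
  sq_le : ∀ h ∈ D.bandwidths n, ∀ i j,
    D.weight n h i j ^ 2 * (n * D.hmin n ^ d) ≤ A * ∑ k, D.weight n h i k ^ 2
  support : ∀ h ∈ D.bandwidths n, ∀ i j, D.weight n h i j ≠ 0 → ‖D.X i - D.X j‖ ≤ h
  nonempty : (D.indexSet n).Nonempty
  card : ((D.indexSet n).ncard : ℝ) ≤ (n : ℝ) ^ 3

lemma sum_scaledKernel_ge (hK : D.KernelCondition) {n : ℕ} {h C : ℝ} (hh : 0 < h)
    (hC : ∀ x : Vec d, ‖x‖ ≤ 1 / 2 → C ≤ D.K x) (i : Fin n) :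
    C / h ^ d * D.localCount n (h / 2) i ≤ ∑ k : Fin n, D.scaledKernel h (D.X i - D.X k) := by
  classical
  have e : D.localCount n (h / 2) i =
      (Finset.univ.filter fun j : Fin n => ‖D.X j - D.X i‖ ≤ h / 2).card := by
    rw [localCount, Set.ncard_eq_toFinset_card']
    congr 1
    ext; simp
  rw [e, mul_comm, ← nsmul_eq_mul, ← Finset.sum_const]
  refine (Finset.sum_le_sum fun k hk => ?_).trans
    (Finset.sum_le_sum_of_subset_of_nonneg (Finset.filter_subset _ _) fun k _ _ =>
      hK.scaledKernel_nonneg hh _)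
  refine div_le_div_of_nonneg_right (hC _ ?_) (by positivity)
  have := (Finset.mem_filter.1 hk).2
  rw [norm_smul, norm_inv, Real.norm_of_nonneg hh.le, inv_mul_eq_div, div_le_iff₀ hh, norm_sub_rev]
  linarith

/-- The normalizing sum is at least a constant times n, by the points in the half ball, so each
weight is O(1 / (n h^d)). The weights sum to one over O(n h^d) points, so by Cauchy-Schwarz their
squares sum to at least a constant over n h^d. Hence no weight carries more than a fraction O(1 / (n
h_min^d)) of the variance. -/
lemma eventually_weights (hX : D.DesignPointCondition) (hb : D.BandwidthCondition)
    (hK : D.KernelCondition) : ∃ A, 0 < A ∧ ∀ᶠ n : ℕ in atTop, ∀ h ∈ D.bandwidths n,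
      (∀ i j, 0 ≤ D.weight n h i j) ∧ (∀ i, 0 < ∑ j, D.weight n h i j ^ 2) ∧
      (∀ i j, D.weight n h i j ^ 2 * (n * D.hmin n ^ d) ≤ A * ∑ k, D.weight n h i k ^ 2) ∧
      (∀ i j, D.weight n h i j ≠ 0 → ‖D.X i - D.X j‖ ≤ h) := by
  obtain ⟨-, C₁, C₂, hC₁, hC₁₂, hev⟩ := hX
  obtain ⟨C, hC, -, hKC⟩ := hK.2.2.2
  have hC₂ : 0 < C₂ := hC₁.trans hC₁₂
  refine ⟨C₂ / (C * C₁) ^ 2, by positivity, ?_⟩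
  filter_upwards [hev, eventually_ge_atTop 1] with n hn hn1 h hh
  have hh0 := hb.pos hh
  have hn0 : (0 : ℝ) < n := by exact_mod_cast hn1
  have hden : ∀ i : Fin n, C * C₁ * n ≤ ∑ k : Fin n, D.scaledKernel h (D.X i - D.X k) := fun i => by
    refine le_trans ?_ (sum_scaledKernel_ge hK hh0 hKC i)
    have h1 := (hn i h hh).1
    calc C * C₁ * n = C / h ^ d * (C₁ * n * h ^ d) := by field_simp
      _ ≤ _ := by gcongr
  have hcn : 0 < C * C₁ * n := by positivity
  have hden0 : ∀ i : Fin n, 0 < ∑ k : Fin n, D.scaledKernel h (D.X i - D.X k) := fun i =>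
    hcn.trans_le (hden i)
  have hnn : ∀ i j, 0 ≤ D.weight n h i j := fun i j =>
    div_nonneg (hK.scaledKernel_nonneg hh0 _) (hden0 i).le
  have hsum : ∀ i, ∑ j, D.weight n h i j = 1 := fun i => by
    simp only [weight]
    rw [← Finset.sum_div, div_self (hden0 i).ne']
  have hsupp : ∀ i j, D.weight n h i j ≠ 0 → ‖D.X i - D.X j‖ ≤ h := fun i j hij => by
    by_contra hlt
    exact hij (by rw [weight, hK.scaledKernel_eq_zero hh0 (not_le.1 hlt), zero_div])
  have hle : ∀ i j, D.weight n h i j * (C * C₁ * (n * h ^ d)) ≤ 1 := fun i j => by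
    have h1 : D.weight n h i j ≤ (1 / h ^ d) / (C * C₁ * n) :=
      div_le_div₀ (by positivity) (hK.scaledKernel_le hh0 _) hcn (hden i)
    calc _ ≤ (1 / h ^ d) / (C * C₁ * n) * (C * C₁ * (n * h ^ d)) := by gcongr
      _ = 1 := by field_simp
  have hCS : ∀ i, 1 ≤ C₂ * (n * h ^ d) * ∑ j, D.weight n h i j ^ 2 := fun i => by
    classical
    set F := Finset.univ.filter fun j : Fin n => ‖D.X j - D.X i‖ ≤ h
    have hF : (F.card : ℝ) ≤ C₂ * n * h ^ d := by
      have e : D.localCount n h i = F.card := by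
        rw [localCount, Set.ncard_eq_toFinset_card']
        congr 1
        ext; simp [F]
      rw [← e]; exact (hn i h hh).2
    have h1 : ∑ j ∈ F, D.weight n h i j = 1 := by
      rw [← hsum i]
      refine Finset.sum_subset (Finset.subset_univ _) fun j _ hj => ?_
      by_contra hne
      exact hj (Finset.mem_filter.2 ⟨Finset.mem_univ _, by
        rw [norm_sub_rev]; exact hsupp i j hne⟩)
    have h2 := sq_sum_le_card_mul_sum_sq (s := F) (f := fun j => D.weight n h i j)
    rw [h1, one_pow] at h2
    refine h2.trans ?_
    have h3 : ∑ j ∈ F, D.weight n h i j ^ 2 ≤ ∑ j, D.weight n h i j ^ 2 :=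
      Finset.sum_le_sum_of_subset_of_nonneg (Finset.filter_subset _ _) fun _ _ _ => sq_nonneg _
    rw [← mul_assoc]
    gcongr
  have hhd : 0 < n * h ^ d := by positivity
  have hpos : ∀ i, 0 < ∑ j, D.weight n h i j ^ 2 := fun i => by
    by_contra hle0
    have := hCS i
    have h4 : C₂ * (n * h ^ d) * ∑ j, D.weight n h i j ^ 2 ≤ 0 :=
      mul_nonpos_of_nonneg_of_nonpos (by positivity) (not_lt.1 hle0)
    linarith
  refine ⟨hnn, hpos, fun i j => ?_, hsupp⟩
  have h1 := hle i j
  have h2 : D.weight n h i j ^ 2 * (C * C₁) ^ 2 * (n * h ^ d) ^ 2 ≤ 1 := by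
    have h0 : 0 ≤ D.weight n h i j * (C * C₁ * (n * h ^ d)) :=
      mul_nonneg (hnn i j) (by positivity)
    calc _ = (D.weight n h i j * (C * C₁ * (n * h ^ d))) ^ 2 := by ring
      _ ≤ 1 := pow_le_one₀ h0 h1
  have h3 : D.weight n h i j ^ 2 * (C * C₁) ^ 2 * (n * h ^ d) ≤
      C₂ * ∑ j, D.weight n h i j ^ 2 := by
    have h4 := h2.trans (hCS i)
    have h5 : (n * h ^ d) * (D.weight n h i j ^ 2 * (C * C₁) ^ 2 * (n * h ^ d)) ≤
        (n * h ^ d) * (C₂ * ∑ j, D.weight n h i j ^ 2) := by linarith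
    exact le_of_mul_le_mul_left h5 hhd
  have h6 : n * D.hmin n ^ d ≤ n * h ^ d := by
    have := hh.2
    have := (hb.2.2.1 n).le
    gcongr
  rw [div_mul_eq_mul_div, le_div_iff₀ (by positivity)]
  calc _ = D.weight n h i j ^ 2 * (C * C₁) ^ 2 * (n * D.hmin n ^ d) := by ring
    _ ≤ D.weight n h i j ^ 2 * (C * C₁) ^ 2 * (n * h ^ d) := by gcongr
    _ ≤ _ := h3

lemma eventually_ncard_indexSet_le (hb : D.BandwidthCondition) :
    ∀ᶠ n : ℕ in atTop, ((D.indexSet n).ncard : ℝ) ≤ (n : ℝ) ^ 3 := by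
  obtain ⟨C, hC, hev⟩ := hb.2.2.2.2
  have h1 := (tendsto_log_mul_rpow_neg 0 (p * C) one_pos).eventually_le_const one_pos
  filter_upwards [hev, h1, eventually_ge_atTop 1] with n hn h1 hn1
  have hn0 : (1 : ℝ) ≤ n := by exact_mod_cast hn1
  have hsub : D.indexSet n ⊆ Set.univ ×ˢ Set.univ ×ˢ D.bandwidths n :=
    fun s hs => ⟨trivial, trivial, hs.1⟩
  have hle := Set.ncard_le_ncard hsub
    (Set.finite_univ.prod (Set.finite_univ.prod (hb.finite n)))
  rw [Set.ncard_prod, Set.ncard_prod, Set.ncard_univ, Set.ncard_univ, Nat.card_fin, Nat.card_fin]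
    at hle
  have h2 : ((D.indexSet n).ncard : ℝ) ≤ n * (p * (D.bandwidths n).ncard) := by exact_mod_cast hle
  rw [zero_add, Real.rpow_neg_one, ← div_eq_mul_inv, div_le_one (by linarith)] at h1
  calc _ ≤ n * (p * (D.bandwidths n).ncard : ℝ) := h2
    _ ≤ n * (p * (C * Real.log n)) := by gcongr
    _ ≤ n * n := by gcongr; linarith
    _ ≤ n ^ 3 := by nlinarith [mul_nonneg (by linarith : (0 : ℝ) ≤ n) (by linarith : (0 : ℝ) ≤ n)]

lemma eventually_regularAt (hp : 0 < p) (hX : D.DesignPointCondition) (hb : D.BandwidthCondition)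
    (hK : D.KernelCondition) (hT : D.TestPointCondition) :
    ∃ A, 0 < A ∧ ∀ᶠ n : ℕ in atTop, D.RegularAt A n := by
  obtain ⟨A, hA, hev⟩ := eventually_weights hX hb hK
  refine ⟨A, hA, ?_⟩
  filter_upwards [hev, eventually_ncard_indexSet_le hb, eventually_ge_atTop 1,
    hb.2.2.2.1.eventually_le_const hX.hmax_pos] with n hn hcard hn1 hmin
  refine ⟨hn1, fun h hh => (hn h hh).1, fun h hh => (hn h hh).2.1, fun h hh => (hn h hh).2.2.1,
    fun h hh => (hn h hh).2.2.2, ?_, hcard⟩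
  -- The coarsest bandwidth is admissible once `hmin` falls below `hmax`; the covering condition
  -- there supplies a test point.
  have hmem : D.hmax ∈ D.bandwidths n := ⟨⟨0, by simp⟩, hmin⟩
  obtain ⟨j, hj, -⟩ := (hT n _ hmem).2 ⟨0, hn1⟩
  exact ⟨(j, ⟨0, hp⟩, D.hmax), hmem, hj⟩

/-- The witness is the largest exponent of an admissible bandwidth: all others lie among 0, …, k,
and k → ∞ since `hmin` tends to 0. -/
lemma eventually_exists_min_bandwidth (hX : D.DesignPointCondition) (hb : D.BandwidthCondition)
    (M : ℕ) : ∀ᶠ n : ℕ in atTop, ∃ k, M ≤ k ∧ D.hmax * D.a ^ k ∈ D.bandwidths n ∧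
      (D.bandwidths n).ncard ≤ k + 1 := by
  have ha0 := hb.1
  have ha1 := hb.2.1
  have hm0 := hX.hmax_pos
  filter_upwards [hb.2.2.2.1.eventually_le_const (by positivity : 0 < D.hmax * D.a ^ M)] with n hn
  have hfin := hb.finite n
  have hinj : Function.Injective fun k : ℕ => D.hmax * D.a ^ k := fun k l hkl =>
    pow_right_injective₀ ha0 ha1.ne (mul_left_cancel₀ hm0.ne' hkl)
  set T : Set ℕ := (fun k : ℕ => D.hmax * D.a ^ k) ⁻¹' D.bandwidths n with hT
  have hTfin : T.Finite := hfin.preimage hinj.injOn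
  have hMT : M ∈ T := ⟨⟨M, rfl⟩, hn⟩
  obtain ⟨k, hkT, hk⟩ := hTfin.exists_maximal ⟨M, hMT⟩
  have hk' : ∀ j ∈ T, j ≤ k := fun j hj => by
    rcases le_total j k with h | h
    · exact h
    · exact hk hj h
  refine ⟨k, hk' M hMT, hkT, ?_⟩
  have hsub : D.bandwidths n ⊆ (fun k : ℕ => D.hmax * D.a ^ k) '' (Finset.range (k + 1)) := by
    rintro _ ⟨⟨j, rfl⟩, hj⟩
    exact ⟨j, by simpa [Nat.lt_succ_iff] using hk' j ⟨⟨j, rfl⟩, hj⟩, rfl⟩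
  calc _ ≤ _ := Set.ncard_le_ncard hsub ((Finset.finite_toSet _).image _)
    _ ≤ (Finset.range (k + 1) : Set ℕ).ncard := Set.ncard_image_le (Finset.finite_toSet _)
    _ = k + 1 := by rw [Set.ncard_coe_finset, Finset.card_range]

/-- The covering property bounds the number of test points from below. -/
lemma one_le_card_mul (hT : D.TestPointCondition) {n : ℕ} (hn : 0 < n) {h h' C : ℝ}
    (hh : h ∈ D.bandwidths n) (hh' : 2 * h ≤ h')
    (hC : ∀ i : ℕ, (D.localCount n h' i : ℝ) ≤ C * n * h' ^ d) :
    1 ≤ (D.I n h).card * (C * h' ^ d) := by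
  classical
  have hcov : (Finset.univ : Finset (Fin n)) ⊆
      (D.I n h).biUnion fun j => Finset.univ.filter fun i : Fin n => ‖D.X i - D.X j‖ ≤ h' := by
    intro i _
    obtain ⟨j, hj, hij⟩ := (hT n h hh).2 i
    exact Finset.mem_biUnion.2 ⟨j, hj, Finset.mem_filter.2 ⟨Finset.mem_univ _, hij.trans hh'⟩⟩
  have h1 := (Finset.card_le_card hcov).trans Finset.card_biUnion_le
  rw [Finset.card_univ, Fintype.card_fin] at h1
  have h2 : (n : ℝ) ≤ ∑ _j ∈ D.I n h, C * n * h' ^ d := by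
    calc (n : ℝ) ≤ ∑ j ∈ D.I n h,
          ((Finset.univ.filter fun i : Fin n => ‖D.X i - D.X j‖ ≤ h').card : ℝ) := by
          exact_mod_cast h1
      _ ≤ _ := Finset.sum_le_sum fun j _ => by
          have e : D.localCount n h' j =
              (Finset.univ.filter fun i : Fin n => ‖D.X i - D.X j‖ ≤ h').card := by
            rw [localCount, Set.ncard_eq_toFinset_card']
            congr 1
            ext; simp
          rw [← e]; exact hC j
  rw [Finset.sum_const, nsmul_eq_mul] at h2
  have hn0 : (0 : ℝ) < n := by exact_mod_cast hn
  refine le_of_mul_le_mul_left (a := (n : ℝ)) ?_ hn0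
  linarith

/-- The number of bandwidth values is at most of the order of the logarithm of the number of test
points at one of them. -/
lemma exists_eventually_log_card_ge (hd : 0 < d) (hX : D.DesignPointCondition)
    (hb : D.BandwidthCondition) (hT : D.TestPointCondition) :
    ∃ B, 0 < B ∧ ∀ M : ℝ, ∀ᶠ n : ℕ in atTop, ∃ h ∈ D.bandwidths n, M ≤ Real.log (D.I n h).card ∧
      ((D.bandwidths n).ncard : ℝ) ≤ B * Real.log (D.I n h).card := by
  obtain ⟨C₁, C₂, hC₁, hC₁₂, hev⟩ := hX.2
  have hC₂ : 0 < C₂ := hC₁.trans hC₁₂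
  have ha0 := hb.1
  have ha1 := hb.2.1
  have hm0 := hX.hmax_pos
  -- The covering balls have radius 2h, but points are counted only in balls whose radius is an
  -- admissible bandwidth. Lowering the exponent by `r` at least doubles the bandwidth and stays
  -- admissible.
  obtain ⟨r, hr⟩ := exists_pow_lt_of_lt_one (by norm_num : (0 : ℝ) < 1 / 2) ha1
  set v := -Real.log D.a with hv
  have hv0 : 0 < v := by have := Real.log_neg ha0 ha1; linarith
  -- Taking logarithms of the covering bound gives log N ≥ kv - E. Requiring k ≥ 2E / v + 1 makes
  -- this at least (k + 1)v / 2, and k + 1 bounds the number of bandwidths.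
  set E := |Real.log (C₂ * D.hmax ^ d)| + d * r * v with hE
  have hE0 : 0 ≤ E := by positivity
  refine ⟨4 / v, by positivity, fun M => ?_⟩
  obtain ⟨M', hM'⟩ := exists_nat_ge (max (2 * E / v + 1) (2 * |M| / v) + r)
  filter_upwards [hev, eventually_exists_min_bandwidth hX hb M', eventually_ge_atTop 1] with
    n hn ⟨k, hMk, hk, hcard⟩ hn1
  have hMk' : (M' : ℝ) ≤ k := by exact_mod_cast hMk
  have hk1 : 2 * E / v + 1 ≤ k := by
    have := le_max_left (2 * E / v + 1) (2 * |M| / v)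
    have : (0 : ℝ) ≤ r := by positivity
    linarith
  have hk2 : 2 * |M| / v ≤ k := by
    have := le_max_right (2 * E / v + 1) (2 * |M| / v)
    have : (0 : ℝ) ≤ r := by positivity
    linarith
  have hrk : r ≤ k := by
    have : 0 ≤ 2 * |M| / v := by positivity
    have := le_max_right (2 * E / v + 1) (2 * |M| / v)
    have h3 : (r : ℝ) ≤ k := by linarith
    exact_mod_cast h3
  have hmem : D.hmax * D.a ^ (k - r) ∈ D.bandwidths n :=
    ⟨⟨_, rfl⟩, hk.2.trans (mul_le_mul_of_nonneg_left
      (pow_le_pow_of_le_one ha0.le ha1.le (Nat.sub_le _ _)) hm0.le)⟩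
  have h2 : 2 * (D.hmax * D.a ^ k) ≤ D.hmax * D.a ^ (k - r) := by
    have e : D.a ^ k = D.a ^ (k - r) * D.a ^ r := by rw [← pow_add, Nat.sub_add_cancel hrk]
    rw [e]
    have : 0 < D.hmax * D.a ^ (k - r) := by positivity
    nlinarith
  have hone := one_le_card_mul hT hn1 hk h2 fun i => (hn i _ hmem).2
  set N := (D.I n (D.hmax * D.a ^ k)).card
  have hN0 : (0 : ℝ) < N := by
    by_contra h0
    have h5 : (N : ℝ) = 0 := le_antisymm (not_lt.1 h0) (Nat.cast_nonneg _)
    rw [h5, zero_mul] at hone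
    linarith
  have hlog : 0 ≤ Real.log N + (Real.log (C₂ * D.hmax ^ d) - d * (k - r) * v) := by
    have h6 := Real.log_nonneg hone
    rw [Real.log_mul hN0.ne' (by positivity), mul_pow, ← mul_assoc,
      Real.log_mul (by positivity) (by positivity), ← pow_mul, Real.log_pow] at h6
    push_cast [hrk] at h6
    rw [hv]; linarith
  have hd1 : (1 : ℝ) ≤ d := by exact_mod_cast hd
  have hkv : k * v ≤ d * (k * v) := le_mul_of_one_le_left (by positivity) hd1
  have habs := le_abs_self (Real.log (C₂ * D.hmax ^ d))
  have hlow : k * v - E ≤ Real.log N := by rw [hE]; linarith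
  have hE2 : 2 * E + v ≤ k * v := by
    have := mul_le_mul_of_nonneg_right hk1 hv0.le
    rw [add_mul, div_mul_cancel₀ _ hv0.ne'] at this
    linarith
  have hM2 : 2 * |M| ≤ k * v := by rwa [div_le_iff₀ hv0] at hk2
  refine ⟨_, hk, ?_, ?_⟩
  · linarith [le_abs_self M]
  · have h7 : ((D.bandwidths n).ncard : ℝ) ≤ k + 1 := by exact_mod_cast hcard
    refine h7.trans ?_
    rw [div_mul_eq_mul_div, le_div_iff₀ hv0]
    linarith

end Design
-- Moments of the noise and its Gaussian approximation
namespace Model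

variable {d p n : ℕ} {c : ModelConstants} {X : ℕ → Vec d} {w : Model d p n}

lemma DisturbanceCondition.memLp (h : w.DisturbanceCondition c X) (hδ : 0 < c.δ) (i : Fin n)
    (m : Fin p) {q : ENNReal} (hq : q ≤ 4) : MemLp (fun e : Vec p => e m) q (w.noise i) := by
  have := h.1 i
  have h1 := (h.2.1 i m).1
  have h2 : MemLp (fun e : Vec p => e m) (ENNReal.ofReal (4 + c.δ)) (w.noise i) := by
    rw [← integrable_norm_rpow_iff (by fun_prop)
      (ENNReal.ofReal_pos.2 (by linarith)).ne' ENNReal.ofReal_ne_top,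
      ENNReal.toReal_ofReal (by linarith)]
    exact h1
  refine h2.mono_exponent (hq.trans ?_)
  rw [show (4 : ENNReal) = ENNReal.ofReal 4 by simp]
  exact ENNReal.ofReal_le_ofReal (by linarith)

lemma DisturbanceCondition.integral_abs_pow_le (h : w.DisturbanceCondition c X) (hδ : 0 < c.δ)
    (i : Fin n) (m : Fin p) {k : ℕ} (hk : k ≤ 4) :
    Integrable (fun e : Vec p => |e m| ^ k) (w.noise i) ∧
      ∫ e : Vec p, |e m| ^ k ∂(w.noise i) ≤ 1 + c.Cmom := by
  have := h.1 i
  obtain ⟨h1, h2⟩ := h.2.1 i m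
  have hle : ∀ e : Vec p, |e m| ^ k ≤ 1 + |e m| ^ (4 + c.δ) := fun e => by
    rcases le_total |e m| 1 with he | he
    · have := pow_le_one₀ (n := k) (abs_nonneg (e m)) he
      have : 0 ≤ |e m| ^ (4 + c.δ) := by positivity
      linarith
    · have : |e m| ^ (k : ℝ) ≤ |e m| ^ (4 + c.δ) :=
        Real.rpow_le_rpow_of_exponent_le he (by
          have : (k : ℝ) ≤ 4 := by exact_mod_cast hk
          linarith)
      rw [Real.rpow_natCast] at this
      linarith
  have hI : Integrable (fun e : Vec p => 1 + |e m| ^ (4 + c.δ)) (w.noise i) :=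
    (integrable_const 1).add h1
  have hint : Integrable (fun e : Vec p => |e m| ^ k) (w.noise i) :=
    hI.mono' (Measurable.aestronglyMeasurable (by fun_prop)) (ae_of_all _ fun e => by
      rw [Real.norm_of_nonneg (by positivity)]; exact hle e)
  refine ⟨hint, (integral_mono hint hI hle).trans ?_⟩
  rw [integral_add (integrable_const _) h1]
  simpa using h2

lemma DisturbanceCondition.cov_le (h : w.DisturbanceCondition c X) (hδ : 0 < c.δ)
    (i : Fin n) (m : Fin p) : w.cov i m m ≤ 1 + c.Cmom := by
  refine le_trans (le_of_eq ?_) (h.integral_abs_pow_le hδ i m (k := 2) (by norm_num)).2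
  simp only [cov, Matrix.of_apply, sq_abs]
  exact integral_congr_ae (ae_of_all _ fun e => by simp only; ring)

lemma DisturbanceCondition.le_cov (h : w.DisturbanceCondition c X) (i : Fin n) (m : Fin p) :
    c.cvar ≤ w.cov i m m := h.2.2.2.2.2 i m

lemma DisturbanceCondition.posSemidef_cov (h : w.DisturbanceCondition c X) (hδ : 0 < c.δ)
    (i : Fin n) : (w.cov i).PosSemidef := by
  refine Matrix.PosSemidef.of_dotProduct_mulVec_nonneg ?_ fun x => ?_
  · ext a b
    simp [cov, mul_comm]
  · have hint : ∀ a b : Fin p, Integrable (fun e : Vec p => e a * e b) (w.noise i) := fun a b =>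
      (h.memLp hδ i a (q := 2) (by norm_num)).integrable_mul (h.memLp hδ i b (q := 2) (by norm_num))
    have e : star x ⬝ᵥ Matrix.mulVec (w.cov i) x = ∫ e : Vec p, (∑ a, x a * e a) ^ 2 ∂(w.noise i) := by
      have : ∀ e : Vec p, (∑ a, x a * e a) ^ 2 = ∑ a, ∑ b, x a * x b * (e a * e b) := fun e => by
        rw [sq, Finset.sum_mul_sum]
        exact Finset.sum_congr rfl fun a _ => Finset.sum_congr rfl fun b _ => by ring
      simp_rw [this]
      rw [integral_finsetSum _ fun a _ => integrable_finsetSum _ fun b _ => (hint a b).const_mul _]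
      simp only [dotProduct, Matrix.mulVec, cov, Matrix.of_apply, Finset.mul_sum]
      refine Finset.sum_congr rfl fun a _ => ?_
      rw [integral_finsetSum _ fun b _ => (hint a b).const_mul _]
      refine Finset.sum_congr rfl fun b _ => ?_
      rw [integral_const_mul]
      simp only [star_trivial]
      ring
    rw [e]
    exact integral_nonneg fun _ => sq_nonneg _

end Model

/-- The third absolute moment of the standard normal distribution. -/
noncomputable def stdAbsCube : ℝ := ∫ x, |x| ^ 3 ∂(gaussianReal 0 1)

lemma stdAbsCube_nonneg : 0 ≤ stdAbsCube := integral_nonneg fun _ => by positivity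

lemma integrable_abs_cube_multivariateGaussian {p : ℕ} (A : Matrix (Fin p) (Fin p) ℝ) (m : Fin p) :
    Integrable (fun z : Vec p => |z m| ^ 3) (multivariateGaussian 0 A) := by
  have := (memLp_coord_multivariateGaussian A m 3 (by norm_num)).integrable_norm_pow (p := 3)
    (by norm_num)
  exact this

lemma integral_abs_cube_multivariateGaussian {p : ℕ} {A : Matrix (Fin p) (Fin p) ℝ}
    (hA : A.PosSemidef) (m : Fin p) :
    ∫ z : Vec p, |z m| ^ 3 ∂(multivariateGaussian 0 A) = √(A m m) ^ 3 * stdAbsCube := by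
  have hmap : (multivariateGaussian 0 A).map (fun z : Vec p => z m) =
      (gaussianReal 0 1).map (√(A m m) * ·) := by
    have hL : HasGaussianLaw (fun z : Vec p => z m) (multivariateGaussian 0 A) := by
      have h0 : HasGaussianLaw (fun z : Vec p => z) (multivariateGaussian 0 A) :=
        ⟨by rw [Measure.map_id']; infer_instance⟩
      exact h0.map_fun (EuclideanSpace.proj (𝕜 := ℝ) m)
    rw [hL.map_eq_gaussianReal, gaussianReal_map_const_mul, integral_coord_multivariateGaussian,
      ← covariance_self (by fun_prop), covariance_eval_multivariateGaussian hA]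
    congr 1
    · simp
    · ext
      have := hA.diag_nonneg (i := m)
      simp [Real.sq_sqrt, this]
  have h1 : ∫ z : Vec p, |z m| ^ 3 ∂(multivariateGaussian 0 A) =
      ∫ x, |x| ^ 3 ∂((multivariateGaussian 0 A).map (fun z : Vec p => z m)) := by
    rw [integral_map (by fun_prop) (by fun_prop)]
  rw [h1, hmap, integral_map (by fun_prop) (by fun_prop), stdAbsCube, ← integral_const_mul]
  refine integral_congr_ae (ae_of_all _ fun x => ?_)
  simp only [abs_mul, mul_pow, abs_of_nonneg (Real.sqrt_nonneg (A m m))]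

/-- Coordinatewise linear images of a vector. -/
lemma norm_mul_coord_cube_le {p : ℕ} {ι : Type*} [Fintype ι] {a : ι → ℝ} {m : ι → Fin p} {κ : ℝ}
    (hκ : 0 ≤ κ) (ha : ∀ i, |a i| ≤ κ) (e : Vec p) :
    ‖fun i => a i * e (m i)‖ ^ 3 ≤ κ ^ 3 * ∑ k, |e k| ^ 3 := by
  have hpt : ∀ i, (|a i * e (m i)|) ^ 3 ≤ κ ^ 3 * ∑ k, |e k| ^ 3 := fun i => by
    rw [abs_mul, mul_pow]
    have h1 : |e (m i)| ^ 3 ≤ ∑ k, |e k| ^ 3 :=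
      Finset.single_le_sum (f := fun k => |e k| ^ 3) (fun _ _ => by positivity) (Finset.mem_univ _)
    have h2 := ha i
    gcongr
  rcases isEmpty_or_nonempty ι with hι | hι
  · rw [Subsingleton.elim (fun i => a i * e (m i)) 0]
    rw [norm_zero, zero_pow (by norm_num)]
    positivity
  · obtain ⟨i, hi⟩ := Finite.exists_max fun i => |a i * e (m i)|
    have h1 : ‖fun i => a i * e (m i)‖ ≤ |a i * e (m i)| :=
      (pi_norm_le_iff_of_nonneg (abs_nonneg _)).2 hi
    exact (pow_le_pow_left₀ (norm_nonneg _) h1 3).trans (hpt i)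

/-- The j-th summand is the vector of all aᵢⱼ e_{m(i)}. Only `p` coordinates of the noise enter it,
so its sup norm cubed has moment at most κ³ times p times a constant, however many statistics there
are. The Gaussian third moments are controlled by the variances, hence by the same moment bound. -/
lemma abs_smoothCdf_noise_sub_le {d p n : ℕ} {c : ModelConstants} {X : ℕ → Vec d}
    {w : Model d p n} (h : w.DisturbanceCondition c X) (hδ : 0 < c.δ) (hC : 0 < c.Cmom)
    {g f f₁ f₂ f₃ : ℝ → ℝ} {G η : ℝ}
    (hf : ThreeDeriv f f₁ f₂ f₃ G) (hg : StepFunction g)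
    (hfg : ∀ x, |f x - g x| ≤ η) {b : ℝ} (hb : 1 ≤ b) {β : ℝ} (hβ : 0 < β)
    {ι : Type*} [Fintype ι] [Nonempty ι] {a : ι → Fin n → ℝ} {m : ι → Fin p} {κ : ℝ}
    (hκ : 0 ≤ κ) (ha : ∀ i j, |a i j| ≤ κ) (t : ℝ) :
    |smoothCdf g β w.noiseLaw (fun e => ⨆ i, linStat (a i) (m i) e) t -
      smoothCdf g β (gaussPi w.cov) (fun z => ⨆ i, linStat (a i) (m i) z) t| ≤
      2 * η + 2 * G * (Real.log (Fintype.card ι) / b) + 6 * G * b ^ 2 *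
        (n * (κ ^ 3 * (p * (1 + c.Cmom + √(1 + c.Cmom) ^ 3 * stdAbsCube)))) / β ^ 3 := by
  have := h.1
  have hpsd := h.posSemidef_cov hδ
  set Xj : Fin n → Vec p → ι → ℝ := fun j e i => a i j * e (m i) with hXj
  have hm : ∀ j, Measurable (Xj j) := fun j => measurable_pi_iff.2 fun i => by fun_prop
  have e1 : ∀ (ω : Fin n → Vec p) i, (∑ j, Xj j (ω j)) i = linStat (a i) (m i) ω := fun ω i => by
    rw [Finset.sum_apply]; rfl
  have hstd := stdAbsCube_nonneg
  have hs3 : 0 ≤ √(1 + c.Cmom) ^ 3 * stdAbsCube := by positivity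
  have hR : ∀ (μ : Measure (Vec p)) (M : ℝ), (∀ k, Integrable (fun e : Vec p => |e k| ^ 3) μ) →
      (∀ k, ∫ e : Vec p, |e k| ^ 3 ∂μ ≤ M) →
      ∀ j, ∫ e, ‖Xj j e‖ ^ 3 ∂μ ≤ κ ^ 3 * (p * M) := fun μ M hI hM j => by
    have hI' : Integrable (fun e : Vec p => κ ^ 3 * ∑ k, |e k| ^ 3) μ :=
      (integrable_finsetSum _ fun k _ => hI k).const_mul _
    have hle : ∀ e, ‖Xj j e‖ ^ 3 ≤ κ ^ 3 * ∑ k, |e k| ^ 3 := fun e =>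
      norm_mul_coord_cube_le (m := m) hκ (fun i => ha i j) e
    have hI'' : Integrable (fun e => ‖Xj j e‖ ^ 3) μ :=
      hI'.mono' ((hm j).norm.pow_const 3).aestronglyMeasurable (ae_of_all _ fun e => by
        rw [Real.norm_of_nonneg (by positivity)]; exact hle e)
    refine (integral_mono hI'' hI' hle).trans ?_
    rw [integral_const_mul, integral_finsetSum _ fun k _ => hI k]
    gcongr
    calc _ ≤ ∑ _k : Fin p, M := Finset.sum_le_sum fun k _ => hM k
      _ = p * M := by simp
  have hmem : ∀ (μ : Measure (Vec p)) [IsProbabilityMeasure μ],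
      (∀ k, MemLp (fun e : Vec p => e k) 3 μ) → ∀ j, MemLp (Xj j) 3 μ := fun μ _ hk j =>
    MemLp.of_eval fun i => (hk (m i)).const_mul (a i j)
  have key := abs_smoothCdf_sum_sub_le hf hg hfg hb hβ w.noise
    (fun j => multivariateGaussian 0 (w.cov j)) hm hm
    (fun j => hmem _ (fun k => h.memLp hδ j k (by norm_num)) j)
    (fun j => hmem _ (fun k => memLp_coord_multivariateGaussian _ k 3 (by norm_num)) j)
    (fun j i => by simp only [hXj, integral_const_mul, h.2.2.1 j (m i), mul_zero])
    (fun j i => by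
      simp only [hXj, integral_const_mul, integral_coord_multivariateGaussian, mul_zero])
    (fun j i k => by
      have hcov := covariance_eval_multivariateGaussian (μ := 0) (hpsd j) (m i) (m k)
      rw [covariance_eq_sub (memLp_coord_multivariateGaussian _ _ 2 (by norm_num))
        (memLp_coord_multivariateGaussian _ _ 2 (by norm_num)),
        integral_coord_multivariateGaussian, integral_coord_multivariateGaussian, mul_zero,
        sub_zero] at hcov
      have e2 : ∀ e : Vec p, Xj j e i * Xj j e k = a i j * a k j * (e (m i) * e (m k)) :=
        fun e => by simp only [hXj]; ring
      simp only [e2, integral_const_mul]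
      congr 1
      exact hcov.symm)
    (R := κ ^ 3 * (p * (1 + c.Cmom + √(1 + c.Cmom) ^ 3 * stdAbsCube)))
    (fun j => hR _ _ (fun k => (h.integral_abs_pow_le hδ j k (by norm_num)).1)
      (fun k => ((h.integral_abs_pow_le hδ j k (by norm_num)).2).trans (by linarith)) j)
    (fun j => hR _ _ (fun k => integrable_abs_cube_multivariateGaussian _ k)
      (fun k => by
        rw [integral_abs_cube_multivariateGaussian (hpsd j)]
        have h3 := h.cov_le hδ j k
        have h4 : √(w.cov j k k) ^ 3 * stdAbsCube ≤ √(1 + c.Cmom) ^ 3 * stdAbsCube := by gcongr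
        linarith) j) t
  simp only [e1] at key
  exact key

lemma UnitGaussian.abs_cov_le_one {Ω ι : Type*} [MeasurableSpace Ω] [Fintype ι] {Z : ι → Ω → ℝ}
    {P : Measure Ω} (h : UnitGaussian Z P) (i k : ι) : |cov[Z i, Z k; P]| ≤ 1 := by
  have := h.isProbabilityMeasure
  have h1 := variance_nonneg (Z i + Z k) P
  rw [variance_add (h.memLp i) (h.memLp k), h.var, h.var] at h1
  exact abs_le.2 ⟨by linarith, h.cov_le_one i k⟩

/-- A perturbation by `l` off `B` shifts the level by `l` and costs the mass of `B`; one-sidedness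
allows it to be used in both directions. -/
lemma smoothCdf_le_add_real {Ω : Type*} [MeasurableSpace Ω] {g : ℝ → ℝ} {β : ℝ} {μ : Measure Ω}
    [IsProbabilityMeasure μ] {T T' : Ω → ℝ} (hg : StepFunction g) (hβ : 0 < β) (hT : Measurable T)
    (hT' : Measurable T') {B : Set Ω} (hB : MeasurableSet B) {l : ℝ}
    (h : ∀ ω, ω ∉ B → T ω ≤ T' ω + l) (t : ℝ) :
    smoothCdf g β μ T' t ≤ smoothCdf g β μ T (t + l) + μ.real B := by
  have hI : Integrable (B.indicator (1 : Ω → ℝ)) μ := (integrable_const (1 : ℝ)).indicator hB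
  rw [smoothCdf, smoothCdf, ← integral_indicator_one hB, ← integral_add (hg.integrable hT _) hI]
  refine integral_mono (hg.integrable hT' _) ((hg.integrable hT _).add hI) fun ω => ?_
  by_cases hω : ω ∈ B
  · simp only [Set.indicator_of_mem hω, Pi.one_apply]
    linarith [hg.le_one ((T' ω - t) / β), hg.nonneg ((T ω - (t + l)) / β)]
  · simp only [Set.indicator_of_notMem hω, add_zero]
    exact hg.anti (div_le_div_of_nonneg_right (by linarith [h ω hω]) hβ.le)

lemma abs_entry_le_norm_toEuclideanCLM {p : ℕ} (A : Matrix (Fin p) (Fin p) ℝ) (m m' : Fin p) :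
    |A m m'| ≤ ‖Matrix.toEuclideanCLM (𝕜 := ℝ) A‖ := by
  have e : A m m' = Matrix.toEuclideanCLM (𝕜 := ℝ) A (EuclideanSpace.single m' 1) m := by
    rw [Matrix.ofLp_toEuclideanCLM]
    simp
  have h1 := PiLp.norm_apply_le (Matrix.toEuclideanCLM (𝕜 := ℝ) A (EuclideanSpace.single m' 1)) m
  have h2 := (Matrix.toEuclideanCLM (𝕜 := ℝ) A).le_opNorm (EuclideanSpace.single m' 1)
  rw [← e, Real.norm_eq_abs] at h1
  simp only [PiLp.norm_single, norm_one, mul_one] at h2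
  exact h1.trans h2

lemma linStat_mul {n p : ℕ} (σ : ℝ) (a : Fin n → ℝ) (m : Fin p) (z : Fin n → Vec p) :
    linStat (fun j => σ * a j) m z = σ * linStat a m z := by
  simp only [linStat, Finset.mul_sum, mul_assoc]

/-! ### Standardized statistics and estimated variances at a fixed sample size -/

namespace Design

variable {d p n : ℕ} {D : Design d p}

/-- The standard deviation of the kernel smoother at `s`. -/
noncomputable def sd (D : Design d p) (w : Model d p n) (s : Fin n × Fin p × ℝ) : ℝ :=
  √(∑ j : Fin n, D.weight n s.2.2 s.1 j ^ 2 * w.cov j s.2.1 s.2.1)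

/-- The weights of the kernel smoother at `s`, standardized to variance one. -/
noncomputable def coef (D : Design d p) (w : Model d p n) (s : Fin n × Fin p × ℝ) (j : Fin n) : ℝ :=
  D.weight n s.2.2 s.1 j / D.sd w s

/-- The studentized smoothed noise. -/
noncomputable def resid (D : Design d p) (w : Model d p n) (s : Fin n × Fin p × ℝ)
    (e : Fin n → Vec p) : ℝ :=
  D.smooth n e s / D.sdHat n (w.response D.X e) s

/-- The smoothed distribution function of the Gaussian analogue of the maximal statistic. -/
noncomputable def gaussCdf (D : Design d p) (w : Model d p n) (A : Set (Fin n × Fin p × ℝ))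
    (t : ℝ) : ℝ :=
  smoothCdf D.g₀ (D.β n) (gaussPi w.cov) (fun z => ⨆ s : A, linStat (D.coef w s) s.1.2.1 z) t

/-- The assumptions on the test, apart from those on the regression function. -/
structure Assumptions (D : Design d p) (c : ModelConstants) (κ : ℝ) : Prop where
  hd : 0 < d
  hp : 0 < p
  hδ : 0 < c.δ
  hCmom : 0 < c.Cmom
  hcvar : 0 < c.cvar
  tuning : D.TuningCondition
  design : D.DesignPointCondition
  bandwidth : D.BandwidthCondition
  estimator : D.CovEstimator
  hκ : 0 < κ
  variance : D.VarianceEstimatorCondition c κ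
  kernel : D.KernelCondition
  testFunction : D.TestFunctionCondition
  testPoints : D.TestPointCondition

section Fixed

variable {c : ModelConstants} {w : Model d p n} {A : ℝ} {s : Fin n × Fin p × ℝ}

lemma cvar_mul_sum_sq_le (h : w.DisturbanceCondition c D.X) (s : Fin n × Fin p × ℝ) :
    c.cvar * ∑ j, D.weight n s.2.2 s.1 j ^ 2 ≤
      ∑ j : Fin n, D.weight n s.2.2 s.1 j ^ 2 * w.cov j s.2.1 s.2.1 := by
  rw [Finset.mul_sum]
  refine Finset.sum_le_sum fun j _ => ?_
  rw [mul_comm]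
  exact mul_le_mul_of_nonneg_left (h.le_cov j _) (sq_nonneg _)

lemma RegularAt.sum_pos (hr : D.RegularAt A n) (h : w.DisturbanceCondition c D.X)
    (hc : 0 < c.cvar) (hs : s ∈ D.indexSet n) :
    0 < ∑ j : Fin n, D.weight n s.2.2 s.1 j ^ 2 * w.cov j s.2.1 s.2.1 :=
  (mul_pos hc (hr.sum_sq_pos _ hs.1 _)).trans_le (cvar_mul_sum_sq_le h s)

lemma RegularAt.sd_pos (hr : D.RegularAt A n) (h : w.DisturbanceCondition c D.X)
    (hc : 0 < c.cvar) (hs : s ∈ D.indexSet n) : 0 < D.sd w s :=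
  Real.sqrt_pos.2 (hr.sum_pos h hc hs)

lemma RegularAt.sd_sq (hr : D.RegularAt A n) (h : w.DisturbanceCondition c D.X)
    (hc : 0 < c.cvar) (hs : s ∈ D.indexSet n) : D.sd w s ^ 2 =
      ∑ j : Fin n, D.weight n s.2.2 s.1 j ^ 2 * w.cov j s.2.1 s.2.1 :=
  Real.sq_sqrt (hr.sum_pos h hc hs).le

lemma RegularAt.sum_coef_sq_mul_cov (hr : D.RegularAt A n) (h : w.DisturbanceCondition c D.X)
    (hc : 0 < c.cvar) (hs : s ∈ D.indexSet n) :
    ∑ j, D.coef w s j ^ 2 * w.cov j s.2.1 s.2.1 = 1 := by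
  simp only [coef, div_pow, div_mul_eq_mul_div]
  rw [← Finset.sum_div, ← hr.sd_sq h hc hs, div_self (pow_pos (hr.sd_pos h hc hs) 2).ne']

lemma RegularAt.sum_coef_sq_le (hr : D.RegularAt A n) (h : w.DisturbanceCondition c D.X)
    (hc : 0 < c.cvar) (hs : s ∈ D.indexSet n) : ∑ j, D.coef w s j ^ 2 ≤ 1 / c.cvar := by
  rw [le_div_iff₀ hc, ← hr.sum_coef_sq_mul_cov h hc hs, Finset.sum_mul]
  exact Finset.sum_le_sum fun j _ => mul_le_mul_of_nonneg_left (h.le_cov j _) (sq_nonneg _)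

/-- The share of one observation in the sum of squared weights bounds its share in the variance,
since the error variances are at least `c.cvar`. This is the negligibility that Lindeberg's method
needs. -/
lemma RegularAt.abs_coef_le (hr : D.RegularAt A n) (h : w.DisturbanceCondition c D.X)
    (hc : 0 < c.cvar) (hm : 0 < D.hmin n) (hs : s ∈ D.indexSet n) (j : Fin n) :
    |D.coef w s j| ≤ √(A / c.cvar / (n * D.hmin n ^ d)) := by
  refine Real.le_sqrt_of_sq_le ?_
  have hn : (0 : ℝ) < n := by exact_mod_cast hr.pos
  have h1 := hr.sq_le _ hs.1 s.1 j
  have h2 := cvar_mul_sum_sq_le h s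
  rw [sq_abs, coef, div_pow, hr.sd_sq h hc hs, div_div, div_le_div_iff₀ (hr.sum_pos h hc hs)
    (by positivity)]
  have hA : 0 ≤ A := by
    by_contra hA
    have h3 := hr.sum_sq_pos _ hs.1 s.1
    have h4 : 0 ≤ D.weight n s.2.2 s.1 j ^ 2 * (n * D.hmin n ^ d) := by positivity
    nlinarith
  calc _ = c.cvar * (D.weight n s.2.2 s.1 j ^ 2 * (n * D.hmin n ^ d)) := by ring
    _ ≤ c.cvar * (A * ∑ k, D.weight n s.2.2 s.1 k ^ 2) := by gcongr
    _ = A * (c.cvar * ∑ k, D.weight n s.2.2 s.1 k ^ 2) := by ring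
    _ ≤ _ := by gcongr

lemma RegularAt.unitGaussian (hr : D.RegularAt A n) (h : w.DisturbanceCondition c D.X)
    (hδ : 0 < c.δ) (hc : 0 < c.cvar) {E : Set (Fin n × Fin p × ℝ)} [Fintype E]
    (hE : E ⊆ D.indexSet n) {σ : ℝ} (hσ : σ ^ 2 = 1) :
    UnitGaussian (fun s : E => linStat (fun j => σ * D.coef w s j) s.1.2.1) (gaussPi w.cov) :=
  unitGaussian_linStat (h.posSemidef_cov hδ) _ _ fun s => by
    rw [← hr.sum_coef_sq_mul_cov h hc (hE s.2)]
    exact Finset.sum_congr rfl fun j _ => by rw [mul_pow, hσ, one_mul]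

lemma RegularAt.unitGaussian_one (hr : D.RegularAt A n) (h : w.DisturbanceCondition c D.X)
    (hδ : 0 < c.δ) (hc : 0 < c.cvar) {E : Set (Fin n × Fin p × ℝ)} [Fintype E]
    (hE : E ⊆ D.indexSet n) :
    UnitGaussian (fun s : E => linStat (D.coef w s) s.1.2.1) (gaussPi w.cov) :=
  unitGaussian_linStat (h.posSemidef_cov hδ) _ _ fun s => hr.sum_coef_sq_mul_cov h hc (hE s.2)

lemma RegularAt.card_le (hr : D.RegularAt A n) (hfin : (D.indexSet n).Finite)
    {E : Set (Fin n × Fin p × ℝ)} [Fintype E] (hE : E ⊆ D.indexSet n) :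
    (Fintype.card E : ℝ) ≤ (n : ℝ) ^ 3 := by
  refine le_trans ?_ hr.card
  rw [← Nat.card_eq_fintype_card, Nat.card_coe_set_eq]
  exact_mod_cast Set.ncard_le_ncard hE hfin

/-- The variance estimator is close to the variance, uniformly over the index set. -/
lemma RegularAt.abs_sdHat_sq_sub_le (hr : D.RegularAt A n) (h : w.DisturbanceCondition c D.X)
    (hc : 0 < c.cvar) {x : ℝ} (hx : 0 ≤ x) {Y : Fin n → Vec p}
    (hY : ∀ j m m', |D.covHat n Y j m m' - w.cov j m m'| ≤ c.cvar * x) (hs : s ∈ D.indexSet n) :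
    |∑ j : Fin n, D.weight n s.2.2 s.1 j ^ 2 * D.covHat n Y j s.2.1 s.2.1 - D.sd w s ^ 2| ≤
      x * D.sd w s ^ 2 := by
  have h1 := cvar_mul_sum_sq_le h s
  rw [hr.sd_sq h hc hs, ← Finset.sum_sub_distrib]
  refine (Finset.abs_sum_le_sum_abs _ _).trans ?_
  refine le_trans (Finset.sum_le_sum (g := fun j => D.weight n s.2.2 s.1 j ^ 2 * (c.cvar * x))
    fun j _ => ?_) ?_
  · rw [← mul_sub, abs_mul, abs_of_nonneg (sq_nonneg _)]
    exact mul_le_mul_of_nonneg_left (hY j _ _) (sq_nonneg _)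
  · rw [← Finset.sum_mul]
    nlinarith

/-- The variances are relatively within `x`, and dividing the difference of squares by the sum of
the standard deviations transfers this to the standard deviations. The factor 2 comes from passing
from the true to the estimated one in the denominator. -/
lemma RegularAt.sdHat_bounds (hr : D.RegularAt A n) (h : w.DisturbanceCondition c D.X)
    (hc : 0 < c.cvar) {x : ℝ} (hx : 0 ≤ x) (hx2 : x ≤ 1 / 2) {Y : Fin n → Vec p}
    (hY : ∀ j m m', |D.covHat n Y j m m' - w.cov j m m'| ≤ c.cvar * x) (hs : s ∈ D.indexSet n) :
    0 < D.sdHat n Y s ∧ D.sdHat n Y s ^ 2 =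
      ∑ j : Fin n, D.weight n s.2.2 s.1 j ^ 2 * D.covHat n Y j s.2.1 s.2.1 ∧
      |D.sd w s / D.sdHat n Y s - 1| ≤ 2 * x := by
  have h1 := abs_le.1 (hr.abs_sdHat_sq_sub_le h hc hx hY hs)
  set q := ∑ j : Fin n, D.weight n s.2.2 s.1 j ^ 2 * D.covHat n Y j s.2.1 s.2.1 with hq
  have hV := hr.sd_pos h hc hs
  set V := D.sd w s
  have hV2 : 0 < V ^ 2 := by positivity
  have hq0 : 0 < q := by nlinarith
  have hs0 : 0 < D.sdHat n Y s := Real.sqrt_pos.2 hq0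
  have hsq : D.sdHat n Y s ^ 2 = q := Real.sq_sqrt hq0.le
  refine ⟨hs0, hsq, ?_⟩
  set v := D.sdHat n Y s
  have h2 : |V - v| ≤ 2 * x * v := by
    rw [← hsq] at h1
    have h4 : |V - v| * (V + v) ≤ x * V ^ 2 := by
      have : |V - v| * (V + v) = |v ^ 2 - V ^ 2| := by
        rw [← abs_of_pos (by linarith : 0 < V + v), ← abs_mul, abs_sub_comm (v ^ 2)]
        congr 1
        ring
      rw [this, abs_le]; exact ⟨by linarith [h1.1], h1.2⟩
    have hVv : V ≤ 2 * v := by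
      by_contra hlt
      rw [not_le] at hlt
      nlinarith
    have h5 : |V - v| * V ≤ x * V * V := by
      nlinarith [abs_nonneg (V - v)]
    have h6 : |V - v| ≤ x * V := le_of_mul_le_mul_right h5 hV
    nlinarith
  rw [div_sub_one hs0.ne', abs_div, abs_of_pos hs0, div_le_iff₀ hs0]
  exact h2

lemma RegularAt.sim_unitGaussian (hr : D.RegularAt A n) (h : w.DisturbanceCondition c D.X)
    (hc : 0 < c.cvar) (he : D.CovEstimator) {x : ℝ} (hx : 0 ≤ x) (hx2 : x ≤ 1 / 2)
    {Y : Fin n → Vec p} (hY : ∀ j m m', |D.covHat n Y j m m' - w.cov j m m'| ≤ c.cvar * x)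
    {E : Set (Fin n × Fin p × ℝ)} [Fintype E] (hE : E ⊆ D.indexSet n) :
    UnitGaussian (fun s : E => linStat (fun j => D.weight n s.1.2.2 s.1.1 j / D.sdHat n Y s)
      s.1.2.1) (gaussPi (D.covHat n Y)) :=
  unitGaussian_linStat (he.2 n Y) _ _ fun s => by
    obtain ⟨h0, h1, -⟩ := hr.sdHat_bounds h hc hx hx2 hY (hE s.2)
    simp only [div_pow, div_mul_eq_mul_div]
    rw [← Finset.sum_div, ← h1, div_self (pow_pos h0 2).ne']

/-- Replacing the matrices under the true standardization costs `x`, as the squared coefficients sum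
to at most `1 / c.cvar`. The two standard deviation ratios have product within `6 * x` of one and
multiply a covariance of size at most 2, so the total is 13 = 6 · 2 + 1. -/
lemma RegularAt.abs_cov_sub_le (hr : D.RegularAt A n) (h : w.DisturbanceCondition c D.X)
    (hδ : 0 < c.δ) (hc : 0 < c.cvar) (he : D.CovEstimator) {x : ℝ} (hx : 0 ≤ x) (hx2 : x ≤ 1 / 2)
    {Y : Fin n → Vec p} (hY : ∀ j m m', |D.covHat n Y j m m' - w.cov j m m'| ≤ c.cvar * x)
    {E : Set (Fin n × Fin p × ℝ)} [Fintype E] (hE : E ⊆ D.indexSet n) (s t : E) :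
    |cov[linStat (fun j => D.weight n s.1.2.2 s.1.1 j / D.sdHat n Y s) s.1.2.1,
        linStat (fun j => D.weight n t.1.2.2 t.1.1 j / D.sdHat n Y t) t.1.2.1;
        gaussPi (D.covHat n Y)] -
      cov[linStat (D.coef w s) s.1.2.1, linStat (D.coef w t) t.1.2.1; gaussPi w.cov]| ≤
      13 * x := by
  have hone := (hr.unitGaussian_one h hδ hc hE).abs_cov_le_one s t
  rw [cov_linStat_gaussPi (h.posSemidef_cov hδ)] at hone ⊢
  rw [cov_linStat_gaussPi (he.2 n Y)]
  obtain ⟨hs0, -, hs1⟩ := hr.sdHat_bounds h hc hx hx2 hY (hE s.2)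
  obtain ⟨ht0, -, ht1⟩ := hr.sdHat_bounds h hc hx hx2 hY (hE t.2)
  have hVs := hr.sd_pos h hc (hE s.2)
  have hVt := hr.sd_pos h hc (hE t.2)
  set a := D.sd w s / D.sdHat n Y s with ha
  set b := D.sd w t / D.sdHat n Y t with hb
  set C := ∑ j, D.coef w s j * D.coef w t j * w.cov j s.1.2.1 t.1.2.1 with hC
  set C' := ∑ j, D.coef w s j * D.coef w t j * D.covHat n Y j s.1.2.1 t.1.2.1 with hC'
  have e1 : ∑ j, D.weight n s.1.2.2 s.1.1 j / D.sdHat n Y s *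
      (D.weight n t.1.2.2 t.1.1 j / D.sdHat n Y t) * D.covHat n Y j s.1.2.1 t.1.2.1 =
      a * b * C' := by
    rw [hC', Finset.mul_sum]
    refine Finset.sum_congr rfl fun j _ => ?_
    rw [ha, hb, coef, coef]
    field_simp
  rw [e1]
  have hCC : |C' - C| ≤ x := by
    rw [hC, hC', ← Finset.sum_sub_distrib]
    refine (Finset.abs_sum_le_sum_abs _ _).trans ?_
    refine le_trans (Finset.sum_le_sum (g := fun j =>
      (D.coef w s j ^ 2 + D.coef w t j ^ 2) / 2 * (c.cvar * x)) fun j _ => ?_) ?_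
    · rw [← mul_sub, abs_mul]
      have h3 : |D.coef w s j * D.coef w t j| ≤ (D.coef w s j ^ 2 + D.coef w t j ^ 2) / 2 := by
        rw [abs_le]
        constructor <;> nlinarith [sq_nonneg (D.coef w s j + D.coef w t j),
          sq_nonneg (D.coef w s j - D.coef w t j)]
      exact mul_le_mul h3 (hY j _ _) (abs_nonneg _) (by positivity)
    · rw [← Finset.sum_mul, ← Finset.sum_div, Finset.sum_add_distrib]
      have h4 := hr.sum_coef_sq_le h hc (hE s.2)
      have h5 := hr.sum_coef_sq_le h hc (hE t.2)
      calc _ ≤ (1 / c.cvar + 1 / c.cvar) / 2 * (c.cvar * x) := by gcongr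
        _ = x := by field_simp; norm_num
  have h6 := abs_le.1 hCC
  have h7 := abs_le.1 hone
  have h8 := abs_le.1 hs1
  have h9 := abs_le.1 ht1
  have hab : |a * b - 1| ≤ 6 * x := by
    rw [abs_le]
    constructor <;> nlinarith
  have hC'2 : |C'| ≤ 2 := by rw [abs_le]; constructor <;> linarith
  have e2 : a * b * C' - C = (a * b - 1) * C' + (C' - C) := by ring
  rw [e2]
  refine (abs_add_le _ _).trans ?_
  rw [abs_mul]
  have := mul_le_mul hab hC'2 (abs_nonneg _) (by positivity)
  linarith

end Fixed

end Design
end CMITest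

namespace CMITest
namespace Design

variable {d p : ℕ} {D : Design d p} {c : ModelConstants} {κ : ℝ}

/-! ### Approximation of noise and simulated maxima for large samples -/

/-- Squared, the Lindeberg error is a constant times (log n)⁴ / (β⁶ h_min^{3d} n), that is, β⁴ times
the quantity assumed to vanish; the surplus β⁴ is bounded. -/
lemma TestFunctionCondition.eventually_rate_le (h : D.TestFunctionCondition)
    (hβ : ∀ n, 0 < D.β n) (hm : ∀ n, 0 < D.hmin n) (M : ℝ) {A ε : ℝ} (hA : 0 ≤ A) (hε : 0 < ε) :
    ∀ᶠ n : ℕ in atTop, Real.log n ^ 2 * (n * (√(A / (n * D.hmin n ^ d)) ^ 3 * M)) / D.β n ^ 3 ≤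
      ε := by
  obtain ⟨⟨C, hC, hβC⟩, ht⟩ := h
  have h1 := ht.const_mul (A ^ 3 * M ^ 2 * C ^ 4)
  rw [mul_zero] at h1
  filter_upwards [h1.eventually_le_const (by positivity : 0 < ε ^ 2), eventually_ge_atTop 1]
    with n hn hn1
  have hn0 : (0 : ℝ) < n := by exact_mod_cast hn1
  have hβ0 := hβ n
  have hm0 := hm n
  refine le_of_abs_le (abs_le_of_sq_le_sq ?_ hε.le)
  refine le_trans (le_of_eq ?_) ((mul_le_mul_of_nonneg_left (pow_le_pow_left₀ hβ0.le (hβC n) 4)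
    (?_ : 0 ≤ A ^ 3 * M ^ 2 * (Real.log n ^ 4 / (D.β n ^ 10 * D.hmin n ^ (3 * d) * n)))).trans
    (le_trans (le_of_eq ?_) hn))
  · have e : (√(A / (n * D.hmin n ^ d)) ^ 3) ^ 2 = (A / (n * D.hmin n ^ d)) ^ 3 := by
      rw [← pow_mul, mul_comm 3 2, pow_mul, Real.sq_sqrt (by positivity)]
    rw [div_pow, mul_pow, mul_pow, mul_pow (√_ ^ 3), e, pow_mul' (D.hmin n)]
    field_simp
  · positivity
  · ring

namespace Assumptions

lemma eventually_regularAt (H : D.Assumptions c κ) : ∃ A, 0 < A ∧ ∀ᶠ n : ℕ in atTop, D.RegularAt A n :=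
  Design.eventually_regularAt H.hp H.design H.bandwidth H.kernel H.testPoints

/-- Gaussian approximation of the maximum of the standardized smoothed noise. -/
lemma eventually_noise (H : D.Assumptions c κ) {η : ℝ} (hη : 0 < η) :
    ∀ᶠ n : ℕ in atTop, ∀ w : Model d p n, w.DisturbanceCondition c D.X →
      ∀ E ⊆ D.indexSet n, E.Nonempty → ∀ σ : ℝ, |σ| = 1 → ∀ t,
        |smoothCdf D.g₀ (D.β n) w.noiseLaw
            (fun e => ⨆ s : E, linStat (fun j => σ * D.coef w s j) s.1.2.1 e) t -
          smoothCdf D.g₀ (D.β n) (gaussPi w.cov)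
            (fun z => ⨆ s : E, linStat (fun j => σ * D.coef w s j) s.1.2.1 z) t| ≤ η := by
  obtain ⟨A, hA, hreg⟩ := H.eventually_regularAt
  have hg := H.tuning.stepFunction
  obtain ⟨f, f₁, f₂, f₃, G, hf, hfg⟩ :=
    exists_threeDeriv_approx hg.cont hg.one hg.zero hg.abs_le_one (by linarith : 0 < η / 8)
  have hG := hf.nonneg
  -- With b = 1 + k log n the smoothing error 2G (3 log n) / b is at most η / 4.
  set k := 24 * G / η with hk
  have hk0 : 0 ≤ k := by positivity
  have hkη : k * η = 24 * G := by rw [hk]; field_simp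
  set M := p * (1 + c.Cmom + √(1 + c.Cmom) ^ 3 * stdAbsCube) with hM
  have hrate := H.testFunction.eventually_rate_le (H.tuning.β_pos) H.bandwidth.2.2.1
    (6 * G * (1 + k) ^ 2 * M) (div_pos hA H.hcvar).le (by linarith : 0 < η / 4)
  have hlog : ∀ᶠ n : ℕ in atTop, 1 ≤ Real.log n :=
    (Real.tendsto_log_atTop.comp tendsto_natCast_atTop_atTop).eventually_ge_atTop 1
  filter_upwards [hreg, hrate, hlog] with n hr hrate hlog w hw E hE hEn σ hσ t
  have := (H.bandwidth.finite_indexSet n).subset hE |>.fintype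
  have := hEn.to_subtype
  have hβ := H.tuning.β_pos n
  set κ₀ := √(A / c.cvar / (n * D.hmin n ^ d)) with hκ₀
  set b := 1 + k * Real.log n with hb
  have hb1 : 1 ≤ b := by nlinarith
  have hmain := abs_smoothCdf_noise_sub_le hw H.hδ H.hCmom hf hg hfg hb1 hβ
    (a := fun (s : E) j => σ * D.coef w s j) (m := fun s : E => s.1.2.1) (κ := κ₀)
    (Real.sqrt_nonneg _) (fun s j => by
      rw [abs_mul, hσ, one_mul]
      exact hr.abs_coef_le hw H.hcvar (H.bandwidth.2.2.1 n) (hE s.2) j) t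
  refine hmain.trans ?_
  have hlc : Real.log (Fintype.card E) ≤ 3 * Real.log n := by
    calc Real.log (Fintype.card E) ≤ Real.log ((n : ℝ) ^ 3) :=
          Real.log_le_log (by exact_mod_cast Fintype.card_pos)
            (hr.card_le (H.bandwidth.finite_indexSet n) hE)
      _ = _ := by rw [Real.log_pow]; norm_cast
  have t1 : 2 * G * (Real.log (Fintype.card E) / b) ≤ η / 4 := by
    rw [← mul_div_assoc, div_le_iff₀ (by linarith)]
    have h4 := mul_le_mul_of_nonneg_left hlc hG
    have h5 : η / 4 * b = η / 4 + 6 * G * Real.log n := by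
      rw [hb]; linear_combination (Real.log n / 4) * hkη
    nlinarith
  have t2 : 6 * G * b ^ 2 * (n * (κ₀ ^ 3 * M)) / D.β n ^ 3 ≤ η / 4 := by
    refine le_trans ?_ hrate
    have hM0 : 0 ≤ M := by
      have := stdAbsCube_nonneg
      have := H.hCmom
      positivity
    have hκ0 : 0 ≤ κ₀ := Real.sqrt_nonneg _
    have hb2 : b ≤ (1 + k) * Real.log n := by nlinarith
    have hb3 : b ^ 2 ≤ (1 + k) ^ 2 * Real.log n ^ 2 := by
      rw [← mul_pow]; exact pow_le_pow_left₀ (by linarith) hb2 2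
    refine div_le_div_of_nonneg_right ?_ (by positivity)
    calc 6 * G * b ^ 2 * (n * (κ₀ ^ 3 * M))
        ≤ 6 * G * ((1 + k) ^ 2 * Real.log n ^ 2) * (n * (κ₀ ^ 3 * M)) := by gcongr
      _ = _ := by ring
  linarith

end Assumptions

/-- The approximations of the distributions of the studentized noise and of the simulated
statistics which hold off a bad event `B`. -/
structure ApproxAt (D : Design d p) {n : ℕ} (w : Model d p n) (η r : ℝ)
    (B : Set (Fin n → Vec p)) : Prop where
  real_le : w.noiseLaw.real B ≤ η
  ratio : ∀ e ∉ B, ∀ s ∈ D.indexSet n, |D.sd w s / D.sdHat n (w.response D.X e) s - 1| ≤ r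
  sim : ∀ e ∉ B, ∀ E ⊆ D.indexSet n, E.Nonempty → ∀ t,
    |smoothCdf D.g₀ (D.β n) (D.simLaw n (w.response D.X e))
      (D.simStat n (w.response D.X e) E) t - D.gaussCdf w E t| ≤ η
  noise : ∀ E ⊆ D.indexSet n, E.Nonempty → ∀ σ : ℝ, |σ| = 1 → ∀ t,
    |smoothCdf D.g₀ (D.β n) w.noiseLaw (fun e => ⨆ s : E, σ * D.resid w s e) t -
      D.gaussCdf w E t| ≤ η

lemma CovEstimator.measurable_resid (h : D.CovEstimator) {n : ℕ} (w : Model d p n)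
    (s : Fin n × Fin p × ℝ) : Measurable (D.resid w s) :=
  (measurable_smooth n s).div ((h.measurable_sdHat n s).comp (w.measurable_response D.X))

namespace Assumptions

/-- The estimated variances are close to the true ones with high probability. -/
lemma eventually_sdHat (H : D.Assumptions c κ) {η : ℝ} (hη : 0 < η) :
    ∀ᶠ n : ℕ in atTop, ∀ w : Model d p n, w.InNullClass c D.X →
      ∃ B : Set (Fin n → Vec p), w.noiseLaw.real B ≤ η ∧ ∀ e ∉ B, ∀ j m m',
        |D.covHat n (w.response D.X e) j m m' - w.cov j m m'| ≤
          c.cvar * ((n : ℝ) ^ (-κ) / c.cvar) := by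
  filter_upwards [H.variance 1 one_pos η hη] with n hn w hw
  refine ⟨_, hn w hw, fun e he j m m' => ?_⟩
  have h1 : ‖Matrix.toEuclideanCLM (𝕜 := ℝ) (D.covHat n (w.response D.X e) j - w.cov j)‖ <
      1 * (n : ℝ) ^ (-κ) := not_le.1 fun hle => he ⟨j, hle⟩
  have h2 := abs_entry_le_norm_toEuclideanCLM (D.covHat n (w.response D.X e) j - w.cov j) m m'
  rw [mul_div_cancel₀ _ H.hcvar.ne']
  rw [Matrix.sub_apply] at h2
  linarith

/-- Estimated covariance matrices within n^{-κ} keep the covariances of the two Gaussian vectors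
within n^{-κ/2}; the loss in the exponent swallows the constants. Gaussian comparison then applies,
whatever the width of the step. -/
lemma eventually_sim (H : D.Assumptions c κ) {η : ℝ} (hη : 0 < η) :
    ∀ᶠ n : ℕ in atTop, ∀ w : Model d p n, w.DisturbanceCondition c D.X → ∀ Y : Fin n → Vec p,
      (∀ j m m', |D.covHat n Y j m m' - w.cov j m m'| ≤ c.cvar * ((n : ℝ) ^ (-κ) / c.cvar)) →
      ∀ E ⊆ D.indexSet n, E.Nonempty → ∀ t,
        |smoothCdf D.g₀ (D.β n) (D.simLaw n Y) (D.simStat n Y E) t - D.gaussCdf w E t| ≤ η := by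
  obtain ⟨A, hA, hreg⟩ := H.eventually_regularAt
  have hκ := H.hκ
  have hc := H.hcvar
  have h1 := (tendsto_log_mul_rpow_neg (13 / c.cvar) 0 (half_pos hκ)).eventually_le_const one_pos
  have h2 := (tendsto_log_mul_rpow_neg (1 / c.cvar) 0 hκ).eventually_le_const one_half_pos
  filter_upwards [hreg, h1, h2, eventually_ge_atTop 1,
    eventually_abs_smoothCdf_sub_le H.tuning.stepFunction (half_pos hκ) hη]
    with n hr h1 h2 hn1 hcmp w hw Y hY E hE hEn t
  have := (H.bandwidth.finite_indexSet n).subset hE |>.fintype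
  have := hEn.to_subtype
  have hn0 : (0 : ℝ) < n := by exact_mod_cast hn1
  have hx0 : 0 ≤ (n : ℝ) ^ (-κ) / c.cvar := by positivity
  have hx2 : (n : ℝ) ^ (-κ) / c.cvar ≤ 1 / 2 := by
    rw [zero_mul, add_zero, one_div_mul_eq_div] at h2; exact h2
  have hx3 : 13 * ((n : ℝ) ^ (-κ) / c.cvar) ≤ (n : ℝ) ^ (-(κ / 2)) := by
    have e : (n : ℝ) ^ (-κ) = (n : ℝ) ^ (-(κ / 2)) * (n : ℝ) ^ (-(κ / 2)) := by
      rw [← Real.rpow_add hn0]; ring_nf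
    rw [zero_mul, add_zero] at h1
    have h0 : 0 ≤ (n : ℝ) ^ (-(κ / 2)) := by positivity
    calc _ = (13 / c.cvar * (n : ℝ) ^ (-(κ / 2))) * (n : ℝ) ^ (-(κ / 2)) := by rw [e]; ring
      _ ≤ 1 * (n : ℝ) ^ (-(κ / 2)) := by gcongr
      _ = _ := one_mul _
  have e : D.simStat n Y E = fun z => ⨆ s : E,
      linStat (fun j => D.weight n s.1.2.2 s.1.1 j / D.sdHat n Y s) s.1.2.1 z := by
    funext z
    rw [simStat_eq_iSup]
    congr 1
    funext s
    rw [smooth, linStat, Finset.sum_div]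
    exact Finset.sum_congr rfl fun j _ => by ring
  rw [e, simLaw_eq_gaussPi]
  exact hcmp E _ _ _ _ _ _ (hr.sim_unitGaussian hw hc H.estimator hx0 hx2 hY hE)
    (hr.unitGaussian_one hw H.hδ hc hE)
    (hr.card_le (H.bandwidth.finite_indexSet n) hE)
    (fun s t => (hr.abs_cov_sub_le hw H.hδ hc H.estimator hx0 hx2 hY hE s t).trans hx3) _ _
    (H.tuning.β_pos n)

/-- A sign does not change Gaussian covariances, so the comparison of Gaussian maxima removes `σ`.
The case -1 controls how negative the noise can be, on which selection depends. -/
lemma eventually_noise_gaussCdf (H : D.Assumptions c κ) {η : ℝ} (hη : 0 < η) :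
    ∀ᶠ n : ℕ in atTop, ∀ w : Model d p n, w.DisturbanceCondition c D.X →
      ∀ E ⊆ D.indexSet n, E.Nonempty → ∀ σ : ℝ, |σ| = 1 → ∀ t,
        |smoothCdf D.g₀ (D.β n) w.noiseLaw
            (fun e => ⨆ s : E, σ * linStat (D.coef w s) s.1.2.1 e) t - D.gaussCdf w E t| ≤ η := by
  obtain ⟨A, hA, hreg⟩ := H.eventually_regularAt
  filter_upwards [hreg, H.eventually_noise (half_pos hη), eventually_ge_atTop 1,
    eventually_abs_smoothCdf_sub_le H.tuning.stepFunction H.hκ (half_pos hη)]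
    with n hr hnoise hn1 hcmp w hw E hE hEn σ hσ t
  have := (H.bandwidth.finite_indexSet n).subset hE |>.fintype
  have := hEn.to_subtype
  have hσ2 : σ ^ 2 = 1 := by rw [← sq_abs, hσ, one_pow]
  have h1 := hnoise w hw E hE hEn σ hσ t
  have h2 := hcmp E _ _ _ _ _ _ (hr.unitGaussian hw H.hδ H.hcvar hE hσ2)
    (hr.unitGaussian_one hw H.hδ H.hcvar hE)
    (hr.card_le (H.bandwidth.finite_indexSet n) hE)
    (fun s u => by
      rw [cov_linStat_gaussPi (hw.posSemidef_cov H.hδ), cov_linStat_gaussPi (hw.posSemidef_cov H.hδ)]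
      have e : ∀ j, σ * D.coef w s j * (σ * D.coef w u j) * w.cov j s.1.2.1 u.1.2.1 =
          D.coef w s j * D.coef w u j * w.cov j s.1.2.1 u.1.2.1 := fun j => by
        linear_combination (D.coef w s j * D.coef w u j * w.cov j s.1.2.1 u.1.2.1) * hσ2
      simp only [e, sub_self, abs_zero]
      positivity) (D.β n) t (H.tuning.β_pos n)
  simp only [linStat_mul] at h1 h2
  rw [gaussCdf]
  rw [abs_le] at *
  constructor <;> linarith

end Assumptions
end Design
lemma iSup_le_iSup_add {ι : Type*} [Finite ι] [Nonempty ι] {x y : ι → ℝ} {l : ℝ}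
    (h : ∀ i, x i ≤ y i + l) : ⨆ i, x i ≤ (⨆ i, y i) + l :=
  ciSup_le fun i => (h i).trans (by linarith [le_iSup_fin y i])

namespace Design

variable {d p : ℕ} {D : Design d p} {c : ModelConstants} {κ : ℝ}

instance {n : ℕ} (w : Model d p n) [∀ i, IsProbabilityMeasure (w.noise i)] :
    IsProbabilityMeasure w.noiseLaw := by
  unfold Model.noiseLaw; infer_instance

/-- The noise statistics are at most of logarithmic order, with high probability. -/
lemma Assumptions.eventually_max_noise (H : D.Assumptions c κ) {η : ℝ} (hη : 0 < η) :
    ∀ᶠ n : ℕ in atTop, ∀ w : Model d p n, w.DisturbanceCondition c D.X →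
      w.noiseLaw.real {e | ∃ s ∈ D.indexSet n,
        D.β n + 4 * Real.log n < |linStat (D.coef w s) s.2.1 e|} ≤ η := by
  obtain ⟨A, hA, hreg⟩ := H.eventually_regularAt
  have hη4 : 0 < η / 4 := by linarith
  filter_upwards [hreg, H.eventually_noise_gaussCdf hη4, eventually_cube_mul_exp_le hη4,
    eventually_ge_atTop 1] with n hr hnoise hcube hn1 w hw
  have := hw.1
  have hfin := H.bandwidth.finite_indexSet n
  have := hfin.fintype
  have := hr.nonempty.to_subtype
  have hg := H.tuning.stepFunction
  have hβ := H.tuning.β_pos n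
  have hL : 0 ≤ 4 * Real.log n := by
    have := Real.log_natCast_nonneg n; linarith
  have htail : 1 - D.gaussCdf w (D.indexSet n) (4 * Real.log n) ≤ η / 4 := by
    have hU := hr.unitGaussian_one hw H.hδ H.hcvar (subset_refl (D.indexSet n))
    refine (one_sub_smoothCdf_le hg hβ (measurable_iSup_fin hU.measurable) _).trans
      ((hU.real_lt_iSup_le hL).trans (le_trans ?_ hcube))
    have := hr.card_le hfin (subset_refl (D.indexSet n))
    gcongr
  have hside : ∀ σ : ℝ, |σ| = 1 → w.noiseLaw.real {e | D.β n + 4 * Real.log n <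
      ⨆ s : D.indexSet n, σ * linStat (D.coef w s) s.1.2.1 e} ≤ η / 2 := fun σ hσ => by
    have hT : Measurable fun e => ⨆ s : D.indexSet n, σ * linStat (D.coef w s) s.1.2.1 e :=
      measurable_iSup_fin fun s => (measurable_linStat _ _).const_mul _
    have h1 := real_lt_le_one_sub (μ := w.noiseLaw) hg hβ hT (4 * Real.log n)
    have h2 := abs_le.1 (hnoise w hw _ subset_rfl hr.nonempty σ hσ (4 * Real.log n))
    rw [add_comm] at h1
    linarith
  have h1 := hside 1 (by norm_num)
  have h2 := hside (-1) (by norm_num)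
  refine (measureReal_mono fun e he => ?_).trans ((measureReal_union_le _ _).trans
    (add_le_add h1 h2) |>.trans (by linarith))
  obtain ⟨s, hs, hlt⟩ := he
  rcases lt_abs.1 hlt with h | h
  · refine Or.inl (lt_of_lt_of_le ?_ (le_iSup_fin _ (⟨s, hs⟩ : D.indexSet n)))
    simpa using h
  · refine Or.inr (lt_of_lt_of_le ?_ (le_iSup_fin _ (⟨s, hs⟩ : D.indexSet n)))
    simpa using h

/-- The studentized noise is the standardized noise times the ratio of standard deviations. Off the
bad event the former is of logarithmic order and the latter within O(n^{-κ}) of one, so the two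
maxima differ by at most n^{-κ/2}, a shift absorbed by the modulus of continuity of `gaussCdf`. -/
lemma Assumptions.eventually_approxAt (H : D.Assumptions c κ) {η : ℝ} (hη : 0 < η) :
    ∀ᶠ n : ℕ in atTop, ∀ w : Model d p n, w.InNullClass c D.X →
      ∃ B, D.ApproxAt w η (2 / c.cvar * (n : ℝ) ^ (-κ)) B := by
  obtain ⟨A, hA, hreg⟩ := H.eventually_regularAt
  obtain ⟨Cβ, hCβ, hβC⟩ := H.testFunction.1
  have hκ := H.hκ
  have hc := H.hcvar
  have hε : 0 < η / 8 := by linarith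
  have hrate := (tendsto_log_mul_rpow_neg (2 / c.cvar * Cβ) (8 / c.cvar)
    (half_pos hκ)).eventually_le_const one_pos
  have h2 := (tendsto_log_mul_rpow_neg (1 / c.cvar) 0 hκ).eventually_le_const one_half_pos
  filter_upwards [hreg, H.eventually_sdHat hε, H.eventually_sim hη, H.eventually_noise_gaussCdf hε,
    H.eventually_max_noise hε,
    eventually_smoothCdf_add_le H.tuning.stepFunction (half_pos hκ) hε, hrate, h2,
    eventually_ge_atTop 1] with n hr hsd hsim hnoise hmax hmod hrate h2 hn1 w hw
  have hwd := hw.1.1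
  have := hwd.1
  have hfin := H.bandwidth.finite_indexSet n
  have hn0 : (0 : ℝ) < n := by exact_mod_cast hn1
  have hg := H.tuning.stepFunction
  have hβ := H.tuning.β_pos n
  have hx0 : 0 ≤ (n : ℝ) ^ (-κ) / c.cvar := by positivity
  have hx2 : (n : ℝ) ^ (-κ) / c.cvar ≤ 1 / 2 := by
    rw [zero_mul, add_zero, one_div_mul_eq_div] at h2; exact h2
  obtain ⟨B₁, hB₁, hY⟩ := hsd w hw
  set B₂ := {e : Fin n → Vec p | ∃ s ∈ D.indexSet n,
    D.β n + 4 * Real.log n < |linStat (D.coef w s) s.2.1 e|} with hB₂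
  -- The event on which the variances are badly estimated is not known to be measurable, so a
  -- measurable hull of the same mass is used.
  set B := toMeasurable w.noiseLaw (B₁ ∪ B₂) with hB
  have hBm : MeasurableSet B := measurableSet_toMeasurable _ _
  have hBle : w.noiseLaw.real B ≤ η / 4 := by
    have e : w.noiseLaw.real B = w.noiseLaw.real (B₁ ∪ B₂) := by
      simp only [Measure.real, hB, measure_toMeasurable]
    rw [e]
    linarith [measureReal_union_le (μ := w.noiseLaw) B₁ B₂, hmax w hwd]
  have hsub := subset_toMeasurable w.noiseLaw (B₁ ∪ B₂)
  have hY' : ∀ e ∉ B, ∀ j m m', |D.covHat n (w.response D.X e) j m m' - w.cov j m m'| ≤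
      c.cvar * ((n : ℝ) ^ (-κ) / c.cvar) := fun e he =>
    hY e fun h => he (hsub (Or.inl h))
  have hM : ∀ e ∉ B, ∀ s ∈ D.indexSet n,
      |linStat (D.coef w s) s.2.1 e| ≤ D.β n + 4 * Real.log n := fun e he s hs =>
    not_lt.1 fun hlt => he (hsub (Or.inr ⟨s, hs, hlt⟩))
  have hb : ∀ e ∉ B, ∀ s ∈ D.indexSet n,
      |D.sd w s / D.sdHat n (w.response D.X e) s - 1| ≤ 2 / c.cvar * (n : ℝ) ^ (-κ) :=
    fun e he s hs => by
      obtain ⟨-, -, h3⟩ := hr.sdHat_bounds hwd hc hx0 hx2 (hY' e he) hs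
      exact h3.trans (le_of_eq (by ring))
  set l := (n : ℝ) ^ (-(κ / 2)) with hl
  have hl0 : 0 ≤ l := by positivity
  have hrM : 2 / c.cvar * (n : ℝ) ^ (-κ) * (D.β n + 4 * Real.log n) ≤ l := by
    have e : (n : ℝ) ^ (-κ) = l * l := by
      rw [hl, ← Real.rpow_add hn0]; ring_nf
    have h3 := hβC n
    have h4 : (2 / c.cvar * D.β n + 8 / c.cvar * Real.log n) * l ≤ 1 := by
      refine le_trans ?_ hrate
      gcongr
    calc _ = ((2 / c.cvar * D.β n + 8 / c.cvar * Real.log n) * l) * l := by rw [e]; ring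
      _ ≤ 1 * l := by gcongr
      _ = l := one_mul l
  have hdiff : ∀ e ∉ B, ∀ s ∈ D.indexSet n, |D.resid w s e - linStat (D.coef w s) s.2.1 e| ≤ l :=
    fun e he s hs => by
      have h3 := hb e he s hs
      have hV := hr.sd_pos hwd hc hs
      have e1 : D.smooth n e s = linStat (D.coef w s) s.2.1 e * D.sd w s := by
        rw [smooth, linStat, Finset.sum_mul]
        refine Finset.sum_congr rfl fun j _ => ?_
        rw [coef]; field_simp
      have e2 : D.resid w s e - linStat (D.coef w s) s.2.1 e =
          (D.sd w s / D.sdHat n (w.response D.X e) s - 1) * linStat (D.coef w s) s.2.1 e := by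
        rw [resid, e1]; ring
      rw [e2, abs_mul]
      refine le_trans ?_ hrM
      exact mul_le_mul h3 (hM e he s hs) (abs_nonneg _) (by positivity)
  refine ⟨B, by linarith, hb,
    fun e he E hE hEn t => hsim w hwd _ (hY' e he) E hE hEn t, fun E hE hEn σ hσ t => ?_⟩
  have := (hfin.subset hE).fintype
  have := hEn.to_subtype
  have hT : Measurable fun e => ⨆ s : E, σ * D.resid w s e :=
    measurable_iSup_fin fun s => (H.estimator.measurable_resid w s).const_mul _
  have hT₀ : Measurable fun e => ⨆ s : E, σ * linStat (D.coef w s) s.1.2.1 e :=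
    measurable_iSup_fin fun s => (measurable_linStat _ _).const_mul _
  have hd2 : ∀ e ∉ B, ∀ s : E, |σ * D.resid w s e - σ * linStat (D.coef w s) s.1.2.1 e| ≤ l :=
    fun e he s => by rw [← mul_sub, abs_mul, hσ, one_mul]; exact hdiff e he s (hE s.2)
  have up := smoothCdf_le_add_real (μ := w.noiseLaw) hg hβ hT₀ hT hBm (l := l) (fun e he =>
    iSup_le_iSup_add fun s => by linarith [(abs_le.1 (hd2 e he s)).1]) t
  have dn := smoothCdf_le_add_real (μ := w.noiseLaw) hg hβ hT hT₀ hBm (l := l) (fun e he =>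
    iSup_le_iSup_add fun s => by linarith [(abs_le.1 (hd2 e he s)).2]) (t - l)
  have hU := hr.unitGaussian_one hwd H.hδ hc hE
  have m1 := hmod E _ _ _ hU (hr.card_le hfin hE) (D.β n) l t hβ hl0 le_rfl
  have m2 := hmod E _ _ _ hU (hr.card_le hfin hE) (D.β n) l (t - l) hβ hl0 le_rfl
  have n1 := abs_le.1 (hnoise w hwd E hE hEn σ hσ (t + l))
  have n2 := abs_le.1 (hnoise w hwd E hE hEn σ hσ (t - l))
  rw [sub_add_cancel] at dn m2
  unfold gaussCdf at *
  rw [abs_le]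
  constructor <;> linarith

end Design
end CMITest

namespace CMITest
namespace Design

variable {d p : ℕ} {D : Design d p} {c : ModelConstants} {κ : ℝ}

/-! ### Drift, critical values and the plug-in test -/

/-- The standardized drift of the statistic at `s`. -/
noncomputable def drift (D : Design d p) {n : ℕ} (w : Model d p n) (s : Fin n × Fin p × ℝ) : ℝ :=
  (∑ j : Fin n, D.weight n s.2.2 s.1 j * w.f s.2.1 (D.X j)) / D.sd w s

section Fixed

variable {n : ℕ} {w : Model d p n} {A ε r : ℝ} {B : Set (Fin n → Vec p)}
  {E E' : Set (Fin n × Fin p × ℝ)} {s : Fin n × Fin p × ℝ}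

lemma smooth_response (e : Fin n → Vec p) (s : Fin n × Fin p × ℝ) :
    D.smooth n (w.response D.X e) s =
      (∑ j : Fin n, D.weight n s.2.2 s.1 j * w.f s.2.1 (D.X j)) + D.smooth n e s := by
  simp only [smooth, Model.response, ← Finset.sum_add_distrib]
  exact Finset.sum_congr rfl fun j _ => by simp only [mul_add]

lemma RegularAt.stat_eq (hr : D.RegularAt A n) (h : w.DisturbanceCondition c D.X)
    (hc : 0 < c.cvar) (hs : s ∈ D.indexSet n) (e : Fin n → Vec p) :
    D.smooth n (w.response D.X e) s / D.sdHat n (w.response D.X e) s =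
      D.drift w s * (D.sd w s / D.sdHat n (w.response D.X e) s) + D.resid w s e := by
  have := (hr.sd_pos h hc hs).ne'
  rw [smooth_response, add_div, drift, resid]
  congr 1
  field_simp

lemma RegularAt.drift_nonpos (hr : D.RegularAt A n) (h : w.InNullClass c D.X)
    (hs : s ∈ D.indexSet n) : D.drift w s ≤ 0 :=
  div_nonpos_of_nonpos_of_nonneg (Finset.sum_nonpos fun _ _ =>
    mul_nonpos_of_nonneg_of_nonpos (hr.nonneg _ hs.1 _ _) (h.2 _ _)) (Real.sqrt_nonneg _)

lemma drift_eq_zero (h : ∀ m x, w.f m x = 0) : D.drift w s = 0 := by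
  simp [drift, h]

lemma RegularAt.stat_le_resid (hr : D.RegularAt A n) (h : w.InNullClass c D.X)
    (hc : 0 < c.cvar) (hs : s ∈ D.indexSet n) (e : Fin n → Vec p) :
    D.smooth n (w.response D.X e) s / D.sdHat n (w.response D.X e) s ≤ D.resid w s e := by
  rw [hr.stat_eq h.1.1 hc hs]
  have := mul_nonpos_of_nonpos_of_nonneg (hr.drift_nonpos h hs)
    (div_nonneg (Real.sqrt_nonneg _) (Real.sqrt_nonneg _) :
      0 ≤ D.sd w s / D.sdHat n (w.response D.X e) s)
  linarith

lemma critical_mono (ht : D.TuningCondition) (hE' : E'.Finite) (hE : E.Nonempty) (hEE : E ⊆ E')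
    (Y : Fin n → Vec p) {q : ℝ} (h0 : 0 < q) (h1 : q < 1) :
    D.critical n Y E q ≤ D.critical n Y E' q :=
  smoothedQuantile_mono ht.stepFunction (ht.β_pos n) (measurable_simStat n (hE'.subset hEE) Y)
    (measurable_simStat n hE' Y) (fun _ => csSup_le_csSup (hE'.image _).bddAbove (hE.image _)
      (Set.image_mono hEE)) h0 h1

/-- The critical value depends on the same data as the statistic. Off `B` it lies above a
deterministic quantile of `gaussCdf`, which removes this dependence; `ApproxAt.critical_le` is the
bound from the other side. -/
lemma ApproxAt.lt_critical (ap : D.ApproxAt w ε r B) (ht : D.TuningCondition)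
    (hb : D.BandwidthCondition) {e : Fin n → Vec p} (he : e ∉ B) (hE : E ⊆ D.indexSet n)
    (hEn : E.Nonempty) {q t : ℝ} (h0 : 0 < q) (h1 : q < 1) (hq : D.gaussCdf w E t + ε < q) :
    t < D.critical n (w.response D.X e) E q := by
  rw [← not_le, critical, smoothedQuantile_le_iff ht.stepFunction (ht.β_pos n)
    (measurable_simStat n ((hb.finite_indexSet n).subset hE) _) h0 h1]
  have := abs_le.1 (ap.sim e he E hE hEn t)
  linarith

lemma ApproxAt.critical_le (ap : D.ApproxAt w ε r B) (ht : D.TuningCondition)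
    (hb : D.BandwidthCondition) {e : Fin n → Vec p} (he : e ∉ B) (hE : E ⊆ D.indexSet n)
    (hEn : E.Nonempty) {q t : ℝ} (h0 : 0 < q) (h1 : q < 1) (hq : q + ε ≤ D.gaussCdf w E t) :
    D.critical n (w.response D.X e) E q ≤ t := by
  rw [critical, smoothedQuantile_le_iff ht.stepFunction (ht.β_pos n)
    (measurable_simStat n ((hb.finite_indexSet n).subset hE) _) h0 h1]
  have := abs_le.1 (ap.sim e he E hE hEn t)
  linarith

lemma ApproxAt.real_noise_gt_le [∀ i, IsProbabilityMeasure (w.noise i)] (ap : D.ApproxAt w ε r B)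
    (ht : D.TuningCondition) (hb : D.BandwidthCondition) (hest : D.CovEstimator)
    (hE : E ⊆ D.indexSet n) (hEn : E.Nonempty) {σ : ℝ} (hσ : |σ| = 1) (t : ℝ) :
    w.noiseLaw.real {e | ∃ s ∈ E, t + D.β n < σ * D.resid w s e} ≤
      1 - D.gaussCdf w E t + ε := by
  have := ((hb.finite_indexSet n).subset hE).fintype
  have hT : Measurable fun e => ⨆ s : E, σ * D.resid w s e :=
    measurable_iSup_fin fun s => (hest.measurable_resid w s).const_mul _
  have h1 := real_lt_le_one_sub (μ := w.noiseLaw) ht.stepFunction (ht.β_pos n) hT t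
  have h2 := abs_le.1 (ap.noise E hE hEn σ hσ t)
  have h3 : w.noiseLaw.real {e | ∃ s ∈ E, t + D.β n < σ * D.resid w s e} ≤
      w.noiseLaw.real {e | t + D.β n < ⨆ s : E, σ * D.resid w s e} :=
    measureReal_mono fun e ⟨s, hs, hlt⟩ =>
      lt_of_lt_of_le hlt (le_iSup_fin (fun s : E => σ * D.resid w s e) ⟨s, hs⟩)
  linarith

lemma RegularAt.one_sub_gaussCdf_le (hr : D.RegularAt A n) (h : w.DisturbanceCondition c D.X)
    (hδ : 0 < c.δ) (hc : 0 < c.cvar) (ht : D.TuningCondition) (hb : D.BandwidthCondition)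
    (hE : E ⊆ D.indexSet n) (hEn : E.Nonempty) {t : ℝ} (h0 : 0 ≤ t) :
    1 - D.gaussCdf w E t ≤ E.ncard * Real.exp (-t ^ 2 / 2) := by
  have := ((hb.finite_indexSet n).subset hE).fintype
  have := hEn.to_subtype
  have hU := hr.unitGaussian_one h hδ hc hE
  have h2 := (one_sub_smoothCdf_le ht.stepFunction (ht.β_pos n)
    (measurable_iSup_fin hU.measurable) t).trans (hU.real_lt_iSup_le h0)
  rwa [← Nat.card_eq_fintype_card, Nat.card_coe_set_eq] at h2

lemma RegularAt.gaussCdf_spec (hr : D.RegularAt A n) (h : w.DisturbanceCondition c D.X)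
    (hδ : 0 < c.δ) (hc : 0 < c.cvar) (ht : D.TuningCondition) (hb : D.BandwidthCondition)
    (hE : E ⊆ D.indexSet n) {q : ℝ} (h0 : 0 < q) (h1 : q < 1) :
    ∃ t, D.gaussCdf w E t = q := by
  have := ((hb.finite_indexSet n).subset hE).fintype
  have hU := hr.unitGaussian_one h hδ hc hE
  exact exists_smoothCdf_eq ht.stepFunction (ht.β_pos n) (measurable_iSup_fin hU.measurable) h0 h1

lemma gaussCdf_anti (ht : D.TuningCondition) (hE' : E'.Finite) (hEn : E.Nonempty) (hEE : E ⊆ E')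
    (t : ℝ) : D.gaussCdf w E' t ≤ D.gaussCdf w E t := by
  have := (hE'.subset hEE).fintype
  have := hE'.fintype
  have := hEn.to_subtype
  refine smoothCdf_anti ht.stepFunction (ht.β_pos n)
    (measurable_iSup_fin fun s => measurable_linStat _ _)
    (measurable_iSup_fin fun s => measurable_linStat _ _) (fun z => ?_) t
  exact ciSup_le fun s =>
    le_iSup_fin (fun s : E' => linStat (D.coef w s) s.1.2.1 z) ⟨s.1, hEE s.2⟩

/-- The maximum over statistics at the same bandwidth and component is that of independent
variables. -/
lemma RegularAt.gaussCdf_le_pow (hr : D.RegularAt A n) (h : w.DisturbanceCondition c D.X)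
    (hδ : 0 < c.δ) (hc : 0 < c.cvar) (ht : D.TuningCondition) (hb : D.BandwidthCondition)
    (htp : D.TestPointCondition) (hE : E ⊆ D.indexSet n) (hEn : E.Nonempty) {m : Fin p} {b : ℝ}
    (hEm : ∀ s ∈ E, s.2 = (m, b)) (t : ℝ) :
    D.gaussCdf w E t ≤ (gaussianReal 0 1).real (Set.Iic (t + D.β n)) ^ E.ncard := by
  classical
  have := ((hb.finite_indexSet n).subset hE).fintype
  have := hEn.to_subtype
  have hU := hr.unitGaussian_one h hδ hc hE
  -- Test points at one bandwidth are more than 2h apart and the kernel has radius h, so no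
  -- observation enters two of the smoothers. The covariances vanish, and for Gaussian variables
  -- this is independence.
  have hcov : ∀ s ∈ (Finset.univ : Finset E), ∀ u ∈ (Finset.univ : Finset E), s ≠ u →
      cov[linStat (D.coef w s) s.1.2.1, linStat (D.coef w u) u.1.2.1; gaussPi w.cov] = 0 :=
    fun s _ u _ hsu => by
      rw [cov_linStat_gaussPi (h.posSemidef_cov hδ)]
      refine Finset.sum_eq_zero fun j _ => ?_
      have hs2 := hEm s s.2
      have hu2 := hEm u u.2
      have hsS := hE s.2
      have huS := hE u.2
      have hne : s.1.1 ≠ u.1.1 := fun heq => hsu (Subtype.ext (Prod.ext heq (hs2.trans hu2.symm)))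
      have hs3 : s.1.2.2 = b := by rw [hs2]
      have hu3 : u.1.2.2 = b := by rw [hu2]
      have hbm : b ∈ D.bandwidths n := hs3 ▸ hsS.1
      have hsep := (htp n b hbm).1 s.1.1 (hs3 ▸ hsS.2) u.1.1 (hu3 ▸ huS.2) hne
      by_cases h1 : D.weight n b s.1.1 j = 0
      · simp [coef, hs3, h1]
      by_cases h2 : D.weight n b u.1.1 j = 0
      · simp [coef, hu3, h2]
      exfalso
      have h3 := hr.support b hbm _ _ h1
      have h4 := hr.support b hbm _ _ h2
      rw [norm_sub_rev] at h4
      have h5 := norm_add_le (D.X s.1.1 - D.X j) (D.X j - D.X u.1.1)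
      rw [sub_add_sub_cancel] at h5
      linarith
  have h1 := smoothCdf_le_real (μ := gaussPi w.cov) ht.stepFunction (ht.β_pos n)
    (measurable_iSup_fin hU.measurable) t
  have h2 := hU.real_forall_le_eq hcov (t + D.β n)
  rw [Finset.card_univ, ← Nat.card_eq_fintype_card, Nat.card_coe_set_eq] at h2
  rw [← h2]
  exact h1.trans (measureReal_mono fun z hz s _ =>
    (le_iSup_fin (fun s : E => linStat (D.coef w s) s.1.2.1 z) s).trans hz)

end Fixed

end Design

/-- Lower bound for the acceptance probability off a bad event. -/
lemma smoothCdf_sub_real_le {Ω : Type*} [MeasurableSpace Ω] {g : ℝ → ℝ} {β : ℝ} {μ : Measure Ω}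
    [IsProbabilityMeasure μ] {T φ : Ω → ℝ} (hg : StepFunction g) (hT : Measurable T)
    (hφ : Measurable φ) (hφ0 : ∀ ω, 0 ≤ φ ω) (hφ1 : ∀ ω, φ ω ≤ 1) {B : Set Ω} {t : ℝ}
    (h : ∀ ω, ω ∉ B → g ((T ω - t) / β) ≤ φ ω) :
    smoothCdf g β μ T t - μ.real B ≤ ∫ ω, φ ω ∂μ := by
  have hBm := measurableSet_toMeasurable μ B
  have hsub := subset_toMeasurable μ B
  have e : μ.real (toMeasurable μ B) = μ.real B := by simp only [Measure.real, measure_toMeasurable]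
  have hI : Integrable ((toMeasurable μ B).indicator (1 : Ω → ℝ)) μ :=
    (integrable_const (1 : ℝ)).indicator hBm
  have hIφ : Integrable φ μ := Integrable.of_bound (C := 1) hφ.aestronglyMeasurable
    (ae_of_all _ fun ω => by rw [Real.norm_of_nonneg (hφ0 ω)]; exact hφ1 ω)
  rw [sub_le_iff_le_add, smoothCdf, ← e, ← integral_indicator_one hBm, ← integral_add hIφ hI]
  refine integral_mono (hg.integrable hT _) (hIφ.add hI) fun ω => ?_
  by_cases hω : ω ∈ toMeasurable μ B
  · simp only [Set.indicator_of_mem hω, Pi.one_apply]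
    linarith [hg.le_one ((T ω - t) / β), hφ0 ω]
  · simp only [Set.indicator_of_notMem hω, add_zero]
    exact h ω fun hB => hω (hsub hB)

/-- Upper bound for the acceptance probability off a bad event. -/
lemma integral_le_smoothCdf_add_real {Ω : Type*} [MeasurableSpace Ω] {g : ℝ → ℝ} {β : ℝ}
    {μ : Measure Ω} [IsProbabilityMeasure μ] {T φ : Ω → ℝ} (hg : StepFunction g)
    (hT : Measurable T) (hφ : Measurable φ) (hφ0 : ∀ ω, 0 ≤ φ ω) (hφ1 : ∀ ω, φ ω ≤ 1)
    {B : Set Ω} {t : ℝ} (h : ∀ ω, ω ∉ B → φ ω ≤ g ((T ω - t) / β)) :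
    ∫ ω, φ ω ∂μ ≤ smoothCdf g β μ T t + μ.real B := by
  have hBm := measurableSet_toMeasurable μ B
  have hsub := subset_toMeasurable μ B
  have e : μ.real (toMeasurable μ B) = μ.real B := by simp only [Measure.real, measure_toMeasurable]
  have hI : Integrable ((toMeasurable μ B).indicator (1 : Ω → ℝ)) μ :=
    (integrable_const (1 : ℝ)).indicator hBm
  have hIφ : Integrable φ μ := Integrable.of_bound (C := 1) hφ.aestronglyMeasurable
    (ae_of_all _ fun ω => by rw [Real.norm_of_nonneg (hφ0 ω)]; exact hφ1 ω)
  rw [smoothCdf, ← e, ← integral_indicator_one hBm, ← integral_add (hg.integrable hT _) hI]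
  refine integral_mono hIφ ((hg.integrable hT _).add hI) fun ω => ?_
  by_cases hω : ω ∈ toMeasurable μ B
  · simp only [Set.indicator_of_mem hω, Pi.one_apply]
    linarith [hg.nonneg ((T ω - t) / β), hφ1 ω]
  · simp only [Set.indicator_of_notMem hω, add_zero]
    exact h ω fun hB => hω (hsub hB)

namespace Design

variable {d p : ℕ} {D : Design d p} {c : ModelConstants} {κ : ℝ}

lemma expect_eq {n : ℕ} (w : Model d p n) (φ : (Fin n → Vec p) → ℝ) :
    D.expect w φ = ∫ e, φ (w.response D.X e) ∂w.noiseLaw := rfl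

section Fixed

variable {n : ℕ} {w : Model d p n} {A ε r : ℝ} {B : Set (Fin n → Vec p)}

lemma stat_eq_iSup (n : ℕ) (Y : Fin n → Vec p) :
    D.stat n Y = ⨆ s : D.indexSet n, D.smooth n Y s / D.sdHat n Y s := sSup_image'

lemma RegularAt.stat_le (hr : D.RegularAt A n) (H : D.Assumptions c κ) (hw : w.InNullClass c D.X)
    (e : Fin n → Vec p) :
    D.stat n (w.response D.X e) ≤ ⨆ s : D.indexSet n, 1 * D.resid w s e := by
  have := (H.bandwidth.finite_indexSet n).fintype
  have := hr.nonempty.to_subtype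
  rw [stat_eq_iSup]
  refine ciSup_le fun s => (hr.stat_le_resid hw H.hcvar s.2 e).trans ?_
  rw [← one_mul (D.resid w s e)]
  exact le_iSup_fin (fun s : D.indexSet n => 1 * D.resid w s e) s

lemma RegularAt.stat_eq_of_zero (hr : D.RegularAt A n) (H : D.Assumptions c κ)
    (hw : w.InNullClass c D.X) (hf : ∀ m x, w.f m x = 0) (e : Fin n → Vec p) :
    D.stat n (w.response D.X e) = ⨆ s : D.indexSet n, 1 * D.resid w s e := by
  rw [stat_eq_iSup]
  congr 1
  funext s
  rw [hr.stat_eq hw.1.1 H.hcvar s.2, drift_eq_zero hf, zero_mul, zero_add, one_mul]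

lemma Assumptions.measurable_iSup_resid (H : D.Assumptions c κ) {E : Set (Fin n × Fin p × ℝ)}
    (hE : E.Finite) (σ : ℝ) : Measurable fun e => ⨆ s : E, σ * D.resid w s e := by
  have := hE.fintype
  exact measurable_iSup_fin fun s => (H.estimator.measurable_resid w s).const_mul _

/-- At the quantile of `gaussCdf` of level 1 - α - 2ε, the critical value is larger off `B` and the
statistic is at most the noise maximum. The loss is 2ε in the level, ε for the noise approximation
and ε for `B`. -/
lemma ApproxAt.le_expect_acceptPIA (ap : D.ApproxAt w ε r B) (H : D.Assumptions c κ)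
    (hr : D.RegularAt A n) (hw : w.InNullClass c D.X) (hε : 0 < ε) (hε1 : 2 * ε < 1 - D.α) :
    1 - D.α - 4 * ε ≤ D.expect w (D.acceptPIA n) := by
  have := hw.1.1.1
  have ht := H.tuning
  have hg := ht.stepFunction
  have hβ := ht.β_pos n
  obtain ⟨t, htq⟩ := hr.gaussCdf_spec hw.1.1 H.hδ H.hcvar ht H.bandwidth subset_rfl
    (by linarith : 0 < 1 - D.α - 2 * ε) (by linarith [ht.1])
  have key := smoothCdf_sub_real_le (μ := w.noiseLaw) (β := D.β n) (B := B) (t := t)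
    (φ := fun e => D.acceptPIA n (w.response D.X e)) hg
    (H.measurable_iSup_resid (w := w) (H.bandwidth.finite_indexSet n) 1)
    ((H.estimator.measurable_acceptPIA ht H.bandwidth n).comp (w.measurable_response D.X))
    (fun _ => hg.nonneg _) (fun _ => hg.le_one _) (fun e he => by
      refine hg.anti (div_le_div_of_nonneg_right ?_ hβ.le)
      have h1 : t < D.cPIA n (w.response D.X e) (1 - D.α) :=
        ap.lt_critical ht H.bandwidth he subset_rfl hr.nonempty (by linarith [ht.2.1])
          (by linarith [ht.1]) (by linarith)
      linarith [hr.stat_le H hw e])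
  have h2 := abs_le.1 (ap.noise _ subset_rfl hr.nonempty 1 abs_one t)
  rw [expect_eq]
  linarith [ap.real_le]

/-- With zero regression function the statistic equals the noise maximum, so the argument for the
lower bound can be reversed, with the quantile of level 1 - α + 2ε. -/
lemma ApproxAt.expect_acceptPIA_le (ap : D.ApproxAt w ε r B) (H : D.Assumptions c κ)
    (hr : D.RegularAt A n) (hw : w.InNullClass c D.X) (hf : ∀ m x, w.f m x = 0) (hε : 0 < ε)
    (hε1 : 2 * ε < D.α) :
    D.expect w (D.acceptPIA n) ≤ 1 - D.α + 4 * ε := by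
  have := hw.1.1.1
  have ht := H.tuning
  have hg := ht.stepFunction
  have hβ := ht.β_pos n
  obtain ⟨t, htq⟩ := hr.gaussCdf_spec hw.1.1 H.hδ H.hcvar ht H.bandwidth subset_rfl
    (by linarith [ht.2.1] : 0 < 1 - D.α + 2 * ε) (by linarith)
  have key := integral_le_smoothCdf_add_real (μ := w.noiseLaw) (β := D.β n) (B := B) (t := t)
    (φ := fun e => D.acceptPIA n (w.response D.X e)) hg
    (H.measurable_iSup_resid (w := w) (H.bandwidth.finite_indexSet n) 1)
    ((H.estimator.measurable_acceptPIA ht H.bandwidth n).comp (w.measurable_response D.X))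
    (fun _ => hg.nonneg _) (fun _ => hg.le_one _) (fun e he => by
      refine hg.anti (div_le_div_of_nonneg_right ?_ hβ.le)
      have h1 : D.cPIA n (w.response D.X e) (1 - D.α) ≤ t :=
        ap.critical_le ht H.bandwidth he subset_rfl hr.nonempty (by linarith [ht.2.1])
          (by linarith [ht.1]) (by linarith)
      linarith [hr.stat_eq_of_zero H hw hf e])
  have h2 := abs_le.1 (ap.noise _ subset_rfl hr.nonempty 1 abs_one t)
  rw [expect_eq]
  linarith [ap.real_le]

end Fixed

end Design
end CMITest

namespace CMITest
namespace Design

variable {d p : ℕ} {D : Design d p} {c : ModelConstants} {κ : ℝ}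

/-! ### The selection step and the test with refined moment selection -/

/-- The numerical requirements for the analysis of the selection step at sample size `n`: `b` is
(up to the width `β`) a quantile of the maximum of the noise; `K` bounds critical values from
below, and `L` independent statistics have a critical value of at least `2`. -/
structure SelectionAt (D : Design d p) {n : ℕ} (w : Model d p n) (ε r b K : ℝ) (L : ℕ) : Prop where
  ε_pos : 0 < ε
  r_nonneg : 0 ≤ r
  r_le : r ≤ 1 / 2
  quantile : D.gaussCdf w (D.indexSet n) (b - D.β n) = 1 - D.γ n - 2 * ε
  one_le : 1 ≤ b
  mul_le : r * b ≤ 1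
  K_nonneg : 0 ≤ K
  L_pos : 0 < L
  lower : (gaussianReal 0 1).real (Set.Iic (-K + D.β n)) + ε < 1 - D.α
  upper : (gaussianReal 0 1).real (Set.Iic (2 + D.β n)) ^ L + ε < 1 - D.α
  far : 0 ≤ b - 4 * K - 6 - D.β n
  tail : (p * (D.bandwidths n).ncard + 1) * L *
    Real.exp (-(b - 4 * K - 6 - D.β n) ^ 2 / 2) ≤ ε

section Fixed

variable {n : ℕ} {w : Model d p n} {A ε r b K : ℝ} {L : ℕ} {B : Set (Fin n → Vec p)}
  {s : Fin n × Fin p × ℝ} {e : Fin n → Vec p}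

/-- The event that a noise statistic exceeds `b`. -/
def exceedSet (D : Design d p) {n : ℕ} (w : Model d p n) (E : Set (Fin n × Fin p × ℝ)) (σ b : ℝ) :
    Set (Fin n → Vec p) :=
  {e | ∃ s ∈ E, b < σ * D.resid w s e}

lemma le_of_notMem_exceedSet {E : Set (Fin n × Fin p × ℝ)} {σ : ℝ}
    (he : e ∉ D.exceedSet w E σ b) (hs : s ∈ E) : σ * D.resid w s e ≤ b :=
  not_lt.1 fun h => he ⟨s, hs, h⟩

lemma SelectionAt.real_exceedSet_le (hsel : D.SelectionAt w ε r b K L) (ap : D.ApproxAt w ε r B)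
    (H : D.Assumptions c κ) (hr : D.RegularAt A n) (hw : w.InNullClass c D.X) {σ : ℝ}
    (hσ : |σ| = 1) : w.noiseLaw.real (D.exceedSet w (D.indexSet n) σ b) ≤ D.γ n + 3 * ε := by
  have := hw.1.1.1
  have h1 := ap.real_noise_gt_le H.tuning H.bandwidth H.estimator subset_rfl hr.nonempty hσ
    (b - D.β n)
  rw [hsel.quantile, sub_add_cancel] at h1
  unfold exceedSet
  linarith

lemma SelectionAt.real_exceedSet_far_le (hsel : D.SelectionAt w ε r b K L)
    (ap : D.ApproxAt w ε r B) (H : D.Assumptions c κ) (hr : D.RegularAt A n)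
    (hw : w.InNullClass c D.X) {σ : ℝ} (hσ : |σ| = 1) {E : Set (Fin n × Fin p × ℝ)}
    (hE : E ⊆ D.indexSet n) (hcard : (E.ncard : ℝ) ≤ (p * (D.bandwidths n).ncard + 1) * L) :
    w.noiseLaw.real (D.exceedSet w E σ (b - 4 * K - 6)) ≤ 2 * ε := by
  have := hw.1.1.1
  rcases E.eq_empty_or_nonempty with rfl | hEn
  · simp [exceedSet, hsel.ε_pos.le]
  · have h1 := ap.real_noise_gt_le H.tuning H.bandwidth H.estimator hE hEn hσ
      (b - 4 * K - 6 - D.β n)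
    have h2 := hr.one_sub_gaussCdf_le hw.1.1 H.hδ H.hcvar H.tuning H.bandwidth hE hEn hsel.far
    have h3 : E.ncard * Real.exp (-(b - 4 * K - 6 - D.β n) ^ 2 / 2) ≤ ε :=
      (mul_le_mul_of_nonneg_right hcard (Real.exp_pos _).le).trans hsel.tail
    rw [sub_add_cancel] at h1
    unfold exceedSet
    linarith

lemma ApproxAt.le_stat (ap : D.ApproxAt w ε r B) (H : D.Assumptions c κ) (hr : D.RegularAt A n)
    (hw : w.InNullClass c D.X) (he : e ∉ B) (hs : s ∈ D.indexSet n) {v : ℝ} (hv : 0 ≤ v)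
    (hu : -v ≤ D.drift w s) : -(v * (1 + r)) + D.resid w s e ≤
      D.smooth n (w.response D.X e) s / D.sdHat n (w.response D.X e) s := by
  rw [hr.stat_eq hw.1.1 H.hcvar hs]
  have h1 := abs_le.1 (ap.ratio e he s hs)
  have h2 := hr.drift_nonpos hw hs
  have h3 : 0 ≤ D.sd w s / D.sdHat n (w.response D.X e) s :=
    div_nonneg (Real.sqrt_nonneg _) (Real.sqrt_nonneg _)
  set t := D.sd w s / D.sdHat n (w.response D.X e) s
  have h4 : -v * t ≤ D.drift w s * t := mul_le_mul_of_nonneg_right hu h3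
  have h5 : v * t ≤ v * (1 + r) := mul_le_mul_of_nonneg_left (by linarith) hv
  linarith

lemma ApproxAt.stat_le (ap : D.ApproxAt w ε r B) (H : D.Assumptions c κ) (hr : D.RegularAt A n)
    (hw : w.InNullClass c D.X) (he : e ∉ B) (hs : s ∈ D.indexSet n) {v : ℝ} (hv : 0 ≤ v)
    (hu : D.drift w s ≤ -v) :
    D.smooth n (w.response D.X e) s / D.sdHat n (w.response D.X e) s ≤
      -(v * (1 - r)) + D.resid w s e := by
  rw [hr.stat_eq hw.1.1 H.hcvar hs]
  have h1 := abs_le.1 (ap.ratio e he s hs)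
  have h3 : 0 ≤ D.sd w s / D.sdHat n (w.response D.X e) s :=
    div_nonneg (Real.sqrt_nonneg _) (Real.sqrt_nonneg _)
  set t := D.sd w s / D.sdHat n (w.response D.X e) s
  have h4 : D.drift w s * t ≤ -v * t := mul_le_mul_of_nonneg_right hu h3
  have h5 : v * (1 - r) ≤ v * t := mul_le_mul_of_nonneg_left (by linarith) hv
  linarith

/-- The level of the quantile defining `b` is 2ε short of 1 - γ, so off `B` the critical value of
level 1 - γ exceeds b - β, and the selection threshold lies below -2b. -/
lemma SelectionAt.mem_rmsSet (hsel : D.SelectionAt w ε r b K L) (ap : D.ApproxAt w ε r B)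
    (H : D.Assumptions c κ) (hr : D.RegularAt A n) (he : e ∉ B) (hs : s ∈ D.indexSet n)
    (h : -2 * b ≤ D.smooth n (w.response D.X e) s / D.sdHat n (w.response D.X e) s) :
    s ∈ D.rmsSet n (w.response D.X e) := by
  have ht := H.tuning
  have h1 : b - D.β n < D.cPIA n (w.response D.X e) (1 - D.γ n) :=
    ap.lt_critical ht H.bandwidth he subset_rfl hr.nonempty
      (by linarith [ht.γ_lt_one n]) (by linarith [ht.γ_pos n])
      (by rw [hsel.quantile]; linarith [hsel.ε_pos])
  exact ⟨hs, by linarith⟩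

/-- Drift at least -(b - 1) and noise at least -b leave the statistic above -2b: the missing 1 in
the drift absorbs the error `r * b ≤ 1` in the standard deviation. -/
lemma SelectionAt.mem_rmsSet_of_drift (hsel : D.SelectionAt w ε r b K L)
    (ap : D.ApproxAt w ε r B) (H : D.Assumptions c κ) (hr : D.RegularAt A n)
    (hw : w.InNullClass c D.X) (he : e ∉ B) (he' : e ∉ D.exceedSet w (D.indexSet n) (-1) b)
    (hs : s ∈ D.indexSet n) (hu : -(b - 1) ≤ D.drift w s) :
    s ∈ D.rmsSet n (w.response D.X e) := by
  refine hsel.mem_rmsSet ap H hr he hs ((le_trans ?_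
    (ap.le_stat H hr hw he hs (by linarith [hsel.one_le]) hu)))
  have h1 := le_of_notMem_exceedSet he' hs
  linarith [hsel.mul_le, hsel.r_nonneg]

/-- A nonempty set contains a singleton, whose statistic is nearly standard normal, so the critical
value cannot be very negative. -/
lemma SelectionAt.neg_lt_critical (hsel : D.SelectionAt w ε r b K L) (ap : D.ApproxAt w ε r B)
    (H : D.Assumptions c κ) (hr : D.RegularAt A n) (hw : w.InNullClass c D.X) (he : e ∉ B)
    {E : Set (Fin n × Fin p × ℝ)} (hE : E ⊆ D.indexSet n) (hEn : E.Nonempty) :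
    -K < D.critical n (w.response D.X e) E (1 - D.α + 2 * D.γ n) := by
  have ht := H.tuning
  have h0 : 0 < 1 - D.α + 2 * D.γ n := by linarith [ht.2.1, ht.γ_pos n]
  have h1 : 1 - D.α + 2 * D.γ n < 1 := by linarith [ht.γ_lt n]
  obtain ⟨s, hs⟩ := hEn
  have hsub : {s} ⊆ E := Set.singleton_subset_iff.2 hs
  refine lt_of_lt_of_le ?_ (critical_mono ht ((H.bandwidth.finite_indexSet n).subset hE)
    (Set.singleton_nonempty s) hsub _ h0 h1)
  have h2 := hr.gaussCdf_le_pow hw.1.1 H.hδ H.hcvar ht H.bandwidth H.testPoints (hsub.trans hE)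
    (Set.singleton_nonempty s) (m := s.2.1) (b := s.2.2)
    (by rintro _ rfl; rfl) (-K)
  rw [Set.ncard_singleton, pow_one] at h2
  exact ap.lt_critical ht H.bandwidth he (hsub.trans hE) (Set.singleton_nonempty s) h0 h1
    (by linarith [hsel.lower, ht.γ_pos n])

/-- Monotonicity reduces to the `L` statistics sharing component and bandwidth. They are
uncorrelated, so the distribution function of their maximum is at most an L-th power. -/
lemma SelectionAt.two_lt_critical (hsel : D.SelectionAt w ε r b K L) (ap : D.ApproxAt w ε r B)
    (H : D.Assumptions c κ) (hr : D.RegularAt A n) (hw : w.InNullClass c D.X) (he : e ∉ B)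
    {E E' : Set (Fin n × Fin p × ℝ)} (hE' : E' ⊆ D.indexSet n) (hEE : E ⊆ E') (hcard : E.ncard = L)
    {v : Fin p × ℝ} (hv : ∀ s ∈ E, s.2 = v) :
    2 < D.critical n (w.response D.X e) E' (1 - D.α + 2 * D.γ n) := by
  have ht := H.tuning
  have h0 : 0 < 1 - D.α + 2 * D.γ n := by linarith [ht.2.1, ht.γ_pos n]
  have h1 : 1 - D.α + 2 * D.γ n < 1 := by linarith [ht.γ_lt n]
  have hEn : E.Nonempty := Set.nonempty_of_ncard_ne_zero (hcard ▸ hsel.L_pos.ne')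
  refine lt_of_lt_of_le ?_ (critical_mono ht ((H.bandwidth.finite_indexSet n).subset hE')
    hEn hEE _ h0 h1)
  have h2 := hr.gaussCdf_le_pow hw.1.1 H.hδ H.hcvar ht H.bandwidth H.testPoints (hEE.trans hE')
    hEn (m := v.1) (b := v.2) hv 2
  rw [hcard] at h2
  exact ap.lt_critical ht H.bandwidth he (hEE.trans hE') hEn h0 h1
    (by linarith [hsel.upper, ht.γ_pos n])

/-- With high probability, no statistic with a very negative drift exceeds the critical value. -/
lemma SelectionAt.exists_real_le (hsel : D.SelectionAt w ε r b K L) (ap : D.ApproxAt w ε r B)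
    (H : D.Assumptions c κ) (hr : D.RegularAt A n) (hw : w.InNullClass c D.X) :
    ∃ B' : Set (Fin n → Vec p), w.noiseLaw.real B' ≤ 2 * ε ∧
      ∀ e, e ∉ B → e ∉ B' → e ∉ D.exceedSet w (D.indexSet n) 1 b →
        (D.rmsSet n (w.response D.X e)).Nonempty →
        ∀ s ∈ D.indexSet n, D.drift w s < -(b - 1) →
          D.smooth n (w.response D.X e) s / D.sdHat n (w.response D.X e) s ≤
            D.critical n (w.response D.X e) (D.rmsSet n (w.response D.X e))
              (1 - D.α + 2 * D.γ n) := by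
  classical
  have hfin := H.bandwidth.finite_indexSet n
  have hb1 := hsel.one_le
  have hK := hsel.K_nonneg
  have hrb := hsel.mul_le
  have hr0 := hsel.r_nonneg
  have hr2 := hsel.r_le
  have hrK : r * K ≤ K / 2 := by nlinarith
  -- Statistics of even more negative drift fall below -K, hence below any critical value, as soon
  -- as the noise is at most b. Only drifts in this bounded window around -b are delicate.
  set Mid : Set (Fin n × Fin p × ℝ) :=
    {s ∈ D.indexSet n | -(b + (2 * K + 2)) < D.drift w s ∧ D.drift w s < -(b - 1)} with hMid
  have hMidS : Mid ⊆ D.indexSet n := fun s hs => hs.1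
  by_cases hcase : ∃ v : Fin p × ℝ, L ≤ {s ∈ Mid | s.2 = v}.ncard
  · obtain ⟨v, hv⟩ := hcase
    obtain ⟨I, hI, hIcard⟩ := Set.exists_subset_card_eq hv
    have hIS : I ⊆ D.indexSet n := fun s hs => hMidS (hI hs).1
    -- Only `L` statistics are involved, so their noise stays above -(b - 4K - 6). The margin 4K + 6
    -- covers the offset 2K + 2 of the drift and the relative error `r`, so all of them are selected
    -- and the critical value exceeds 2. A statistic of drift below -(b - 1) with noise at most b
    -- stays at or below 1 + rb ≤ 2.
    refine ⟨_, hsel.real_exceedSet_far_le ap H hr hw (σ := -1) (by simp) hIS ?_,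
      fun e he he' he1 _ s hs hu => ?_⟩
    · rw [hIcard]
      exact le_mul_of_one_le_left (by positivity) (le_add_of_nonneg_left (by positivity))
    · have hIsel : I ⊆ D.rmsSet n (w.response D.X e) := fun u hu => by
        have hM := (hI hu).1
        refine hsel.mem_rmsSet ap H hr he hM.1 (le_trans ?_
          (ap.le_stat H hr hw he hM.1 (by linarith) hM.2.1.le))
        have h1 := le_of_notMem_exceedSet he' hu
        linarith
      have h2 := hsel.two_lt_critical ap H hr hw he (rmsSet_subset n _) hIsel hIcard
        (fun s hs => (hI hs).2)
      have h3 := ap.stat_le H hr hw he hs (by linarith : 0 ≤ b - 1) hu.le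
      have h4 := le_of_notMem_exceedSet he1 hs
      linarith
  -- Fewer than `L` statistics in each pair of component and bandwidth: the whole window is small
  -- enough for its noise to stay below b - 4K - 6, so these statistics fall below -K.
  · push Not at hcase
    have hMfin := hfin.subset hMidS
    have hHfin := H.bandwidth.finite n
    have hcard : (Mid.ncard : ℝ) ≤ (p * (D.bandwidths n).ncard + 1) * L := by
      have h1 := Finset.card_le_mul_card_image_of_maps_to (s := hMfin.toFinset)
        (t := (Finset.univ : Finset (Fin p)) ×ˢ hHfin.toFinset) (f := fun s => s.2)
        (fun s hs => by
          rw [Set.Finite.mem_toFinset] at hs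
          simpa using hs.1.1) L (fun v _ => by
          refine le_trans (le_of_eq ?_) (hcase v).le
          rw [← Set.ncard_coe_finset]
          congr 1
          ext s
          simp)
      rw [Finset.card_product, Finset.card_univ, Fintype.card_fin,
        ← Set.ncard_eq_toFinset_card _ hMfin, ← Set.ncard_eq_toFinset_card _ hHfin] at h1
      have h2 : (Mid.ncard : ℝ) ≤ L * (p * (D.bandwidths n).ncard) := by exact_mod_cast h1
      have hL : (0 : ℝ) ≤ L := by positivity
      linarith
    refine ⟨_, hsel.real_exceedSet_far_le ap H hr hw abs_one hMidS hcard,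
      fun e he he' he1 hne s hs hu => ?_⟩
    refine le_trans ?_ (hsel.neg_lt_critical ap H hr hw he (rmsSet_subset n _) hne).le
    by_cases hsM : s ∈ Mid
    · have h3 := ap.stat_le H hr hw he hs (by linarith : 0 ≤ b - 1) hu.le
      have h4 := le_of_notMem_exceedSet he' hsM
      linarith
    -- Here r ≤ 1 / 2 halves the offset 2K + 2 at worst, and rb ≤ 1 uses up the remaining 1, which
    -- leaves exactly -K.
    · have hu2 : D.drift w s ≤ -(b + (2 * K + 2)) := not_lt.1 fun hlt => hsM ⟨hs, hlt, hu⟩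
      have h3 := ap.stat_le H hr hw he hs (by linarith) hu2
      have h4 := le_of_notMem_exceedSet he1 hs
      linarith

lemma acceptRMS_nonneg (ht : D.TuningCondition) (Y : Fin n → Vec p) : 0 ≤ D.acceptRMS n Y := by
  unfold acceptRMS
  split_ifs
  · exact ht.stepFunction.nonneg _
  · exact zero_le_one

lemma acceptRMS_le_one (ht : D.TuningCondition) (Y : Fin n → Vec p) : D.acceptRMS n Y ≤ 1 := by
  unfold acceptRMS
  split_ifs
  · exact ht.stepFunction.le_one _
  · exact le_rfl

lemma acceptRMS_of_nonempty {Y : Fin n → Vec p} (h : (D.rmsSet n Y).Nonempty) :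
    D.acceptRMS n Y =
      D.g₀ ((D.stat n Y - D.critical n Y (D.rmsSet n Y) (1 - D.α + 2 * D.γ n)) / D.β n) :=
  if_pos h

/-- The critical value is at least that of the statistics with drift at least -(b - 1), all of them
selected off the bad events, while the other statistics do not exceed it. The bad events have mass
at most 2γ + 9ε, and the 2γ is offset by the increased level 1 - α + 2γ. -/
lemma SelectionAt.le_expect_acceptRMS (hsel : D.SelectionAt w ε r b K L)
    (ap : D.ApproxAt w ε r B) (H : D.Assumptions c κ) (hr : D.RegularAt A n)
    (hw : w.InNullClass c D.X) (hε1 : 2 * ε < 1 - D.α) :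
    1 - D.α - 12 * ε ≤ D.expect w (D.acceptRMS n) := by
  have := hw.1.1.1
  have hε := hsel.ε_pos
  have ht := H.tuning
  have hg := ht.stepFunction
  have hβ := ht.β_pos n
  have hfin := H.bandwidth.finite_indexSet n
  have h0 : 0 < 1 - D.α + 2 * D.γ n := by linarith [ht.2.1, ht.γ_pos n]
  have h1 : 1 - D.α + 2 * D.γ n < 1 := by linarith [ht.γ_lt n]
  have hφ : Measurable fun e => D.acceptRMS n (w.response D.X e) :=
    (H.estimator.measurable_acceptRMS ht H.bandwidth n).comp (w.measurable_response D.X)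
  obtain ⟨B', hB', hrej⟩ := hsel.exists_real_le ap H hr hw
  have hE1 := hsel.real_exceedSet_le ap H hr hw abs_one
  have hE2 := hsel.real_exceedSet_le ap H hr hw (σ := -1) (by simp)
  set E₁ := D.exceedSet w (D.indexSet n) 1 b
  set E₂ := D.exceedSet w (D.indexSet n) (-1) b
  have hbad : w.noiseLaw.real (B ∪ B' ∪ E₁ ∪ E₂) ≤ 2 * D.γ n + 9 * ε := by
    have u1 := measureReal_union_le (μ := w.noiseLaw) (B ∪ B' ∪ E₁) E₂
    have u2 := measureReal_union_le (μ := w.noiseLaw) (B ∪ B') E₁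
    have u3 := measureReal_union_le (μ := w.noiseLaw) B B'
    linarith [ap.real_le]
  -- Statistics outside F never exceed the critical value, so the maximum is bounded by anything
  -- dominating both that value and the noise over F.
  have hstat : ∀ e, e ∉ B ∪ B' ∪ E₁ ∪ E₂ → (D.rmsSet n (w.response D.X e)).Nonempty → ∀ T : ℝ,
      (∀ s ∈ D.indexSet n, -(b - 1) ≤ D.drift w s → D.resid w s e ≤ T) →
      D.critical n (w.response D.X e) (D.rmsSet n (w.response D.X e)) (1 - D.α + 2 * D.γ n) ≤ T →
      D.stat n (w.response D.X e) ≤ T := fun e he hne T hT hcT => by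
    simp only [Set.mem_union, not_or] at he
    have := hr.nonempty.to_subtype
    rw [stat_eq_iSup]
    refine ciSup_le fun s => ?_
    rcases le_or_gt (-(b - 1)) (D.drift w s) with hu | hu
    · exact (hr.stat_le_resid hw H.hcvar s.2 e).trans (hT s s.2 hu)
    · exact (hrej e he.1.1.1 he.1.1.2 he.1.2 hne s s.2 hu).trans hcT
  set F : Set (Fin n × Fin p × ℝ) := {s ∈ D.indexSet n | -(b - 1) ≤ D.drift w s} with hF
  have hFS : F ⊆ D.indexSet n := fun s hs => hs.1
  rw [expect_eq]
  rcases F.eq_empty_or_nonempty with hFe | hFn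
  -- With F empty, acceptance is certain off the bad events; the constant statistic 0 at level 0
  -- expresses this, and 2γ < α gives enough room.
  · have key := smoothCdf_sub_real_le (μ := w.noiseLaw) (β := D.β n) (t := 0)
      (B := B ∪ B' ∪ E₁ ∪ E₂) (T := fun _ => 0) hg measurable_const hφ
      (fun _ => acceptRMS_nonneg ht _) (fun _ => acceptRMS_le_one ht _) (fun e he => by
        refine (hg.le_one _).trans ?_
        by_cases hne : (D.rmsSet n (w.response D.X e)).Nonempty
        · rw [acceptRMS_of_nonempty hne, hg.one]
          refine div_nonpos_of_nonpos_of_nonneg (sub_nonpos.2 ?_) hβ.le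
          refine hstat e he hne _ (fun s hs hu => ?_) le_rfl
          have : s ∈ F := ⟨hs, hu⟩
          rw [hFe] at this
          exact this.elim
        · rw [acceptRMS, if_neg hne])
    have e1 : smoothCdf D.g₀ (D.β n) w.noiseLaw (fun _ => (0 : ℝ)) 0 = 1 := by
      simp [smoothCdf, hg.one 0 le_rfl]
    rw [e1] at key
    linarith [ht.γ_lt n]
  · obtain ⟨t, htq⟩ := hr.gaussCdf_spec hw.1.1 H.hδ H.hcvar ht H.bandwidth hFS
      (by linarith [ht.γ_pos n] : 0 < 1 - D.α + 2 * D.γ n - 2 * ε) (by linarith)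
    have hFfin := (hfin.subset hFS).fintype
    have key := smoothCdf_sub_real_le (μ := w.noiseLaw) (β := D.β n) (t := t)
      (B := B ∪ B' ∪ E₁ ∪ E₂) hg (H.measurable_iSup_resid (w := w) (hfin.subset hFS) 1) hφ
      (fun _ => acceptRMS_nonneg ht _) (fun _ => acceptRMS_le_one ht _) (fun e he => by
        have he' := he
        simp only [Set.mem_union, not_or] at he'
        have hsub : F ⊆ D.rmsSet n (w.response D.X e) := fun s hs =>
          hsel.mem_rmsSet_of_drift ap H hr hw he'.1.1.1 he'.2 hs.1 hs.2
        have hne := hFn.mono hsub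
        rw [acceptRMS_of_nonempty hne]
        have hc1 : t < D.critical n (w.response D.X e) F (1 - D.α + 2 * D.γ n) :=
          ap.lt_critical ht H.bandwidth he'.1.1.1 hFS hFn h0 h1 (by linarith)
        have hc2 := critical_mono ht (hfin.subset (rmsSet_subset n (w.response D.X e))) hFn hsub
          (w.response D.X e) h0 h1
        set ĉ := D.critical n (w.response D.X e) (D.rmsSet n (w.response D.X e))
          (1 - D.α + 2 * D.γ n) with hĉ
        set T := ⨆ s : F, 1 * D.resid w s e with hT
        have hTle : ∀ s ∈ D.indexSet n, -(b - 1) ≤ D.drift w s → D.resid w s e ≤ T :=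
          fun s hs hu => by
            have := le_iSup_fin (fun s : F => 1 * D.resid w s e) ⟨s, hs, hu⟩
            rwa [one_mul] at this
        -- If the critical value dominates the noise over F, the test accepts with probability one.
        -- Otherwise the statistic is at most that noise maximum and the critical value exceeds t.
        rcases le_total T ĉ with hle | hle
        · rw [hg.one ((D.stat n (w.response D.X e) - ĉ) / D.β n)]
          · exact hg.le_one _
          · exact div_nonpos_of_nonpos_of_nonneg (sub_nonpos.2
              (hstat e he hne _ (fun s hs hu => (hTle s hs hu).trans hle) le_rfl)) hβ.le
        · refine hg.anti (div_le_div_of_nonneg_right ?_ hβ.le)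
          linarith [hstat e he hne _ hTle hle])
    have h2 := abs_le.1 (ap.noise F hFS hFn 1 abs_one t)
    linarith

/-- With zero drift every index is selected unless the noise falls below -b. The test is then the
plug-in test at level 1 - α + 2γ, and the exceptional event contributes the third γ. -/
lemma SelectionAt.expect_acceptRMS_le (hsel : D.SelectionAt w ε r b K L)
    (ap : D.ApproxAt w ε r B) (H : D.Assumptions c κ) (hr : D.RegularAt A n)
    (hw : w.InNullClass c D.X) (hf : ∀ m x, w.f m x = 0) (hε1 : 2 * ε + 2 * D.γ n < D.α) :
    D.expect w (D.acceptRMS n) ≤ 1 - D.α + 3 * D.γ n + 7 * ε := by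
  have := hw.1.1.1
  have hε := hsel.ε_pos
  have ht := H.tuning
  have hg := ht.stepFunction
  have hβ := ht.β_pos n
  have hfin := H.bandwidth.finite_indexSet n
  have h0 : 0 < 1 - D.α + 2 * D.γ n := by linarith [ht.2.1, ht.γ_pos n]
  have h1 : 1 - D.α + 2 * D.γ n < 1 := by linarith [ht.γ_lt n]
  have hE2 := hsel.real_exceedSet_le ap H hr hw (σ := -1) (by simp)
  set E₂ := D.exceedSet w (D.indexSet n) (-1) b
  have hbad := measureReal_union_le (μ := w.noiseLaw) B E₂
  obtain ⟨t, htq⟩ := hr.gaussCdf_spec hw.1.1 H.hδ H.hcvar ht H.bandwidth subset_rfl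
    (by linarith [ht.γ_pos n] : 0 < 1 - D.α + 2 * D.γ n + 2 * ε) (by linarith)
  have key := integral_le_smoothCdf_add_real (μ := w.noiseLaw) (β := D.β n) (t := t)
    (φ := fun e => D.acceptRMS n (w.response D.X e))
    (B := B ∪ E₂) hg (H.measurable_iSup_resid (w := w) hfin 1)
    ((H.estimator.measurable_acceptRMS ht H.bandwidth n).comp (w.measurable_response D.X))
    (fun _ => acceptRMS_nonneg ht _) (fun _ => acceptRMS_le_one ht _) (fun e he => by
      simp only [Set.mem_union, not_or] at he
      have hall : D.rmsSet n (w.response D.X e) = D.indexSet n :=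
        (rmsSet_subset n _).antisymm fun s hs =>
          hsel.mem_rmsSet_of_drift ap H hr hw he.1 he.2 hs
            (by rw [drift_eq_zero hf]; linarith [hsel.one_le])
      rw [acceptRMS_of_nonempty (by rw [hall]; exact hr.nonempty), hall]
      refine hg.anti (div_le_div_of_nonneg_right ?_ hβ.le)
      have h2 := ap.critical_le ht H.bandwidth he.1 subset_rfl hr.nonempty h0 h1
        (by rw [htq]; linarith : 1 - D.α + 2 * D.γ n + ε ≤ D.gaussCdf w (D.indexSet n) t)
      linarith [hr.stat_eq_of_zero H hw hf e])
  have h2 := abs_le.1 (ap.noise _ subset_rfl hr.nonempty 1 abs_one t)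
  rw [expect_eq]
  linarith [ap.real_le]

end Fixed

end Design
end CMITest

namespace CMITest
namespace Design

variable {d p : ℕ} {D : Design d p} {c : ModelConstants} {κ : ℝ}

/-! ### Growth of the noise quantile -/

lemma exists_gaussianReal_Iic_le {ε : ℝ} (hε : 0 < ε) (C : ℝ) :
    ∃ K, 0 ≤ K ∧ ∀ b ≤ C, (gaussianReal 0 1).real (Set.Iic (-K + b)) ≤ ε := by
  obtain ⟨x, hx⟩ := ((tendsto_cdf_atBot (gaussianReal 0 1)).eventually_le_const hε).exists
  refine ⟨max 0 (C - x), le_max_left _ _, fun b hb => ?_⟩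
  rw [cdf_eq_real] at hx
  refine (measureReal_mono (Set.Iic_subset_Iic.2 ?_)).trans hx
  linarith [le_max_right 0 (C - x)]

lemma gaussianReal_Iic_le_one_sub {b : ℝ} (hb : 0 ≤ b) :
    (gaussianReal 0 1).real (Set.Iic b) ≤ 1 - (√(2 * Real.pi))⁻¹ * Real.exp (-1) * Real.exp (-b ^ 2) := by
  have h1 := le_gaussianReal_real_gt hb
  have h2 := probReal_compl_eq_one_sub (μ := gaussianReal 0 1) (measurableSet_Iic (a := b))
  have e : (Set.Iic b)ᶜ = {x : ℝ | b < x} := by ext; simp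
  rw [e] at h2
  linarith

lemma exists_gaussianReal_Iic_pow_le {ε : ℝ} (hε : 0 < ε) {C : ℝ} (hC : 0 ≤ C) :
    ∃ L : ℕ, 0 < L ∧ ∀ b ≤ C, (gaussianReal 0 1).real (Set.Iic b) ^ L ≤ ε := by
  have h1 : (gaussianReal 0 1).real (Set.Iic C) < 1 :=
    (gaussianReal_Iic_le_one_sub hC).trans_lt (sub_lt_self _ (by positivity))
  obtain ⟨L, hL⟩ := exists_pow_lt_of_lt_one hε h1
  refine ⟨L + 1, L.succ_pos, fun b hb => le_trans ?_ hL.le⟩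
  refine (pow_le_pow_left₀ measureReal_nonneg (measureReal_mono (Set.Iic_subset_Iic.2 hb)) _).trans
    (pow_le_pow_of_le_one measureReal_nonneg h1.le L.le_succ)

/-- A quantile of the maximum of `N` independent standard normal variables is at least of the order
of the square root of `log N`. -/
lemma gaussianReal_Iic_pow_lt {b : ℝ} (hb : 0 ≤ b) {N : ℕ} (hN : 0 < N)
    (h : 1 ≤ (√(2 * Real.pi))⁻¹ * Real.exp (-1) * Real.exp (Real.log N / 2))
    (hbN : b ^ 2 ≤ Real.log N / 2) :
    (gaussianReal 0 1).real (Set.Iic b) ^ N < 3 / 8 := by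
  set a := (√(2 * Real.pi))⁻¹ * Real.exp (-1) with ha
  have ha0 : 0 < a := by positivity
  have hN0 : (0 : ℝ) < N := by exact_mod_cast hN
  have h1 : (gaussianReal 0 1).real (Set.Iic b) ≤ Real.exp (-(a * Real.exp (-b ^ 2))) := by
    have := Real.add_one_le_exp (-(a * Real.exp (-b ^ 2)))
    linarith [gaussianReal_Iic_le_one_sub hb]
  have h2 : 1 ≤ N * (a * Real.exp (-b ^ 2)) := by
    have e : (N : ℝ) = Real.exp (Real.log N) := (Real.exp_log hN0).symm
    have h3 : a * Real.exp (Real.log N / 2) ≤ N * (a * Real.exp (-b ^ 2)) := by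
      calc a * Real.exp (Real.log N / 2) ≤ a * Real.exp (Real.log N + -b ^ 2) := by
            gcongr; linarith
        _ = N * (a * Real.exp (-b ^ 2)) := by rw [Real.exp_add, Real.exp_log hN0]; ring
    linarith
  calc _ ≤ Real.exp (-(a * Real.exp (-b ^ 2))) ^ N := pow_le_pow_left₀ measureReal_nonneg h1 _
    _ = Real.exp (-(N * (a * Real.exp (-b ^ 2)))) := by rw [← Real.exp_nat_mul]; ring_nf
    _ ≤ Real.exp (-1) := Real.exp_le_exp.2 (by linarith)
    _ < 3 / 8 := Real.exp_neg_one_lt_d9.trans (by norm_num)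

lemma eventually_linear_mul_exp_le (u v : ℝ) {ε : ℝ} (hε : 0 < ε) :
    ∀ᶠ x : ℝ in atTop, (u * x + v) * Real.exp (-x / 16) ≤ ε := by
  have h1 := (Real.tendsto_pow_mul_exp_neg_atTop_nhds_zero 1).comp
    (tendsto_id.atTop_div_const (by norm_num : (0 : ℝ) < 16))
  have h2 := (Real.tendsto_pow_mul_exp_neg_atTop_nhds_zero 0).comp
    (tendsto_id.atTop_div_const (by norm_num : (0 : ℝ) < 16))
  have h3 := (h1.const_mul (16 * u)).add (h2.const_mul v)
  rw [mul_zero, mul_zero, add_zero] at h3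
  filter_upwards [h3.eventually_le_const hε] with x hx
  refine le_trans (le_of_eq ?_) hx
  simp only [Function.comp_apply, id, pow_one, pow_zero]
  rw [neg_div]
  ring

/-- At a suitable bandwidth with N test points, the corresponding Gaussian variables are
independent, so the quantile b is at least √((log N) / 2). The number of bandwidths is O(log N), and
a union bound over that many indices loses to exp(-(log N) / 16). -/
lemma Assumptions.eventually_selectionAt (H : D.Assumptions c κ) {ε : ℝ} (hε : 0 < ε)
    (hε1 : 4 * ε ≤ 1 - D.α) (hε2 : ε ≤ 1 / 16) :
    ∃ (K : ℝ) (L : ℕ), ∀ᶠ n : ℕ in atTop, ∀ w : Model d p n, w.DisturbanceCondition c D.X →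
      ∃ b, D.SelectionAt w ε (2 / c.cvar * (n : ℝ) ^ (-κ)) b K L := by
  obtain ⟨A, hA, hreg⟩ := H.eventually_regularAt
  obtain ⟨C, hC, hβC⟩ := H.testFunction.1
  have hκ := H.hκ
  have hc := H.hcvar
  obtain ⟨K, hK, hKε⟩ := exists_gaussianReal_Iic_le hε C
  obtain ⟨L, hL, hLε⟩ := exists_gaussianReal_Iic_pow_le hε (by linarith : 0 ≤ 2 + C)
  obtain ⟨Q, hQ, hcardev⟩ := exists_eventually_log_card_ge H.hd H.design H.bandwidth H.testPoints
  have hx1 : ∀ᶠ x : ℝ in atTop, 1 ≤ (√(2 * Real.pi))⁻¹ * Real.exp (-1) * Real.exp (x / 2) :=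
    ((Real.tendsto_exp_atTop.comp (tendsto_id.atTop_div_const
      (by norm_num : (0 : ℝ) < 2))).const_mul_atTop (by positivity)).eventually_ge_atTop 1
  have hx2 : ∀ᶠ x : ℝ in atTop, 2 * (4 * K + 6 + C) ≤ √(x / 2) :=
    (Real.tendsto_sqrt_atTop.comp (tendsto_id.atTop_div_const
      (by norm_num : (0 : ℝ) < 2))).eventually_ge_atTop _
  have hx3 := eventually_linear_mul_exp_le (p * Q * L) L hε
  obtain ⟨M, hM⟩ := eventually_atTop.1 (hx1.and (hx2.and (hx3.and (eventually_ge_atTop 1))))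
  have hr1 := (tendsto_log_mul_rpow_neg (2 / c.cvar) 0 hκ).eventually_le_const one_half_pos
  have hr2 := (tendsto_log_mul_rpow_neg (2 / c.cvar * C) (8 / c.cvar) hκ).eventually_le_const one_pos
  refine ⟨K, L, ?_⟩
  filter_upwards [hreg, hcardev M, hr1, hr2, eventually_cube_mul_exp_le hε]
    with n hr ⟨h, hh, hMx, hcard⟩ hr1 hr2 hcube w hw
  have ht := H.tuning
  have hg := ht.stepFunction
  have hβ := ht.β_pos n
  have hβn := hβC n
  have hfin := H.bandwidth.finite_indexSet n
  obtain ⟨hx1, hx2, hx3, hx4⟩ := hM _ hMx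
  set x := Real.log (D.I n h).card with hx
  obtain ⟨t, htq⟩ := hr.gaussCdf_spec hw H.hδ hc ht H.bandwidth subset_rfl
    (by linarith [ht.γ_lt_one n] : 0 < 1 - D.γ n - 2 * ε) (by linarith [ht.γ_pos n])
  set m₀ : Fin p := ⟨0, H.hp⟩
  set E : Set (Fin n × Fin p × ℝ) := (fun i => (i, (m₀, h))) '' (D.I n h : Set (Fin n)) with hE
  have hES : E ⊆ D.indexSet n := by
    rintro _ ⟨i, hi, rfl⟩
    exact ⟨hh, hi⟩
  have hEcard : E.ncard = (D.I n h).card := by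
    rw [hE, Set.ncard_image_of_injective _ fun i j hij => (Prod.ext_iff.1 hij).1,
      Set.ncard_coe_finset]
  have hcard0 : 0 < (D.I n h).card := by
    rcases Nat.eq_zero_or_pos (D.I n h).card with h0 | h0
    · rw [hx, h0] at hx4; norm_num at hx4
    · exact h0
  have hEn : E.Nonempty := Set.nonempty_of_ncard_ne_zero (by rw [hEcard]; exact hcard0.ne')
  -- The level 1 - γ - 2ε is at least 3/8, because γ < 1/2 and ε ≤ 1/16. Below √((log N) / 2) the
  -- maximum of N independent standard normals has distribution function under 3/8.
  have hlow : √(x / 2) ≤ t + D.β n := by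
    by_contra hlt
    rw [not_le] at hlt
    have h1 := gaussCdf_anti (w := w) ht hfin hEn hES t
    have h2 := hr.gaussCdf_le_pow hw H.hδ hc ht H.bandwidth H.testPoints hES hEn (m := m₀) (b := h)
      (by rintro _ ⟨i, _, rfl⟩; rfl) t
    rw [hEcard] at h2
    have h3 : (gaussianReal 0 1).real (Set.Iic (t + D.β n)) ^ (D.I n h).card ≤
        (gaussianReal 0 1).real (Set.Iic √(x / 2)) ^ (D.I n h).card :=
      pow_le_pow_left₀ measureReal_nonneg (measureReal_mono (Set.Iic_subset_Iic.2 hlt.le)) _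
    have h4 := gaussianReal_Iic_pow_lt (Real.sqrt_nonneg (x / 2)) hcard0 hx1
      (by rw [Real.sq_sqrt (by linarith)])
    linarith [ht.γ_lt_one n]
  -- The quantile is at most logarithmic, so that r b → 0 although r is only O(n^{-κ}).
  have hup : t ≤ 4 * Real.log n := by
    by_contra hlt
    rw [not_le] at hlt
    have hL0 : 0 ≤ 4 * Real.log n := by
      have := Real.log_natCast_nonneg n; linarith
    have hU : D.gaussCdf w (D.indexSet n) (4 * Real.log n) ≤ D.gaussCdf w (D.indexSet n) t := by
      have := hfin.fintype
      exact smoothCdf_mono hg hβ (measurable_iSup_fin fun s => measurable_linStat _ _) hlt.le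
    have h1 := hr.one_sub_gaussCdf_le hw H.hδ hc ht H.bandwidth subset_rfl hr.nonempty hL0
    have h2 : (D.indexSet n).ncard * Real.exp (-(4 * Real.log n) ^ 2 / 2) ≤ ε := by
      refine le_trans ?_ hcube
      have := hr.card
      gcongr
    linarith [ht.γ_pos n]
  -- The fixed constants take at most half of √(x / 2); squaring and halving the rest gives the
  -- exponent x / 16.
  have hfar : √(x / 2) / 2 ≤ t + D.β n - 4 * K - 6 - D.β n := by linarith
  have hsq0 := Real.sqrt_nonneg (x / 2)
  refine ⟨t + D.β n, hε, by positivity, ?_, by rw [add_sub_cancel_right]; exact htq, by linarith, ?_,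
    hK, hL, by linarith [hKε _ hβn], by linarith [hLε (2 + D.β n) (by linarith)], by linarith, ?_⟩
  · rwa [zero_mul, add_zero] at hr1
  · refine le_trans ?_ hr2
    calc _ ≤ 2 / c.cvar * (n : ℝ) ^ (-κ) * (4 * Real.log n + C) := by gcongr
      _ = _ := by ring
  · refine le_trans ?_ hx3
    have h1 : Real.exp (-(t + D.β n - 4 * K - 6 - D.β n) ^ 2 / 2) ≤ Real.exp (-x / 16) := by
      refine Real.exp_le_exp.2 ?_
      have h2 := pow_le_pow_left₀ (by linarith) hfar 2
      rw [div_pow, Real.sq_sqrt (by linarith)] at h2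
      linarith
    have h3 : (p * (D.bandwidths n).ncard + 1) * L ≤ p * Q * L * x + L := by
      calc (p * (D.bandwidths n).ncard + 1 : ℝ) * L ≤ (p * (Q * x) + 1) * L := by gcongr
        _ = _ := by ring
    exact mul_le_mul h3 h1 (Real.exp_pos _).le (by positivity)

end Design
end CMITest

/-! ### Assembly of the three conclusions -/

theorem theorem1 {d p : ℕ} (hd : 0 < d) (hp : 0 < p)
    (D : CMITest.Design d p) (c : CMITest.ModelConstants) (hc : c.Admissible)
    (hTuning : D.TuningCondition)
    (hDesign : D.DesignPointCondition)
    (hBandwidth : D.BandwidthCondition)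
    (hEstimator : D.CovEstimator)
    (φ : ℝ) (hφ : 0 < φ) (hφ' : φ < 1 / (2 + d))
    (hVariance : D.VarianceEstimatorCondition c (1 / (2 + d) - φ))
    (hKernel : D.KernelCondition)
    (hTestFunction : D.TestFunctionCondition)
    (hTestPoints : D.TestPointCondition) :
    (∀ η : ℝ, 0 < η → ∀ᶠ n : ℕ in Filter.atTop, ∀ w : CMITest.Model d p n,
      w.InNullClass c D.X →
        1 - D.α - η ≤ D.expect w (D.acceptPIA n) ∧
        1 - D.α - η ≤ D.expect w (D.acceptRMS n)) ∧
    (∀ η : ℝ, 0 < η → ∀ᶠ n : ℕ in Filter.atTop, ∀ w : CMITest.Model d p n,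
      w.InNullClass c D.X → (∀ m x, w.f m x = 0) →
        |D.expect w (D.acceptPIA n) - (1 - D.α)| ≤ η) ∧
    (Filter.Tendsto D.γ Filter.atTop (nhds 0) →
      ∀ η : ℝ, 0 < η → ∀ᶠ n : ℕ in Filter.atTop, ∀ w : CMITest.Model d p n,
        w.InNullClass c D.X → (∀ m x, w.f m x = 0) →
          |D.expect w (D.acceptRMS n) - (1 - D.α)| ≤ η) := by
  have H : D.Assumptions c (1 / (2 + d) - φ) :=
    ⟨hd, hp, hc.2.2.2.1, hc.2.2.2.2.1, hc.2.2.2.2.2.2.1, hTuning, hDesign, hBandwidth, hEstimator,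
      by linarith, hVariance, hKernel, hTestFunction, hTestPoints⟩
  obtain ⟨A, hA, hreg⟩ := H.eventually_regularAt
  have hα0 := hTuning.1
  have hα1 := hTuning.2.1
  -- The largest total error is the 12ε of the lower bound for refined moment selection. The other
  -- requirements keep the shifted levels inside (0, 1) and the quantile level above 3/8.
  have hε : ∀ η : ℝ, 0 < η → ∃ ε : ℝ, 0 < ε ∧ 12 * ε ≤ η ∧ 8 * ε ≤ 1 - D.α ∧ 8 * ε ≤ D.α ∧
      ε ≤ 1 / 16 := fun η hη => by
    refine ⟨min (min (η / 12) ((1 - D.α) / 8)) (min (D.α / 8) (1 / 16)), ?_, ?_, ?_, ?_, ?_⟩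
    · have : 0 < 1 - D.α := by linarith
      positivity
    all_goals
      have h1 := min_le_left (min (η / 12) ((1 - D.α) / 8)) (min (D.α / 8) (1 / 16))
      have h2 := min_le_right (min (η / 12) ((1 - D.α) / 8)) (min (D.α / 8) (1 / 16))
      have h3 := min_le_left (η / 12) ((1 - D.α) / 8)
      have h4 := min_le_right (η / 12) ((1 - D.α) / 8)
      have h5 := min_le_left (D.α / 8) (1 / 16 : ℝ)
      have h6 := min_le_right (D.α / 8) (1 / 16 : ℝ)
      linarith
  refine ⟨fun η hη => ?_, fun η hη => ?_, fun hγ η hη => ?_⟩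
  · obtain ⟨ε, hε0, h1, h2, h3, h4⟩ := hε η hη
    obtain ⟨K, L, hsel⟩ := H.eventually_selectionAt hε0 (by linarith) h4
    filter_upwards [hreg, H.eventually_approxAt hε0, hsel] with n hr hap hsel w hw
    obtain ⟨B, ap⟩ := hap w hw
    obtain ⟨b, hb⟩ := hsel w hw.1.1
    have r1 := ap.le_expect_acceptPIA H hr hw hε0 (by linarith)
    have r2 := hb.le_expect_acceptRMS ap H hr hw (by linarith)
    constructor <;> linarith
  · obtain ⟨ε, hε0, h1, h2, h3, h4⟩ := hε η hη
    filter_upwards [hreg, H.eventually_approxAt hε0] with n hr hap w hw hf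
    obtain ⟨B, ap⟩ := hap w hw
    have r1 := ap.le_expect_acceptPIA H hr hw hε0 (by linarith)
    have r2 := ap.expect_acceptPIA_le H hr hw hf hε0 (by linarith)
    rw [abs_le]
    constructor <;> linarith
  · obtain ⟨ε, hε0, h1, h2, h3, h4⟩ := hε (η / 2) (by linarith)
    obtain ⟨K, L, hsel⟩ := H.eventually_selectionAt hε0 (by linarith) h4
    filter_upwards [hreg, H.eventually_approxAt hε0, hsel,
      -- The term 3γ of the upper bound takes at most η / 2, and γ < α / 4 keeps the level 1 - α +
      -- 2γ + 2ε below one.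
      hγ.eventually_lt_const (by positivity : 0 < min (η / 6) (D.α / 4))]
      with n hr hap hsel hγn w hw hf
    obtain ⟨B, ap⟩ := hap w hw
    obtain ⟨b, hb⟩ := hsel w hw.1.1
    have hγ1 := hγn.trans_le (min_le_left _ _)
    have hγ2 := hγn.trans_le (min_le_right _ _)
    have r1 := hb.le_expect_acceptRMS ap H hr hw (by linarith)
    have r2 := hb.expect_acceptRMS_le ap H hr hw hf (by linarith)
    rw [abs_le]
    constructor <;> linarith
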